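/- Let $\xi,\eta\in(0,\pi)$ be such that $\xi/\pi$ and $\eta/\pi$ are irrational, and let $w_k(x)=\sqrt{2/\pi}\,\sin kx$ for $k=1,2,\dots$. For $\alpha\in\mathbb R$ and $\beta\in\{\xi,\eta\}$ let $D^\alpha_\beta$ be the real Hilbert space obtained by completing the linear hull of the functions $w_k$ with respect to the norm $$\Bigl\|\sum a_kw_k\Bigr\|_{D^\alpha_\beta}^2=\sum k^{2\alpha}\sin^2(k\beta)\,|a_k|^2 ,$$ its elements being identified with series $\sum a_kw_k$ of finite norm, on which $\Delta$ acts by $\Delta w_k=-k^2w_k$. Put $$\mathcal H'_{\xi,\eta}=D^0_\xi\times D^0_\eta\times D^{-1}_\xi\times D^{-2}_\eta,\qquad \mathcal G=\mathbb R^2,$$ $$D(\mathcal A^*)=D(\mathcal B^*)=D^1_\xi\times D^2_\eta\times D^0_\xi\times D^0_\eta,$$ and, for $(A,B,C,D)\in\mathbb R^4$, $$\mathcal A^*(u_1,u_2,v_1,v_2)=(v_1,\;v_2,\;\Delta u_1-Au_1-Cu_2,\;-\Delta^2u_2-Bu_1-Du_2),$$ $$\mathcal B^*(u_1,u_2,v_1,v_2)=(u_1(\xi),u_2(\eta)).$$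 Assume that $\mathcal A^*$ is an operator in $\mathcal H'_{\xi,\eta}$ with this domain, i.e. that $\mathcal A^*U\in\mathcal H'_{\xi,\eta}$ for every $U\in D(\mathcal A^*)$ (for $B,C\ne0$ this means $D^2_\eta\subset D^{-1}_\xi$ and $D^1_\xi\subset D^{-2}_\eta$; it is automatic if $\xi=\eta$). Consider the observation problem $$U'=\mathcal A^*U,\quad U(0)=U_0,\quad \psi=\mathcal B^*U .$$ Then (H1) and (H3) below hold for all such $(A,B,C,D)$, and all of (H1)--(H4) hold for almost every such $(A,B,C,D)\in\mathbb R^4$ (with respect to Lebesgue measure). (H1) $\mathcal A^*$ generates a strongly continuous group $e^{t\mathcal A^*}$ of automorphisms of $\mathcal H'_{\xi,\eta}$. (H2) $D(\mathcal A^*)\subset D(\mathcal B^*)$, and there is a constant $c$ such that $\|\mathcal B^*U_0\|_{\mathcal G}\le c\,\|\mathcal A^*U_0\|_{\mathcal H'_{\xi,\eta}}$ for all $U_0\in D(\mathcal A^*)$. (H3) There are a non-degenerate bounded interval $I$ and a constant $c_I$ such that the solutions satisfy $\mathcal B^*U\in L^2(I;\mathcal G)$ and $\|\mathcal B^*U\|_{L^2(I;\mathcal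 G)}\le c_I\|U_0\|_{\mathcal H'_{\xi,\eta}}$ for all $U_0\in D(\mathcal A^*)$. (H4) There are a bounded interval $I'$ and a constant $c'>0$ such that the solutions satisfy $\mathcal B^*U\in L^2(I';\mathcal G)$ and $\|U_0\|_{\mathcal H'_{\xi,\eta}}\le c'\|\mathcal B^*U\|_{L^2(I';\mathcal G)}$ for all $U_0\in D(\mathcal A^*)$. -/

import Mathlib

open MeasureTheory Filter Topology

noncomputable section

namespace StringBeam

/-! ### The spaces `D^α_β` -/

/-- A point `β ∈ (0, π)` such that `β / π` is irrational. -/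
structure IrrPoint where
  val : ℝ
  mem_Ioo : val ∈ Set.Ioo 0 Real.pi
  irrational : Irrational (val / Real.pi)

/-- The weight `k ^ (2 α) * sin² (k β)` of the `k`-th sine coefficient in `D^α_β`. -/
def weight (α : ℝ) (β : IrrPoint) (k : ℕ+) : ℝ :=
  (k : ℝ) ^ (2 * α) * Real.sin (k * β.val) ^ 2

theorem sin_ne_zero (β : IrrPoint) (k : ℕ+) : Real.sin (k * β.val) ≠ 0 := by
  intro h
  obtain ⟨n, hn⟩ := Real.sin_eq_zero_iff.1 h
  have hk : (k : ℝ) ≠ 0 := by exact_mod_cast k.pos.ne'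
  apply β.irrational
  refine ⟨(n : ℚ) / (k : ℕ), ?_⟩
  have hpi := Real.pi_ne_zero
  push_cast
  field_simp
  linarith

theorem weight_pos (α : ℝ) (β : IrrPoint) (k : ℕ+) : 0 < weight α β k := by
  have hk : (0 : ℝ) < k := by exact_mod_cast k.pos
  have := sin_ne_zero β k
  unfold weight
  positivity

theorem weight_mono {α α' : ℝ} (h : α ≤ α') (β : IrrPoint) (k : ℕ+) :
    weight α β k ≤ weight α' β k := by
  have hk : (1 : ℝ) ≤ k := by exact_mod_cast k.pos
  unfold weight
  gcongr

theorem summable_weight_mul {α : ℝ} {β : IrrPoint} {a b : ℕ+ → ℝ}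
    (ha : Summable fun k => weight α β k * |a k| ^ 2)
    (hb : Summable fun k => weight α β k * |b k| ^ 2) :
    Summable fun k => weight α β k * (a k * b k) := by
  refine Summable.of_norm_bounded (ha.add hb) fun k => ?_
  have hw := weight_pos α β k
  rw [Real.norm_eq_abs, abs_mul, abs_mul, abs_of_pos hw]
  nlinarith [mul_nonneg hw.le (sq_nonneg (|a k| - |b k|)),
    mul_nonneg hw.le (mul_nonneg (abs_nonneg (a k)) (abs_nonneg (b k)))]

/-- The sequences of coefficients `(a_k)`, with respect to `w_k(x) = √(2/π) sin (k x)`, of the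
elements of `D^α_β`: those with `∑ k^(2α) sin²(k β) |a_k|² < ∞`. -/
def coeffs (α : ℝ) (β : IrrPoint) : Submodule ℝ (ℕ+ → ℝ) where
  carrier := {a | Summable fun k => weight α β k * |a k| ^ 2}
  zero_mem' := by simp
  add_mem' := by
    intro a b ha hb
    simp only [Set.mem_ofPred_eq] at *
    refine ((ha.add ((summable_weight_mul ha hb).mul_left 2)).add hb).congr fun k => ?_
    simp only [Pi.add_apply, sq_abs]
    ring
  smul_mem' := by
    intro c a ha
    simp only [Set.mem_ofPred_eq] at *
    refine (ha.mul_left (c ^ 2)).congr fun k => ?_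
    simp only [Pi.smul_apply, smul_eq_mul, sq_abs]
    ring

theorem mem_coeffs {α : ℝ} {β : IrrPoint} {a : ℕ+ → ℝ} :
    a ∈ coeffs α β ↔ Summable fun k => weight α β k * |a k| ^ 2 := Iff.rfl

theorem coeffs_anti {α α' : ℝ} (h : α ≤ α') (β : IrrPoint) : coeffs α' β ≤ coeffs α β := by
  intro a ha
  rw [mem_coeffs] at *
  refine Summable.of_nonneg_of_le (fun k => ?_) (fun k => ?_) ha
  · have := weight_pos α β k
    positivity
  · have := weight_mono h β k
    gcongr

/-- The Hilbert space `D^α_β`: the completion of the linear hull `Z` of the functions `w_k`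
for the norm `‖∑ a_k w_k‖² = ∑ k^(2α) sin²(k β) |a_k|²`. It is realised as the space of
the formal series `∑ a_k w_k` of finite norm; `DSpace.norm_sq_eq`, the `CompleteSpace` instance and
`DSpace.dense_Z` below say that this is the completion. -/
def DSpace (α : ℝ) (β : IrrPoint) : Type := coeffs α β

namespace DSpace

variable {α : ℝ} {β : IrrPoint}

instance : AddCommGroup (DSpace α β) := inferInstanceAs (AddCommGroup (coeffs α β))

instance : Module ℝ (DSpace α β) := inferInstanceAs (Module ℝ (coeffs α β))

/-- The sequence of coefficients `(a_k)` of `∑ a_k w_k`. -/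
def coeff : DSpace α β →ₗ[ℝ] (ℕ+ → ℝ) := (coeffs α β).subtype

/-- The element `∑ a_k w_k` with given coefficients. -/
def mk (a : ℕ+ → ℝ) (ha : a ∈ coeffs α β) : DSpace α β := ⟨a, ha⟩

@[simp] theorem coeff_mk (a : ℕ+ → ℝ) (ha : a ∈ coeffs α β) :
    coeff (mk a ha : DSpace α β) = a := rfl

theorem coeff_mem (u : DSpace α β) : coeff u ∈ coeffs α β := u.2

theorem coeff_injective : Function.Injective (coeff : DSpace α β → ℕ+ → ℝ) :=
  Subtype.val_injective

@[ext] theorem ext {u v : DSpace α β} (h : ∀ k, coeff u k = coeff v k) : u = v :=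
  coeff_injective (funext h)

theorem summable (u v : DSpace α β) :
    Summable fun k => weight α β k * (coeff u k * coeff v k) :=
  summable_weight_mul u.coeff_mem v.coeff_mem

/-- The inner product `∑ k^(2α) sin²(k β) a_k b_k`. -/
@[reducible] def core (α : ℝ) (β : IrrPoint) : InnerProductSpace.Core ℝ (DSpace α β) where
  inner u v := ∑' k, weight α β k * (coeff u k * coeff v k)
  conj_inner_symm u v := by
    simp only [conj_trivial]
    exact tsum_congr fun k => by ring
  re_inner_nonneg u := by
    refine tsum_nonneg fun k => ?_
    have := weight_pos α β k
    have := mul_self_nonneg (coeff u k)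
    positivity
  add_left u v w := by
    rw [← (summable u w).tsum_add (summable v w)]
    exact tsum_congr fun k => by simp only [map_add, Pi.add_apply]; ring
  smul_left u v c := by
    rw [← tsum_mul_left]
    exact tsum_congr fun k => by
      simp only [map_smul, Pi.smul_apply, smul_eq_mul, conj_trivial]; ring
  definite u hu := by
    have h0 : ∀ k, 0 ≤ weight α β k * (coeff u k * coeff u k) := fun k =>
      mul_nonneg (weight_pos α β k).le (mul_self_nonneg _)
    have h1 := (hasSum_zero_iff_of_nonneg h0).1 (hu ▸ (summable u u).hasSum)
    ext k
    have h2 := congrFun h1 k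
    simpa [(weight_pos α β k).ne'] using h2

instance : NormedAddCommGroup (DSpace α β) := (core α β).toNormedAddCommGroup

instance : InnerProductSpace ℝ (DSpace α β) := InnerProductSpace.ofCore (core α β).toCore

theorem norm_sq_eq (u : DSpace α β) : ‖u‖ ^ 2 = ∑' k, weight α β k * |coeff u k| ^ 2 := by
  rw [← real_inner_self_eq_norm_sq]
  change ∑' k, weight α β k * (coeff u k * coeff u k) = _
  exact tsum_congr fun k => by rw [sq_abs, sq]

/-- The isometry of `D^α_β` onto `ℓ²` given by `a_k ↦ k^α |sin (k β)| a_k`. -/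
def toEll2 (α : ℝ) (β : IrrPoint) : DSpace α β ≃ₗᵢ[ℝ] lp (fun _ : ℕ+ => ℝ) 2 where
  toFun u := ⟨fun k => √(weight α β k) * coeff u k, by
    refine (memℓp_gen_iff (by norm_num)).2 ?_
    refine u.coeff_mem.congr fun k => ?_
    have := Real.sq_sqrt (weight_pos α β k).le
    simp only [Real.norm_eq_abs, ENNReal.toReal_ofNat, Real.rpow_ofNat, sq_abs, mul_pow, this]⟩
  invFun x := mk (fun k => (√(weight α β k))⁻¹ * x k) (by
    have hx := (memℓp_gen_iff (by norm_num)).1 x.2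
    rw [mem_coeffs]
    refine hx.congr fun k => ?_
    have h := Real.sq_sqrt (weight_pos α β k).le
    have h' := (weight_pos α β k).ne'
    simp only [Real.norm_eq_abs, ENNReal.toReal_ofNat, Real.rpow_ofNat, sq_abs, mul_pow, inv_pow, h]
    field_simp)
  map_add' u v := by
    ext k
    simp only [map_add, Pi.add_apply, lp.coeFn_add]
    ring
  map_smul' c u := by
    ext k
    simp only [map_smul, Pi.smul_apply, lp.coeFn_smul, smul_eq_mul, RingHom.id_apply]
    ring
  left_inv u := by
    ext k
    have h' := (Real.sqrt_pos.2 (weight_pos α β k)).ne'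
    simp only [coeff_mk]
    field_simp
  right_inv x := by
    ext k
    have h' := (Real.sqrt_pos.2 (weight_pos α β k)).ne'
    simp only [coeff_mk]
    field_simp
  norm_map' u := by
    rw [← sq_eq_sq₀ (norm_nonneg _) (norm_nonneg _), norm_sq_eq,
      ← real_inner_self_eq_norm_sq, lp.inner_eq_tsum]
    refine tsum_congr fun k => ?_
    have h := Real.mul_self_sqrt (weight_pos α β k).le
    change (√(weight α β k) * coeff u k) * (√(weight α β k) * coeff u k) = _
    rw [sq_abs]
    linear_combination (coeff u k) ^ 2 * h

instance : CompleteSpace (DSpace α β) :=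
  (completeSpace_congr (e := (toEll2 α β).toEquiv) (toEll2 α β).isometry.isUniformEmbedding).2
    inferInstance

/-- The basis function `w_k`, as an element of `D^α_β`. -/
def basisFun (α : ℝ) (β : IrrPoint) (k : ℕ+) : DSpace α β :=
  mk (Pi.single k 1) (by
    refine summable_of_hasFiniteSupport ((Set.finite_singleton k).subset fun j hj => ?_)
    by_contra hjk
    simp at hj
    exact hjk hj.2)

theorem dense_Z (α : ℝ) (β : IrrPoint) :
    Dense (Submodule.span ℝ (Set.range (basisFun α β)) : Set (DSpace α β)) := by
  intro u
  have h := (lp.hasSum_single (by norm_num) (toEll2 α β u)).map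
    (toEll2 α β).symm.toLinearEquiv.toLinearMap (toEll2 α β).symm.continuous
  have h2 : (toEll2 α β).symm.toLinearEquiv.toLinearMap (toEll2 α β u) = u :=
    (toEll2 α β).symm_apply_apply u
  rw [h2] at h
  refine mem_closure_of_tendsto h (Eventually.of_forall fun s => ?_)
  refine Submodule.sum_mem _ fun k _ => ?_
  have h3 : (toEll2 α β).symm.toLinearEquiv.toLinearMap (lp.single 2 k (toEll2 α β u k))
      = coeff u k • basisFun α β k := by
    apply (toEll2 α β).injective
    change (toEll2 α β) ((toEll2 α β).symm _) = _
    rw [(toEll2 α β).apply_symm_apply]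
    ext j
    change (Pi.single k (√(weight α β k) * coeff u k) : ℕ+ → ℝ) j
      = √(weight α β j) * (coeff u k * (Pi.single k (1 : ℝ) : ℕ+ → ℝ) j)
    by_cases hj : j = k
    · subst hj; simp
    · simp [Pi.single_eq_of_ne hj]
  change (toEll2 α β).symm.toLinearEquiv.toLinearMap (lp.single 2 k (toEll2 α β u k)) ∈ _
  rw [h3]
  exact Submodule.smul_mem _ _ (Submodule.subset_span ⟨k, rfl⟩)

end DSpace

/-! ### The state space and the operators -/

/-- The Hilbert space `𝓗'_{ξ,η} = D^0_ξ × D^0_η × D^{-1}_ξ × D^{-2}_η`, with elements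
`U = (u₁, u₂, v₁, v₂)` bracketed as `((u₁, u₂), (v₁, v₂))`. -/
abbrev StateSpace (ξ η : IrrPoint) : Type :=
  WithLp 2 (WithLp 2 (DSpace 0 ξ × DSpace 0 η) × WithLp 2 (DSpace (-1) ξ × DSpace (-2) η))

section State

variable {ξ η : IrrPoint}

/-- Coefficients of `u₁`. -/
def u₁ : StateSpace ξ η →ₗ[ℝ] (ℕ+ → ℝ) where
  toFun U := DSpace.coeff U.fst.fst
  map_add' _ _ := map_add DSpace.coeff _ _
  map_smul' _ _ := map_smul DSpace.coeff _ _

/-- Coefficients of `u₂`. -/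
def u₂ : StateSpace ξ η →ₗ[ℝ] (ℕ+ → ℝ) where
  toFun U := DSpace.coeff U.fst.snd
  map_add' _ _ := map_add DSpace.coeff _ _
  map_smul' _ _ := map_smul DSpace.coeff _ _

/-- Coefficients of `v₁`. -/
def v₁ : StateSpace ξ η →ₗ[ℝ] (ℕ+ → ℝ) where
  toFun U := DSpace.coeff U.snd.fst
  map_add' _ _ := map_add DSpace.coeff _ _
  map_smul' _ _ := map_smul DSpace.coeff _ _

/-- Coefficients of `v₂`. -/
def v₂ : StateSpace ξ η →ₗ[ℝ] (ℕ+ → ℝ) where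
  toFun U := DSpace.coeff U.snd.snd
  map_add' _ _ := map_add DSpace.coeff _ _
  map_smul' _ _ := map_smul DSpace.coeff _ _

/-- The element of the state space with the given coefficients. -/
def mkState (a₁ a₂ b₁ b₂ : ℕ+ → ℝ) (ha₁ : a₁ ∈ coeffs 0 ξ) (ha₂ : a₂ ∈ coeffs 0 η)
    (hb₁ : b₁ ∈ coeffs (-1) ξ) (hb₂ : b₂ ∈ coeffs (-2) η) : StateSpace ξ η :=
  WithLp.toLp 2 (WithLp.toLp 2 (DSpace.mk a₁ ha₁, DSpace.mk a₂ ha₂),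
    WithLp.toLp 2 (DSpace.mk b₁ hb₁, DSpace.mk b₂ hb₂))

@[simp] theorem u₁_mkState {a₁ a₂ b₁ b₂ : ℕ+ → ℝ} (ha₁ : a₁ ∈ coeffs 0 ξ) (ha₂ : a₂ ∈ coeffs 0 η)
    (hb₁ : b₁ ∈ coeffs (-1) ξ) (hb₂ : b₂ ∈ coeffs (-2) η) :
    u₁ (mkState a₁ a₂ b₁ b₂ ha₁ ha₂ hb₁ hb₂) = a₁ := rfl

@[simp] theorem u₂_mkState {a₁ a₂ b₁ b₂ : ℕ+ → ℝ} (ha₁ : a₁ ∈ coeffs 0 ξ) (ha₂ : a₂ ∈ coeffs 0 η)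
    (hb₁ : b₁ ∈ coeffs (-1) ξ) (hb₂ : b₂ ∈ coeffs (-2) η) :
    u₂ (mkState a₁ a₂ b₁ b₂ ha₁ ha₂ hb₁ hb₂) = a₂ := rfl

@[simp] theorem v₁_mkState {a₁ a₂ b₁ b₂ : ℕ+ → ℝ} (ha₁ : a₁ ∈ coeffs 0 ξ) (ha₂ : a₂ ∈ coeffs 0 η)
    (hb₁ : b₁ ∈ coeffs (-1) ξ) (hb₂ : b₂ ∈ coeffs (-2) η) :
    v₁ (mkState a₁ a₂ b₁ b₂ ha₁ ha₂ hb₁ hb₂) = b₁ := rfl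

@[simp] theorem v₂_mkState {a₁ a₂ b₁ b₂ : ℕ+ → ℝ} (ha₁ : a₁ ∈ coeffs 0 ξ) (ha₂ : a₂ ∈ coeffs 0 η)
    (hb₁ : b₁ ∈ coeffs (-1) ξ) (hb₂ : b₂ ∈ coeffs (-2) η) :
    v₂ (mkState a₁ a₂ b₁ b₂ ha₁ ha₂ hb₁ hb₂) = b₂ := rfl

theorem state_ext {U V : StateSpace ξ η} (h₁ : u₁ U = u₁ V) (h₂ : u₂ U = u₂ V)
    (h₃ : v₁ U = v₁ V) (h₄ : v₂ U = v₂ V) : U = V := by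
  apply WithLp.ofLp_injective
  refine Prod.ext (WithLp.ofLp_injective _ (Prod.ext ?_ ?_))
    (WithLp.ofLp_injective _ (Prod.ext ?_ ?_))
  exacts [DSpace.coeff_injective h₁, DSpace.coeff_injective h₂, DSpace.coeff_injective h₃,
    DSpace.coeff_injective h₄]

end State

/-- The Laplacian `Δ = d²/dx²`, term by term in the sine series: `Δ w_k = -k² w_k`. -/
def lap : (ℕ+ → ℝ) →ₗ[ℝ] (ℕ+ → ℝ) where
  toFun a k := -(k : ℝ) ^ 2 * a k
  map_add' a b := by ext k; simp only [Pi.add_apply]; ring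
  map_smul' c a := by
    ext k; simp only [Pi.smul_apply, smul_eq_mul, RingHom.id_apply]; ring

/-- The third component `Δ u₁ - A u₁ - C u₂` of `𝒜* (u₁, u₂, v₁, v₂)`. -/
def stringForce (A C : ℝ) (a₁ a₂ : ℕ+ → ℝ) : ℕ+ → ℝ := lap a₁ - A • a₁ - C • a₂

/-- The fourth component `-Δ² u₂ - B u₁ - D u₂` of `𝒜* (u₁, u₂, v₁, v₂)`. -/
def beamForce (B D : ℝ) (a₁ a₂ : ℕ+ → ℝ) : ℕ+ → ℝ := -lap (lap a₂) - B • a₁ - D • a₂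

/-- `D(𝒜*) = D(ℬ*) = D^1_ξ × D^2_η × D^0_ξ × D^0_η`, as a subspace of `𝓗'_{ξ,η}`. -/
def dom (ξ η : IrrPoint) : Submodule ℝ (StateSpace ξ η) :=
  (coeffs 1 ξ).comap u₁ ⊓ (coeffs 2 η).comap u₂ ⊓ (coeffs 0 ξ).comap v₁ ⊓ (coeffs 0 η).comap v₂

theorem mem_dom {ξ η : IrrPoint} {U : StateSpace ξ η} :
    U ∈ dom ξ η ↔ ((u₁ U ∈ coeffs 1 ξ ∧ u₂ U ∈ coeffs 2 η) ∧ v₁ U ∈ coeffs 0 ξ) ∧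
      v₂ U ∈ coeffs 0 η := Iff.rfl

/-- `𝒜*` takes its values on `D(𝒜*)` in `𝓗'_{ξ,η}`, i.e. the formula for `𝒜*` defines an
operator in `𝓗'_{ξ,η}` with domain `D(𝒜*)`. (The first two components of `𝒜* U` always lie in
`D^0_ξ` and `D^0_η`.) -/
def MapsDomIntoState (A B C D : ℝ) (ξ η : IrrPoint) : Prop :=
  ∀ U ∈ dom ξ η, stringForce A C (u₁ U) (u₂ U) ∈ coeffs (-1) ξ ∧
    beamForce B D (u₁ U) (u₂ U) ∈ coeffs (-2) η

/-- `𝒜* (u₁, u₂, v₁, v₂) = (v₁, v₂, Δ u₁ - A u₁ - C u₂, -Δ² u₂ - B u₁ - D u₂)` as an unbounded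
operator in `𝓗'_{ξ,η}` with domain `D^1_ξ × D^2_η × D^0_ξ × D^0_η`. -/
def opA {A B C D : ℝ} {ξ η : IrrPoint} (h : MapsDomIntoState A B C D ξ η) :
    StateSpace ξ η →ₗ.[ℝ] StateSpace ξ η where
  domain := dom ξ η
  toFun :=
    { toFun := fun U => mkState (v₁ U.1) (v₂ U.1) (stringForce A C (u₁ U.1) (u₂ U.1))
        (beamForce B D (u₁ U.1) (u₂ U.1)) U.2.1.2 U.2.2 (h U.1 U.2).1 (h U.1 U.2).2
      map_add' := by
        intro U V
        apply state_ext
        · rw [map_add]; simp only [u₁_mkState, Submodule.coe_add, map_add]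
        · rw [map_add]; simp only [u₂_mkState, Submodule.coe_add, map_add]
        · rw [map_add]; simp only [v₁_mkState, Submodule.coe_add, map_add, stringForce, smul_add]
          abel
        · rw [map_add]; simp only [v₂_mkState, Submodule.coe_add, map_add, beamForce, smul_add]
          abel
      map_smul' := by
        intro c U
        apply state_ext
        · rw [map_smul]; simp only [u₁_mkState, Submodule.coe_smul, map_smul, RingHom.id_apply]
        · rw [map_smul]; simp only [u₂_mkState, Submodule.coe_smul, map_smul, RingHom.id_apply]
        · rw [map_smul]
          simp only [v₁_mkState, Submodule.coe_smul, map_smul, RingHom.id_apply, stringForce,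
            smul_sub, smul_comm c]
        · rw [map_smul]
          simp only [v₂_mkState, Submodule.coe_smul, map_smul, RingHom.id_apply, beamForce,
            smul_sub, smul_neg, smul_comm c] }

/-- `w_k(x) = √(2/π) sin (k x)`. -/
def w (k : ℕ+) (x : ℝ) : ℝ := √(2 / Real.pi) * Real.sin (k * x)

/-- The value at `x` of `∑ a_k w_k`. -/
def valueAt (x : ℝ) (a : ℕ+ → ℝ) : ℝ := ∑' k, a k * w k x

/-- The series for the point value at `β` converges absolutely on `D^1_β`. -/
theorem summable_valueAt {β : IrrPoint} {a : ℕ+ → ℝ} (ha : a ∈ coeffs 1 β) :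
    Summable fun k => a k * w k β.val := by
  have h1 : Summable fun k : ℕ+ => ((k : ℝ) ^ 2)⁻¹ :=
    (Real.summable_nat_pow_inv.2 (by norm_num : 1 < 2)).comp_injective
      (i := fun k : ℕ+ => (k : ℕ)) PNat.coe_injective
  refine Summable.of_norm_bounded ((h1.add (mem_coeffs.1 ha)).mul_left √(2 / Real.pi)) fun k => ?_
  have hk : (0 : ℝ) < k := by exact_mod_cast k.pos
  have hw : weight 1 β k = (k : ℝ) ^ 2 * Real.sin (k * β.val) ^ 2 := by
    simp [weight]
  have key : |a k| * |Real.sin (k * β.val)| ≤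
      ((k : ℝ) ^ 2)⁻¹ + (k : ℝ) ^ 2 * Real.sin (k * β.val) ^ 2 * |a k| ^ 2 := by
    have e : |a k| * |Real.sin (k * β.val)| =
        (k : ℝ)⁻¹ * ((k : ℝ) * |Real.sin (k * β.val)| * |a k|) := by
      field_simp
    rw [e, ← inv_pow, ← sq_abs (Real.sin _)]
    nlinarith [sq_nonneg ((k : ℝ)⁻¹ - (k : ℝ) * |Real.sin (k * β.val)| * |a k|),
      sq_nonneg ((k : ℝ)⁻¹), sq_nonneg ((k : ℝ) * |Real.sin (k * β.val)| * |a k|)]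
  rw [hw, w, Real.norm_eq_abs, abs_mul, abs_mul, abs_of_nonneg (Real.sqrt_nonneg _)]
  calc |a k| * (√(2 / Real.pi) * |Real.sin (k * β.val)|)
      = √(2 / Real.pi) * (|a k| * |Real.sin (k * β.val)|) := by ring
    _ ≤ _ := by gcongr

theorem valueAt_add {β : IrrPoint} {a b : ℕ+ → ℝ} (ha : a ∈ coeffs 1 β) (hb : b ∈ coeffs 1 β) :
    valueAt β.val (a + b) = valueAt β.val a + valueAt β.val b := by
  unfold valueAt
  rw [← (summable_valueAt ha).tsum_add (summable_valueAt hb)]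
  exact tsum_congr fun k => by simp only [Pi.add_apply]; ring

theorem valueAt_smul (x c : ℝ) (a : ℕ+ → ℝ) : valueAt x (c • a) = c * valueAt x a := by
  unfold valueAt
  rw [← tsum_mul_left]
  exact tsum_congr fun k => by simp only [Pi.smul_apply, smul_eq_mul]; ring

/-- `ℬ* (u₁, u₂, v₁, v₂) = (u₁(ξ), u₂(η))` as an operator from `𝓗'_{ξ,η}` to `𝒢 = ℝ²` with domain
`D^1_ξ × D^2_η × D^0_ξ × D^0_η`. -/
def opB (ξ η : IrrPoint) : StateSpace ξ η →ₗ.[ℝ] EuclideanSpace ℝ (Fin 2) where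
  domain := dom ξ η
  toFun :=
    { toFun := fun U => !₂[valueAt ξ.val (u₁ U.1), valueAt η.val (u₂ U.1)]
      map_add' := by
        intro U V
        have h₁ := valueAt_add U.2.1.1.1 V.2.1.1.1
        have h₂ := valueAt_add (coeffs_anti one_le_two η U.2.1.1.2)
          (coeffs_anti one_le_two η V.2.1.1.2)
        ext i
        fin_cases i
        · simpa using h₁
        · simpa using h₂
      map_smul' := by
        intro c U
        ext i
        fin_cases i
        · simp [valueAt_smul]
        · simp [valueAt_smul] }

/-! ### Strongly continuous groups, solutions, and the four hypotheses -/

section Abstract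

variable {X G : Type*} [NormedAddCommGroup X] [NormedSpace ℝ X]
  [NormedAddCommGroup G] [NormedSpace ℝ G]

/-- `S` is a strongly continuous group of bounded operators on `X`. -/
structure IsStronglyContinuousGroup (S : ℝ → X →L[ℝ] X) : Prop where
  map_zero : S 0 = ContinuousLinearMap.id ℝ X
  map_add : ∀ s t, S (s + t) = (S s).comp (S t)
  continuous : ∀ x, Continuous fun t => S t x

/-- `A` is the infinitesimal generator of `S`: `x ∈ D(A)` and `A x = y` if and only if
`(S t x - x) / t → y` as `t → 0`. -/
def IsGeneratorOf (A : X →ₗ.[ℝ] X) (S : ℝ → X →L[ℝ] X) : Prop :=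
  ∀ x y, (x, y) ∈ A.graph ↔ Tendsto (fun t : ℝ => t⁻¹ • (S t x - x)) (𝓝[≠] 0) (𝓝 y)

/-- `U` is a solution of `U' = A U` on `ℝ`, `U 0 = U₀`. -/
structure IsSolution (A : X →ₗ.[ℝ] X) (U₀ : X) (U : ℝ → X) : Prop where
  init : U 0 = U₀
  mem : ∀ t, U t ∈ A.domain
  hasDerivAt : ∀ t, HasDerivAt U (A ⟨U t, mem t⟩) t

/-- The norm of `f` in `L²(a, b; G)`, for `f` in that space. -/
def L2norm (a b : ℝ) (f : ℝ → G) : ℝ := √(∫ t in Set.Icc a b, ‖f t‖ ^ 2)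

/-- `A` generates a strongly continuous group. -/
def HypH1 (A : X →ₗ.[ℝ] X) : Prop :=
  ∃ S : ℝ → X →L[ℝ] X, IsStronglyContinuousGroup S ∧ IsGeneratorOf A S

/-- `D(A) ⊆ D(B)` and `‖B U₀‖ ≤ c ‖A U₀‖` for all `U₀ ∈ D(A)`. -/
def HypH2 (A : X →ₗ.[ℝ] X) (B : X →ₗ.[ℝ] G) : Prop :=
  ∃ hAB : A.domain ≤ B.domain, ∃ c : ℝ,
    ∀ U₀ : A.domain, ‖B ⟨U₀.1, hAB U₀.2⟩‖ ≤ c * ‖A U₀‖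

/-- Direct inequality: `‖B U‖_{L²(I; G)} ≤ c ‖U₀‖` for the solutions with `U₀ ∈ D(A)`, for some
non-degenerate bounded interval `I`. -/
def HypH3 (A : X →ₗ.[ℝ] X) (B : X →ₗ.[ℝ] G) : Prop :=
  ∃ hAB : A.domain ≤ B.domain, ∃ a b c : ℝ, a < b ∧
    ∀ U₀ ∈ A.domain, ∀ U : ℝ → X, ∀ hU : IsSolution A U₀ U,
      MemLp (fun t => B ⟨U t, hAB (hU.mem t)⟩) 2 (volume.restrict (Set.Icc a b)) ∧
      L2norm a b (fun t => B ⟨U t, hAB (hU.mem t)⟩) ≤ c * ‖U₀‖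

/-- Inverse inequality: `‖U₀‖ ≤ c' ‖B U‖_{L²(I'; G)}` for the solutions with `U₀ ∈ D(A)`, for some
bounded interval `I'` and some `c' > 0`. -/
def HypH4 (A : X →ₗ.[ℝ] X) (B : X →ₗ.[ℝ] G) : Prop :=
  ∃ hAB : A.domain ≤ B.domain, ∃ a b c' : ℝ, a < b ∧ 0 < c' ∧
    ∀ U₀ ∈ A.domain, ∀ U : ℝ → X, ∀ hU : IsSolution A U₀ U,
      MemLp (fun t => B ⟨U t, hAB (hU.mem t)⟩) 2 (volume.restrict (Set.Icc a b)) ∧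
      ‖U₀‖ ≤ c' * L2norm a b (fun t => B ⟨U t, hAB (hU.mem t)⟩)

end Abstract

end StringBeam

end

noncomputable section

open MeasureTheory Filter Topology

namespace StringBeam

/-! ### Block-diagonal groups on `ℓ²` -/

section Blocks

set_option linter.unusedSectionVars false

variable {ι E : Type*} [NormedAddCommGroup E] [NormedSpace ℝ E]

/-! Multiply the coefficients of the mode `k` in `u₁, u₂, v₁, v₂` by `sin kξ`, `sin kη`, `sin kξ /
k`, `sin kη / k²`. This maps the state space isometrically onto `ℓ²(ℕ+; ℝ⁴)` (`rescale`), makes `𝒜*`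
block diagonal with 4×4 blocks `M_k` (`blockGen`), and turns `ℬ*` into `√(2/π)` times the sum over
`k` of the first two coordinates. Small divisors survive only in the couplings `g_k = C sin kξ / sin
kη` and `h_k = B sin kη / sin kξ`. Their product is the constant `BC`, and the assumption that `𝒜*`
maps its domain into the state space forces `|g_k|, |h_k| ≤ c k³` (`exists_isCoupling`).

For large `k` the eigenvalues of a block depend on the couplings only through `g_k h_k`, and the gap
of order `k⁴` beats the growth `k³`: the frequencies are `k + O(1/k)` and `k² + O(1/k)`, and the
modes mix by `O(1/k)` in the positions (`exists_rotations`). Hence the flows of the high blocks are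
uniformly bounded, which gives the group. The graph estimate identifies its maximal domain with
`D(𝒜*)`, whence (H1). On a bounded time interval the observation of a high block is `O(1/k)`-close
to rotations of integer frequencies `k` and `k²`, and these are orthogonal over whole periods. Since
`∑ 1/k²` converges, Cauchy–Schwarz bounds the total error. This gives (H3), through
`bessel_blockGen`, and, once finitely many blocks are dropped, the inverse inequality
(`exists_high_blocks_observable`).

The dropped blocks are recovered by a compactness-uniqueness argument (`exists_observability`).
States unobserved for a long time lie in the domain of powers of the generator, so polynomials in
the generator can be applied to them. Products of characteristic polynomials of low blocks remove
all but one block, and a single block is observable because its positions determine its velocities.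
This needs blocks with pairwise disjoint spectra; (H2) needs invertible blocks and follows from
Cramer's rule. Both conditions (`Generic`) exclude countably many sets `φ(A, D) = q BC` with `q ≠
0`, which are null by Fubini (`ae_generic`). -/

theorem ell2_summable (z : lp (fun _ : ι => E) 2) : Summable fun k => ‖z k‖ ^ 2 := by
  simpa using (lp.memℓp z).summable (by norm_num)

theorem ell2_norm_sq (z : lp (fun _ : ι => E) 2) : ‖z‖ ^ 2 = ∑' k, ‖z k‖ ^ 2 := by
  simpa using lp.norm_rpow_eq_tsum (by norm_num) z

theorem memℓp_two_of_summable {f : ι → E} (h : Summable fun k => ‖f k‖ ^ 2) :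
    Memℓp f 2 := (memℓp_gen_iff (by norm_num)).2 (by simpa using h)

theorem memℓp_of_norm_le {f : ι → E} (z : lp (fun _ : ι => E) 2) (C : ℝ)
    (h : ∀ k, ‖f k‖ ≤ C * ‖z k‖) : Memℓp f 2 := by
  refine memℓp_two_of_summable (Summable.of_nonneg_of_le (fun k => by positivity) (fun k => ?_)
    ((ell2_summable z).mul_left (C ^ 2)))
  rw [← mul_pow]
  exact pow_le_pow_left₀ (norm_nonneg _) (h k) 2

theorem ell2_norm_le {z z' : lp (fun _ : ι => E) 2} {C : ℝ} (hC : 0 ≤ C)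
    (h : ∀ k, ‖z' k‖ ≤ C * ‖z k‖) : ‖z'‖ ≤ C * ‖z‖ := by
  refine le_of_sq_le_sq ?_ (by positivity)
  rw [mul_pow, ell2_norm_sq, ell2_norm_sq, ← tsum_mul_left]
  refine (ell2_summable z').tsum_le_tsum (fun k => ?_) ((ell2_summable z).mul_left _)
  rw [← mul_pow]
  exact pow_le_pow_left₀ (norm_nonneg _) (h k) 2

/-- The block-diagonal operator on `ℓ²` with uniformly bounded blocks `T k`. -/
def blockOp (T : ι → E →L[ℝ] E) (hT : ∃ C, ∀ k, ‖T k‖ ≤ C) :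
    lp (fun _ : ι => E) 2 →L[ℝ] lp (fun _ : ι => E) 2 :=
  LinearMap.mkContinuous
    { toFun := fun z => ⟨fun k => T k (z k), memℓp_of_norm_le z hT.choose fun k =>
        (T k).le_of_opNorm_le (hT.choose_spec k) _⟩
      map_add' := fun x y => by ext k; exact map_add (T k) _ _
      map_smul' := fun c x => by ext k; exact map_smul (T k) _ _ } (max hT.choose 0) (fun z => by
        refine ell2_norm_le (le_max_right _ _) fun k => ?_
        exact (T k).le_of_opNorm_le ((hT.choose_spec k).trans (le_max_left _ _)) _)

@[simp] theorem blockOp_apply (T : ι → E →L[ℝ] E) (hT : ∃ C, ∀ k, ‖T k‖ ≤ C)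
    (z : lp (fun _ : ι => E) 2) (k : ι) : blockOp T hT z k = T k (z k) := rfl

/-- Dominated convergence in `ℓ²`. -/
theorem ell2_tendsto_of_dominated {τ : Type*} {l : Filter τ} {f : τ → lp (fun _ : ι => E) 2}
    {g : lp (fun _ : ι => E) 2} {b : ι → ℝ} (hb : Summable fun k => b k ^ 2)
    (hfg : ∀ k, Tendsto (fun t => f t k) l (𝓝 (g k)))
    (hle : ∀ᶠ t in l, ∀ k, ‖f t k - g k‖ ≤ b k) : Tendsto f l (𝓝 g) := by
  rw [tendsto_iff_norm_sub_tendsto_zero]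
  have h : Tendsto (fun t => ∑' k, ‖f t k - g k‖ ^ 2) l (𝓝 (∑' _ : ι, (0 : ℝ))) := by
    refine tendsto_tsum_of_dominated_convergence hb (fun k => ?_) ?_
    · have := (tendsto_iff_norm_sub_tendsto_zero.1 (hfg k)).pow 2
      simpa using this
    · filter_upwards [hle] with t ht k
      rw [Real.norm_eq_abs, abs_of_nonneg (by positivity)]
      exact pow_le_pow_left₀ (norm_nonneg _) (ht k) 2
  rw [tsum_zero] at h
  have h2 := h.sqrt
  rw [Real.sqrt_zero] at h2
  refine h2.congr fun t => ?_
  rw [← Real.sqrt_sq (norm_nonneg (f t - g)), ell2_norm_sq]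
  rfl

/-! ### Flows of the blocks and the group they generate on `ℓ²` -/

section Flow

variable [CompleteSpace E]

/-- The flow `e^{tM}` of the linear equation `z' = M z`. -/
def flow (M : E →L[ℝ] E) (t : ℝ) : E →L[ℝ] E := NormedSpace.exp (t • M)

theorem flow_zero (M : E →L[ℝ] E) : flow M 0 = ContinuousLinearMap.id ℝ E := by
  simp [flow, NormedSpace.exp_zero, ContinuousLinearMap.one_def]

theorem flow_add (M : E →L[ℝ] E) (s t : ℝ) : flow M (s + t) = (flow M s).comp (flow M t) := by
  unfold flow
  let _ : NormedAlgebra ℚ (E →L[ℝ] E) := NormedAlgebra.restrictScalars ℚ ℝ _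
  rw [add_smul, NormedSpace.exp_add_of_commute (((Commute.refl M).smul_left s).smul_right t)]
  rfl

theorem hasDerivAt_flow_apply (M : E →L[ℝ] E) (z : E) (t : ℝ) :
    HasDerivAt (fun t => flow M t z) (M (flow M t z)) t :=
  (hasDerivAt_exp_smul_const' M t).clm_apply (hasDerivAt_const t z) |>.congr_deriv (by simp [flow])

theorem hasDerivAt_flow_apply' (M : E →L[ℝ] E) (z : E) (t : ℝ) :
    HasDerivAt (fun t => flow M t z) (flow M t (M z)) t :=
  (hasDerivAt_exp_smul_const M t).clm_apply (hasDerivAt_const t z) |>.congr_deriv (by simp [flow])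

theorem continuous_flow_apply (M : E →L[ℝ] E) (z : E) : Continuous fun t => flow M t z :=
  continuous_iff_continuousAt.2 fun t => (hasDerivAt_flow_apply M z t).continuousAt

/-- Uniqueness for `z' = M z`. -/
theorem eq_flow_of_hasDerivAt {M : E →L[ℝ] E} {z : ℝ → E}
    (hz : ∀ t, HasDerivAt z (M (z t)) t) (t : ℝ) : z t = flow M t (z 0) := by
  have h1 : ∀ t, HasDerivAt (fun t => flow M (-t) (z t)) 0 t := by
    intro t
    have hd : HasDerivAt (fun t : ℝ => flow M (-t)) (-(flow M (-t) * M)) t := by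
      have := (hasDerivAt_exp_smul_const M (-t)).scomp t (hasDerivAt_neg t)
      simpa [Function.comp_def, flow] using this
    refine (hd.clm_apply (hz t)).congr_deriv ?_
    simp
  have h2 : flow M (-t) (z t) = flow M (-0) (z 0) :=
    is_const_of_deriv_eq_zero (fun t => (h1 t).differentiableAt) (fun t => (h1 t).deriv) t 0
  have h3 : flow M t (flow M (-t) (z t)) = z t := by
    rw [← ContinuousLinearMap.comp_apply, ← flow_add, add_neg_cancel, flow_zero]; rfl
  rw [← h3, h2, neg_zero, flow_zero]; rfl

theorem continuous_flow (M : E →L[ℝ] E) : Continuous (flow M) :=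
  continuous_iff_continuousAt.2 fun t => (hasDerivAt_exp_smul_const M t).continuousAt

theorem exists_norm_flow_le (M : E →L[ℝ] E) (T : ℝ) : ∃ C, ∀ t, |t| ≤ T → ‖flow M t‖ ≤ C := by
  obtain ⟨C, hC⟩ := (isCompact_Icc (a := -T) (b := T)).exists_bound_of_continuousOn
    (continuous_flow M).continuousOn
  exact ⟨C, fun t ht => hC t (abs_le.1 ht)⟩

/-- The flows of the blocks `M k` are bounded uniformly in `k`, locally uniformly in time. -/
def FlowBounded (M : ι → E →L[ℝ] E) : Prop :=
  ∀ T : ℝ, ∃ C, ∀ k t, |t| ≤ T → ‖flow (M k) t‖ ≤ C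

variable {M : ι → E →L[ℝ] E}

theorem FlowBounded.exists_bound (hM : FlowBounded M) (t : ℝ) : ∃ C, ∀ k, ‖flow (M k) t‖ ≤ C :=
  (hM |t|).imp fun _ hC k => hC k t le_rfl

/-- The block-diagonal group `e^{tM}` on `ℓ²`. -/
def blockGroup (hM : FlowBounded M) (t : ℝ) : lp (fun _ : ι => E) 2 →L[ℝ] lp (fun _ : ι => E) 2 :=
  blockOp (fun k => flow (M k) t) (hM.exists_bound t)

@[simp] theorem blockGroup_apply (hM : FlowBounded M) (t : ℝ) (z : lp (fun _ : ι => E) 2) (k : ι) :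
    blockGroup hM t z k = flow (M k) t (z k) := rfl

/-- The group law holds block by block. Strong continuity is dominated convergence, the bound on the
blocks being uniform for times within distance 1. -/
theorem isStronglyContinuousGroup_blockGroup (hM : FlowBounded M) :
    IsStronglyContinuousGroup (blockGroup hM) where
  map_zero := by
    ext z k
    simp [flow_zero]
  map_add s t := by
    ext z k
    simp [flow_add]
  continuous z := by
    refine continuous_iff_continuousAt.2 fun t => ?_
    obtain ⟨C, hC⟩ := hM (|t| + 1)
    refine ell2_tendsto_of_dominated (f := fun t => blockGroup hM t z) (g := blockGroup hM t z)
      (b := fun k => (2 * C) * ‖z k‖) ?_ (fun k => ?_) ?_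
    · exact ((ell2_summable z).mul_left ((2 * C) ^ 2)).congr fun k => (mul_pow _ _ _).symm
    · simp only [blockGroup_apply]
      exact (continuous_flow_apply (M k) (z k)).continuousAt
    · filter_upwards [Metric.ball_mem_nhds t one_pos] with s hs k
      have hs' : |s| ≤ |t| + 1 := by
        have h1 : |s - t| < 1 := by simpa [Real.dist_eq] using hs
        have h2 := abs_add_le (s - t) t
        rw [sub_add_cancel] at h2
        linarith
      have h1 := (flow (M k) s).le_of_opNorm_le (hC k s hs') (z k)
      have h2 := (flow (M k) t).le_of_opNorm_le (hC k t (by linarith)) (z k)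
      simp only [blockGroup_apply]
      exact (norm_sub_le _ _).trans (by linarith)

/-- The generator of the block-diagonal group acts as `M k` in the `k`-th block, on its maximal
domain. -/
theorem tendsto_blockGroup_iff (hM : FlowBounded M) (x y : lp (fun _ : ι => E) 2) :
    Tendsto (fun t : ℝ => t⁻¹ • (blockGroup hM t x - x)) (𝓝[≠] 0) (𝓝 y) ↔
      ∀ k, M k (x k) = y k := by
  have key : ∀ k, Tendsto (fun t : ℝ => t⁻¹ • (flow (M k) t (x k) - x k)) (𝓝[≠] 0)
      (𝓝 (M k (x k))) := fun k => by
    have h := (hasDerivAt_flow_apply (M k) (x k) 0).tendsto_slope_zero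
    simpa [flow_zero] using h
  constructor
  · intro h k
    have h1 := ((lp.evalCLM ℝ (fun _ : ι => E) 2 k).continuous.tendsto y).comp h
    exact tendsto_nhds_unique (key k) h1
  · intro h
    obtain ⟨C, hC⟩ := hM 1
    refine ell2_tendsto_of_dominated (b := fun k => (C + 1) * ‖y k‖) ?_
      (fun k => h k ▸ key k) ?_
    · exact ((ell2_summable y).mul_left ((C + 1) ^ 2)).congr fun k => (mul_pow _ _ _).symm
    · have h1 : ∀ᶠ t : ℝ in 𝓝[≠] 0, t ∈ Metric.ball (0 : ℝ) 1 :=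
        mem_nhdsWithin_of_mem_nhds (Metric.ball_mem_nhds 0 one_pos)
      filter_upwards [h1, self_mem_nhdsWithin] with t ht ht0 k
      have ht1 : |t| ≤ 1 := by
        have : |t| < 1 := by simpa [Real.dist_eq] using ht
        exact this.le
      -- Mean value inequality: the derivative is the flow applied to `M k (x k) = y k`, so the
      -- difference quotients are dominated by `C ‖y k‖`, which is square summable.
      have hmv : ‖flow (M k) t (x k) - flow (M k) 0 (x k)‖ ≤ (C * ‖y k‖) * ‖t - 0‖ := by
        refine Convex.norm_image_sub_le_of_norm_hasDerivWithin_le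
          (fun s _ => (hasDerivAt_flow_apply' (M k) (x k) s).hasDerivWithinAt) ?_
          (convex_Icc (-1 : ℝ) 1) (by constructor <;> norm_num) (abs_le.1 ht1)
        intro s hs
        rw [h k]
        exact (flow (M k) s).le_of_opNorm_le (hC k s (abs_le.2 hs)) _
      have ht0' : 0 < |t| := abs_pos.2 ht0
      change ‖t⁻¹ • (flow (M k) t (x k) - x k) - y k‖ ≤ _
      refine (norm_sub_le _ _).trans ?_
      rw [norm_smul, norm_inv, Real.norm_eq_abs]
      simp only [flow_zero, ContinuousLinearMap.id_apply, sub_zero, Real.norm_eq_abs] at hmv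
      have : |t|⁻¹ * ‖flow (M k) t (x k) - x k‖ ≤ C * ‖y k‖ := by
        rw [inv_mul_le_iff₀ ht0']
        linarith
      linarith

end Flow

end Blocks

/-! ### Observation of block-diagonal groups -/

section ToL2

set_option linter.unusedSectionVars false

variable {G : Type*} [NormedAddCommGroup G] [NormedSpace ℝ G]

theorem memLp_Icc_of_continuous (T : ℝ) {f : ℝ → G} (hf : Continuous f) :
    MemLp f 2 (volume.restrict (Set.Icc 0 T)) := by
  obtain ⟨C, hC⟩ := (isCompact_Icc (a := 0) (b := T)).exists_bound_of_continuousOn hf.continuousOn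
  exact MemLp.of_bound hf.aestronglyMeasurable C (ae_restrict_of_forall_mem measurableSet_Icc hC)

/-- The class of a continuous function in `L²(0, T; G)`. -/
def toL2 (T : ℝ) : C(ℝ, G) →ₗ[ℝ] Lp G 2 (volume.restrict (Set.Icc 0 T)) where
  toFun f := (memLp_Icc_of_continuous T f.continuous).toLp f
  map_add' _ _ := rfl
  map_smul' _ _ := rfl

theorem norm_toL2_sq (T : ℝ) (f : C(ℝ, G)) :
    ‖toL2 T f‖ ^ 2 = ∫ t in Set.Icc 0 T, ‖f t‖ ^ 2 := by
  have hf := memLp_Icc_of_continuous T f.continuous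
  change ‖hf.toLp f‖ ^ 2 = _
  rw [Lp.norm_toLp, hf.eLpNorm_eq_integral_rpow_norm (by norm_num) (by norm_num)]
  have h0 : 0 ≤ ∫ t in Set.Icc 0 T, ‖f t‖ ^ 2 := by positivity
  simp only [ENNReal.toReal_ofNat, Real.rpow_ofNat]
  rw [ENNReal.toReal_ofReal (by positivity), ← Real.rpow_natCast, ← Real.rpow_mul h0]
  norm_num

theorem norm_toL2_le_of_forall {T c : ℝ} (hT : 0 ≤ T) (hc : 0 ≤ c) {f : C(ℝ, G)}
    (h : ∀ t ∈ Set.Icc 0 T, ‖f t‖ ≤ c) : ‖toL2 T f‖ ≤ √T * c := by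
  refine le_of_sq_le_sq ?_ (by positivity)
  rw [norm_toL2_sq, mul_pow, Real.sq_sqrt hT]
  have h1 : ∫ t in Set.Icc 0 T, ‖f t‖ ^ 2 ≤ ∫ _ in Set.Icc 0 T, c ^ 2 := by
    refine setIntegral_mono_on ?_ ?_ measurableSet_Icc fun t ht =>
      pow_le_pow_left₀ (norm_nonneg _) (h t ht) 2
    · exact (by fun_prop : Continuous fun t => ‖f t‖ ^ 2).continuousOn.integrableOn_Icc
    · exact continuousOn_const.integrableOn_Icc
  simpa [hT] using h1

/-- Translating and shortening the time interval decreases the norm. -/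
theorem norm_toL2_translate_le {T₀ T τ : ℝ} (hτ : 0 ≤ τ) (hT : τ + T₀ ≤ T) (f g : C(ℝ, G))
    (hfg : ∀ t, g t = f (t + τ)) : ‖toL2 T₀ g‖ ≤ ‖toL2 T f‖ := by
  refine le_of_sq_le_sq ?_ (norm_nonneg _)
  rw [norm_toL2_sq, norm_toL2_sq]
  have hmp : MeasurePreserving (fun t : ℝ => t + τ)
      (volume.restrict ((fun t => t + τ) ⁻¹' Set.Icc τ (τ + T₀)))
      (volume.restrict (Set.Icc τ (τ + T₀))) :=
    (measurePreserving_add_right volume τ).restrict_preimage measurableSet_Icc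
  have hpre : (fun t : ℝ => t + τ) ⁻¹' Set.Icc τ (τ + T₀) = Set.Icc 0 T₀ := by
    ext t; simp
  rw [hpre] at hmp
  have h1 := hmp.integral_comp (measurableEmbedding_addRight τ) fun t => ‖f t‖ ^ 2
  simp only [hfg]
  rw [h1]
  refine setIntegral_mono_set ?_ (Eventually.of_forall fun t => by positivity)
    (Set.Icc_subset_Icc hτ hT).eventuallyLE
  exact (by fun_prop : Continuous fun t => ‖f t‖ ^ 2).continuousOn.integrableOn_Icc

/-- A continuous function vanishing almost everywhere on the open interval vanishes there, and at
the endpoints by closure. -/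
theorem toL2_eq_zero {T : ℝ} (hT : 0 < T) {f : C(ℝ, G)} (h : toL2 T f = 0) :
    ∀ t ∈ Set.Icc 0 T, f t = 0 := by
  have hf := memLp_Icc_of_continuous T f.continuous
  have h1 : f =ᵐ[volume.restrict (Set.Icc 0 T)] fun _ => (0 : G) := by
    have h2 := hf.coeFn_toLp
    change (toL2 T f : ℝ → G) =ᵐ[_] f at h2
    rw [h] at h2
    exact h2.symm.trans (Lp.coeFn_zero _ _ _)
  rw [← Measure.restrict_congr_set Ioo_ae_eq_Icc] at h1
  have h2 := Measure.eqOn_open_of_ae_eq h1 isOpen_Ioo f.continuous.continuousOn continuousOn_const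
  have h3 := h2.closure f.continuous continuous_const
  rw [closure_Ioo hT.ne] at h3
  exact h3

end ToL2

section Observation

set_option linter.unusedSectionVars false

variable {ι E G : Type*} [NormedAddCommGroup E] [NormedSpace ℝ E] [CompleteSpace E]
  [FiniteDimensional ℝ E] [NormedAddCommGroup G] [NormedSpace ℝ G]

/-- The observation `t ↦ P (e^{tM} z)`. -/
def obsFun (P : E →L[ℝ] G) (M : E →L[ℝ] E) : E →ₗ[ℝ] C(ℝ, G) where
  toFun z := ⟨fun t => P (flow M t z), P.continuous.comp (continuous_flow_apply M z)⟩
  map_add' x y := by ext t; simp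
  map_smul' c x := by ext t; simp

@[simp] theorem obsFun_apply (P : E →L[ℝ] G) (M : E →L[ℝ] E) (z : E) (t : ℝ) :
    obsFun P M z t = P (flow M t z) := rfl

/-- The observation of one block, as a map into `L²(0, T; G)`. -/
def obsBlock (P : E →L[ℝ] G) (M : E →L[ℝ] E) (T : ℝ) :
    E →L[ℝ] Lp G 2 (volume.restrict (Set.Icc 0 T)) :=
  LinearMap.toContinuousLinearMap ((toL2 T).comp (obsFun P M))

theorem obsBlock_apply (P : E →L[ℝ] G) (M : E →L[ℝ] E) (T : ℝ) (z : E) :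
    obsBlock P M T z = toL2 T (obsFun P M z) := rfl

/-- The observations of finitely many blocks satisfy a Bessel inequality in `L²(0, T; G)`. -/
def Bessel (P : E →L[ℝ] G) (M : ι → E →L[ℝ] E) (T : ℝ) : Prop :=
  ∃ C : ℝ, 0 ≤ C ∧ ∀ (s : Finset ι) (z : ι → E),
    ‖∑ k ∈ s, obsBlock P (M k) T (z k)‖ ≤ C * √(∑ k ∈ s, ‖z k‖ ^ 2)

variable [CompleteSpace G] {P : E →L[ℝ] G} {M : ι → E →L[ℝ] E} {T : ℝ}

/-- The Bessel inequality turns the Cauchy criterion for `∑ ‖z k‖²` into the one for the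
observations. -/
theorem Bessel.summable (h : Bessel P M T) (z : lp (fun _ : ι => E) 2) :
    Summable fun k => obsBlock P (M k) T (z k) := by
  obtain ⟨C, hC0, hC⟩ := h
  rw [summable_iff_vanishing_norm]
  intro ε hε
  have hpos : 0 < (ε / (C + 1)) ^ 2 := by positivity
  obtain ⟨s, hs⟩ := (summable_iff_vanishing_norm.1 (ell2_summable z)) _ hpos
  refine ⟨s, fun t ht => (hC t _).trans_lt ?_⟩
  have h1 := hs t ht
  rw [Real.norm_eq_abs, abs_of_nonneg (by positivity)] at h1
  have h2 : √(∑ k ∈ t, ‖z k‖ ^ 2) < ε / (C + 1) := (Real.sqrt_lt' (by positivity)).2 h1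
  have h3 : (C + 1) * √(∑ k ∈ t, ‖z k‖ ^ 2) < ε := by
    rw [lt_div_iff₀ (by positivity)] at h2; linarith
  nlinarith [Real.sqrt_nonneg (∑ k ∈ t, ‖z k‖ ^ 2)]

/-- The observation operator from `ℓ²` to `L²(0, T; G)`. -/
def obs (h : Bessel P M T) :
    lp (fun _ : ι => E) 2 →L[ℝ] Lp G 2 (volume.restrict (Set.Icc 0 T)) :=
  LinearMap.mkContinuous
    { toFun := fun z => ∑' k, obsBlock P (M k) T (z k)
      map_add' := fun x y => by
        rw [← (h.summable x).tsum_add (h.summable y)]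
        exact tsum_congr fun k => map_add (obsBlock P (M k) T) _ _
      map_smul' := fun c x => by
        rw [RingHom.id_apply, ← (h.summable x).tsum_const_smul c]
        exact tsum_congr fun k => map_smul (obsBlock P (M k) T) _ _ } h.choose (fun z => by
      refine le_of_tendsto (h.summable z).hasSum.norm (Eventually.of_forall fun s => ?_)
      refine (h.choose_spec.2 s _).trans (mul_le_mul_of_nonneg_left ?_ h.choose_spec.1)
      refine Real.sqrt_le_iff.2 ⟨norm_nonneg _, ?_⟩
      rw [ell2_norm_sq]
      exact (ell2_summable z).sum_le_tsum s fun k _ => by positivity)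

theorem hasSum_obs (h : Bessel P M T) (z : lp (fun _ : ι => E) 2) :
    HasSum (fun k => obsBlock P (M k) T (z k)) (obs h z) := (h.summable z).hasSum

/-- If the observations of the blocks can be summed pointwise, the sum is the observation. -/
theorem obs_ae_eq [Countable ι] (h : Bessel P M T) (z : lp (fun _ : ι => E) 2) {f : ℝ → G}
    (hf : ∀ t, HasSum (fun k => P (flow (M k) t (z k))) (f t)) :
    obs h z =ᵐ[volume.restrict (Set.Icc 0 T)] f := by
  -- Convergence in `L²` gives almost everywhere convergence along a sequence of finite sets;
  -- countability of `ι` makes their filter countably generated. The pointwise sums converge along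
  -- the same sequence, so the limits agree.
  have h1 := tendstoInMeasure_of_tendsto_Lp (hasSum_obs h z)
  obtain ⟨ns, hns, hlim⟩ := h1.exists_seq_tendsto_ae'
  have h2 : ∀ᵐ t ∂volume.restrict (Set.Icc 0 T), ∀ n,
      (∑ k ∈ ns n, obsBlock P (M k) T (z k) : Lp G 2 _) t = ∑ k ∈ ns n, P (flow (M k) t (z k)) := by
    rw [ae_all_iff]
    intro n
    have h3 : ∑ k ∈ ns n, obsBlock P (M k) T (z k)
        = toL2 T (∑ k ∈ ns n, obsFun P (M k) (z k)) := by
      rw [map_sum]; rfl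
    rw [h3]
    filter_upwards [(memLp_Icc_of_continuous T
      (∑ k ∈ ns n, obsFun P (M k) (z k)).continuous).coeFn_toLp] with t ht
    refine ht.trans ?_
    simp
  filter_upwards [hlim, h2] with t ht1 ht2
  simp only [ht2] at ht1
  exact tendsto_nhds_unique ht1 ((hf t).comp hns)

/-- Observing the state evolved by `τ` over `[0, T₀]` is observing the original state over `[τ, τ +
T₀]`, a part of `[0, T]`. This is checked on finite sums and passed to the limit. -/
theorem norm_obs_blockGroup_le {T₀ τ : ℝ} (hM : FlowBounded M) (h₀ : Bessel P M T₀)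
    (h : Bessel P M T) (hτ : 0 ≤ τ) (hT : τ + T₀ ≤ T) (z : lp (fun _ : ι => E) 2) :
    ‖obs h₀ (blockGroup hM τ z)‖ ≤ ‖obs h z‖ := by
  refine le_of_tendsto_of_tendsto (hasSum_obs h₀ (blockGroup hM τ z)).norm (hasSum_obs h z).norm
    (Eventually.of_forall fun s => ?_)
  simp only [obsBlock_apply, ← map_sum]
  refine norm_toL2_translate_le hτ hT _ _ fun t => ?_
  simp [flow_add]

end Observation

/-! ### From the observability of high blocks to full observability -/

/-- An injective bounded operator that is bounded below modulo an operator of finite rank is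
bounded below. -/
theorem exists_bound_of_injective {X F V : Type*} [NormedAddCommGroup X] [NormedSpace ℝ X]
    [CompleteSpace X] [NormedAddCommGroup F] [NormedSpace ℝ F] [NormedAddCommGroup V]
    [NormedSpace ℝ V] [FiniteDimensional ℝ V] (Ψ : X →L[ℝ] F) (r : X →L[ℝ] V) {C : ℝ}
    (hC : ∀ z, ‖z‖ ≤ C * (‖Ψ z‖ + ‖r z‖)) (hΨ : ∀ z, Ψ z = 0 → z = 0) :
    ∃ c, 0 < c ∧ ∀ z, ‖z‖ ≤ c * ‖Ψ z‖ := by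
  by_contra! hcon
  have h1 : ∀ n : ℕ, ∃ z : X, ‖z‖ = 1 ∧ ‖Ψ z‖ ≤ 1 / ((n : ℝ) + 1) := by
    intro n
    obtain ⟨z, hz⟩ := hcon ((n : ℝ) + 1) (by positivity)
    have hz0 : 0 < ‖z‖ := lt_of_le_of_lt (by positivity) hz
    refine ⟨‖z‖⁻¹ • z, ?_, ?_⟩
    · rw [norm_smul, norm_inv, norm_norm, inv_mul_cancel₀ hz0.ne']
    · rw [map_smul, norm_smul, norm_inv, norm_norm, inv_mul_le_iff₀ hz0, mul_one_div,
        le_div_iff₀ (by positivity)]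
      linarith
  choose z hz1 hz2 using h1
  have hΨ0 : Tendsto (fun n => Ψ (z n)) atTop (𝓝 0) :=
    squeeze_zero_norm hz2 tendsto_one_div_add_atTop_nhds_zero_nat
  have : ProperSpace V := FiniteDimensional.proper ℝ V
  -- Finite dimension of `V` makes a subsequence of `r (z n)` converge. With `Ψ (z n) → 0`, the
  -- estimate `hC` makes the same subsequence of `z` Cauchy, and its limit is a unit vector in the
  -- kernel of `Ψ`.
  obtain ⟨v, -, φ, hφ, hv⟩ := (isCompact_closedBall (0 : V) ‖r‖).tendsto_subseq
    (x := fun n => r (z n)) (fun n => by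
      rw [mem_closedBall_zero_iff]
      simpa [hz1 n] using r.le_opNorm (z n))
  have hcau : CauchySeq (z ∘ φ) := by
    have hA := (hΨ0.comp hφ.tendsto_atTop).cauchySeq
    have hB := hv.cauchySeq
    rw [Metric.cauchySeq_iff] at hA hB ⊢
    intro ε hε
    have hC0 : 0 < |C| + 1 := by positivity
    obtain ⟨N₁, h₁⟩ := hA (ε / (2 * (|C| + 1))) (by positivity)
    obtain ⟨N₂, h₂⟩ := hB (ε / (2 * (|C| + 1))) (by positivity)
    refine ⟨max N₁ N₂, fun m hm n hn => ?_⟩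
    have e₁ := h₁ m (le_of_max_le_left hm) n (le_of_max_le_left hn)
    have e₂ := h₂ m (le_of_max_le_right hm) n (le_of_max_le_right hn)
    simp only [Function.comp_apply, dist_eq_norm, ← map_sub] at e₁ e₂ ⊢
    rw [lt_div_iff₀ (by positivity)] at e₁ e₂
    have e₃ := hC (z (φ m) - z (φ n))
    have e₄ : C * (‖Ψ (z (φ m) - z (φ n))‖ + ‖r (z (φ m) - z (φ n))‖) ≤
      (|C| + 1) * (‖Ψ (z (φ m) - z (φ n))‖ + ‖r (z (φ m) - z (φ n))‖) := by
      gcongr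
      exact (le_abs_self C).trans (by linarith)
    nlinarith
  obtain ⟨x, hx⟩ := cauchySeq_tendsto_of_complete hcau
  have hx1 : ‖x‖ = 1 := tendsto_nhds_unique hx.norm (by simp [hz1])
  have hx2 : Ψ x = 0 := tendsto_nhds_unique ((Ψ.continuous.tendsto x).comp hx)
    (hΨ0.comp hφ.tendsto_atTop)
  rw [hΨ x hx2, norm_zero] at hx1
  exact zero_ne_one hx1

section Uniqueness

set_option linter.unusedSectionVars false

variable {ι E G : Type*} [NormedAddCommGroup E] [NormedSpace ℝ E] [CompleteSpace E]
  [FiniteDimensional ℝ E] [NormedAddCommGroup G] [NormedSpace ℝ G] [CompleteSpace G]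
  {P : E →L[ℝ] G} {M : ι → E →L[ℝ] E} {T₀ : ℝ}

/-- The coordinates in a finite set of blocks. -/
def lowBlocks (L : Finset ι) : lp (fun _ : ι => E) 2 →L[ℝ] (L → E) :=
  ContinuousLinearMap.pi fun k => lp.evalCLM ℝ (fun _ : ι => E) 2 (k : ι)

/-- Removing the low blocks leaves a state to which `htail` applies, and changes the observation by
at most a multiple of their norm. -/
theorem norm_le_obs_add_lowBlocks (h₀ : Bessel P M T₀) (L : Finset ι) {c : ℝ}
    (htail : ∀ z : lp (fun _ : ι => E) 2, (∀ k ∈ L, z k = 0) → ‖z‖ ≤ c * ‖obs h₀ z‖) :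
    ∃ C, ∀ z, ‖z‖ ≤ C * (‖obs h₀ z‖ + ‖lowBlocks L z‖) := by
  classical
  refine ⟨|c| + (|c| * ‖obs h₀‖ + 1) * L.card, fun z => ?_⟩
  set z₁ : lp (fun _ : ι => E) 2 := ∑ k ∈ L, lp.single 2 k (z k) with hz₁
  have hlow : ‖z₁‖ ≤ L.card * ‖lowBlocks L z‖ := by
    rw [← nsmul_eq_mul]
    refine (norm_sum_le _ _).trans (Finset.sum_le_card_nsmul _ _ _ fun k hk => ?_)
    rw [lp.norm_single (by norm_num)]
    exact norm_le_pi_norm (lowBlocks L z) ⟨k, hk⟩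
  have hz₂ : ∀ k ∈ L, (z - z₁) k = 0 := by
    intro k hk
    rw [lp.coeFn_sub, Pi.sub_apply, hz₁, lp.coeFn_sum, Finset.sum_apply,
      Finset.sum_eq_single k (fun j _ hj => lp.single_apply_ne _ _ _ hj.symm)
        (fun h => absurd hk h), lp.single_apply_self, sub_self]
  have h1 := htail _ hz₂
  have h2 : ‖obs h₀ (z - z₁)‖ ≤ ‖obs h₀ z‖ + ‖obs h₀‖ * ‖z₁‖ := by
    rw [map_sub]
    exact (norm_sub_le _ _).trans (by gcongr; exact (obs h₀).le_opNorm _)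
  have h3 : ‖z‖ ≤ ‖z - z₁‖ + ‖z₁‖ := by simpa using norm_add_le (z - z₁) z₁
  have h4 : c * ‖obs h₀ (z - z₁)‖ ≤ |c| * (‖obs h₀ z‖ + ‖obs h₀‖ * ‖z₁‖) := by
    gcongr
    exact le_abs_self c
  have h5 : (|c| * ‖obs h₀‖ + 1) * ‖z₁‖ ≤
      (|c| * ‖obs h₀‖ + 1) * (L.card * ‖lowBlocks L z‖) := by gcongr
  have h6 : 0 ≤ |c| * ‖lowBlocks L z‖ := by positivity
  have h7 : 0 ≤ (|c| * ‖obs h₀‖ + 1) * L.card * ‖obs h₀ z‖ := by positivity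
  linarith

/-- The states whose observation vanishes on `[τ, τ + T₀]` for all `τ ∈ [0, n]`. -/
def unobserved (hM : FlowBounded M) (h₀ : Bessel P M T₀) (n : ℕ) :
    Submodule ℝ (lp (fun _ : ι => E) 2) where
  carrier := {z | ∀ τ ∈ Set.Icc (0 : ℝ) n, obs h₀ (blockGroup hM τ z) = 0}
  zero_mem' := by simp
  add_mem' := by
    intro a b ha hb τ hτ
    rw [map_add, map_add, ha τ hτ, hb τ hτ, add_zero]
  smul_mem' := by
    intro c a ha τ hτ
    rw [map_smul, map_smul, ha τ hτ, smul_zero]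

variable {hM : FlowBounded M} {h₀ : Bessel P M T₀}

theorem unobserved_anti {m n : ℕ} (h : m ≤ n) : unobserved hM h₀ n ≤ unobserved hM h₀ m :=
  fun _ hz τ hτ => hz τ ⟨hτ.1, hτ.2.trans (by exact_mod_cast h)⟩

theorem obs_eq_zero_of_mem_unobserved {n : ℕ} {z : lp (fun _ : ι => E) 2}
    (hz : z ∈ unobserved hM h₀ n) : obs h₀ z = 0 := by
  have h := hz 0 ⟨le_rfl, by positivity⟩
  rwa [(isStronglyContinuousGroup_blockGroup hM).map_zero] at h

/-- Unobserved states are smooth: the generator maps them to unobserved states. -/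
theorem exists_unobserved_generator (L : Finset ι) {C : ℝ}
    (hC : ∀ z, ‖z‖ ≤ C * (‖obs h₀ z‖ + ‖lowBlocks L z‖)) {n : ℕ} {z : lp (fun _ : ι => E) 2}
    (hz : z ∈ unobserved hM h₀ (n + 1)) :
    ∃ z' ∈ unobserved hM h₀ n, ∀ k, z' k = M k (z k) := by
  set t : ℕ → ℝ := fun m => 1 / ((m : ℝ) + 1) with ht
  have ht0 : ∀ m, 0 < t m := fun m => by positivity
  have ht1 : ∀ m, t m ≤ 1 := fun m => by
    rw [ht]
    exact (div_le_one (by positivity)).2 (by simp)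
  have htlim : Tendsto t atTop (𝓝[≠] 0) :=
    tendsto_nhdsWithin_iff.2 ⟨tendsto_one_div_add_atTop_nhds_zero_nat,
      Eventually.of_forall fun m => (ht0 m).ne'⟩
  set q : ℕ → lp (fun _ : ι => E) 2 := fun m => (t m)⁻¹ • (blockGroup hM (t m) z - z) with hq
  -- A shift by `t m ≤ 1` costs one unit of the observation window, whence `n + 1` in the hypothesis
  -- and `n` in the conclusion.
  have hqmem : ∀ m, q m ∈ unobserved hM h₀ n := by
    intro m
    refine Submodule.smul_mem _ _ (Submodule.sub_mem _ (fun τ hτ => ?_)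
      (unobserved_anti n.le_succ hz))
    have h1 := (isStronglyContinuousGroup_blockGroup hM).map_add τ (t m)
    rw [← ContinuousLinearMap.comp_apply (blockGroup hM τ), ← h1]
    refine hz _ ⟨add_nonneg hτ.1 (ht0 m).le, ?_⟩
    push_cast
    exact add_le_add hτ.2 (ht1 m)
  have hcoord : ∀ k, Tendsto (fun m => q m k) atTop (𝓝 (M k (z k))) := fun k => by
    have h := (hasDerivAt_flow_apply (M k) (z k) 0).tendsto_slope_zero.comp htlim
    simp only [Function.comp_def, zero_add, flow_zero, ContinuousLinearMap.id_apply] at h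
    exact h
  have hlow : CauchySeq fun m => lowBlocks L (q m) :=
    (tendsto_pi_nhds.2 fun k : L => hcoord k).cauchySeq
  -- The difference quotients are unobserved, so `hC` bounds their differences by low coordinates
  -- alone. Those coordinates converge because every finite-dimensional flow is differentiable.
  have hcau : CauchySeq q := by
    rw [Metric.cauchySeq_iff] at hlow ⊢
    intro ε hε
    obtain ⟨N, hN⟩ := hlow (ε / (|C| + 1)) (by positivity)
    refine ⟨N, fun i hi j hj => ?_⟩
    have e₁ := hN i hi j hj
    rw [dist_eq_norm, ← map_sub, lt_div_iff₀ (by positivity)] at e₁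
    have e₂ := hC (q i - q j)
    rw [obs_eq_zero_of_mem_unobserved (Submodule.sub_mem _ (hqmem i) (hqmem j)), norm_zero,
      zero_add] at e₂
    rw [dist_eq_norm]
    nlinarith [norm_nonneg (lowBlocks L (q i - q j)), le_abs_self C]
  obtain ⟨z', hz'⟩ := cauchySeq_tendsto_of_complete hcau
  refine ⟨z', fun τ hτ => ?_, fun k => ?_⟩
  · have h1 := (((obs h₀).comp (blockGroup hM τ)).continuous.tendsto z').comp hz'
    refine tendsto_nhds_unique h1 (tendsto_const_nhds.congr fun m => ?_)
    exact (hqmem m τ hτ).symm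
  · have h1 := ((lp.evalCLM ℝ (fun _ : ι => E) 2 k).continuous.tendsto z').comp hz'
    exact tendsto_nhds_unique h1 (hcoord k)

open Polynomial in
-- Each factor `X` is one application of the generator and costs one unit of time, so `n` depends on
-- `Q` only.
theorem exists_unobserved_aeval (L : Finset ι) {C : ℝ}
    (hC : ∀ z, ‖z‖ ≤ C * (‖obs h₀ z‖ + ‖lowBlocks L z‖)) (Q : ℝ[X]) :
    ∃ n : ℕ, ∀ (a : ℕ) (z : lp (fun _ : ι => E) 2), z ∈ unobserved hM h₀ (a + n) →
      ∃ z' ∈ unobserved hM h₀ a, ∀ k, z' k = aeval (M k) Q (z k) := by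
  induction Q using Polynomial.induction_on with
  | C c =>
    refine ⟨0, fun a z hz => ⟨c • z, Submodule.smul_mem _ _ hz, fun k => ?_⟩⟩
    simp
  | add p q hp hq =>
    obtain ⟨n₁, h₁⟩ := hp
    obtain ⟨n₂, h₂⟩ := hq
    refine ⟨max n₁ n₂, fun a z hz => ?_⟩
    obtain ⟨z₁, hz₁, e₁⟩ := h₁ a z (unobserved_anti (by omega) hz)
    obtain ⟨z₂, hz₂, e₂⟩ := h₂ a z (unobserved_anti (by omega) hz)
    refine ⟨z₁ + z₂, Submodule.add_mem _ hz₁ hz₂, fun k => ?_⟩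
    simp [e₁, e₂]
  | monomial m c ih =>
    obtain ⟨n, hn⟩ := ih
    refine ⟨n + 1, fun a z hz => ?_⟩
    obtain ⟨z₁, hz₁, e₁⟩ := exists_unobserved_generator L hC (n := a + n) hz
    obtain ⟨z₂, hz₂, e₂⟩ := hn a z₁ hz₁
    refine ⟨z₂, hz₂, fun k => ?_⟩
    have h1 : aeval (M k) (Polynomial.C c * X ^ (m + 1)) =
        aeval (M k) (Polynomial.C c * X ^ m) * M k := by
      rw [pow_succ, ← mul_assoc, map_mul _ _ X, aeval_X]
    rw [e₂, e₁, h1]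
    rfl

open Polynomial in
theorem injective_aeval_prod {s : Finset ι} {Q : ι → ℝ[X]} {N : E →L[ℝ] E}
    (h : ∀ j ∈ s, Function.Injective (aeval N (Q j))) :
    Function.Injective (aeval N (∏ j ∈ s, Q j)) := by
  classical
  induction s using Finset.induction_on with
  | empty =>
    simp only [Finset.prod_empty, map_one]
    exact Function.injective_id
  | insert j s hj ih =>
    rw [Finset.prod_insert hj, map_mul]
    exact (h j (by simp)).comp (ih fun i hi => h i (by simp [hi]))

open Polynomial in
theorem aeval_prod_eq_zero {s : Finset ι} {Q : ι → ℝ[X]} {k : ι} (hk : k ∈ s) {N : E →L[ℝ] E}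
    (h : aeval N (Q k) = 0) : aeval N (∏ j ∈ s, Q j) = 0 := by
  classical
  rw [← Finset.mul_prod_erase s Q hk, map_mul, h, zero_mul]

open Polynomial in
/-- If the blocks have polynomials `Q k` with `Q k (M k) = 0` and `Q j (M k)` injective for
`j ≠ k`, and each block is observable, then no nonzero state is unobserved for long. -/
theorem exists_unobserved_eq_bot (hT₀ : 0 < T₀) (L : Finset ι) {C : ℝ}
    (hC : ∀ z, ‖z‖ ≤ C * (‖obs h₀ z‖ + ‖lowBlocks L z‖)) (Q : ι → ℝ[X])
    (hQ : ∀ k, aeval (M k) (Q k) = 0)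
    (hQ' : ∀ j k, j ≠ k → Function.Injective (aeval (M k) (Q j)))
    (hobs : ∀ k z, (∀ t ∈ Set.Icc 0 T₀, P (flow (M k) t z) = 0) → z = 0) :
    ∃ n : ℕ, ∀ z ∈ unobserved hM h₀ n, z = 0 := by
  classical
  obtain ⟨n₀, hn₀⟩ := exists_unobserved_aeval (hM := hM) L hC (∏ j ∈ L, Q j)
  choose n hn using fun k => exists_unobserved_aeval (hM := hM) L hC (∏ j ∈ L.erase k, Q j)
  refine ⟨n₀ + ∑ k ∈ L, n k, fun z hz => ?_⟩
  have hzero : ∀ w ∈ unobserved hM h₀ 0, (∀ k ∈ L, w k = 0) → w = 0 := by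
    intro w hw hwL
    have h1 := hC w
    have h2 : lowBlocks L w = 0 := funext fun k => hwL k k.2
    rw [obs_eq_zero_of_mem_unobserved hw, h2] at h1
    simpa using h1
  -- The product over all of `L` kills the low blocks. The image is unobserved with no low part,
  -- hence zero, and injectivity of the product on a high block gives `z k = 0`.
  have htail : ∀ k ∉ L, z k = 0 := by
    obtain ⟨w, hw, e⟩ := hn₀ 0 z (unobserved_anti (by omega) hz)
    have hw0 := hzero w hw fun k hk => by rw [e, aeval_prod_eq_zero hk (hQ k)]; rfl
    intro k hk
    refine injective_aeval_prod (s := L) (Q := Q) (N := M k)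
      (fun j hj => hQ' j k (by rintro rfl; exact hk hj)) ?_
    rw [← e, hw0, map_zero]
    rfl
  ext k
  by_cases hk : k ∈ L
  · have hle : n k ≤ ∑ k ∈ L, n k := Finset.single_le_sum (fun _ _ => Nat.zero_le _) hk
    -- Omitting the factor of `k` produces an unobserved state concentrated in the block `k`; its
    -- observation is that of one block, so `hobs` applies.
    obtain ⟨w, hw, e⟩ := hn k 0 z (unobserved_anti (by omega) hz)
    have hwj : ∀ j, j ≠ k → w j = 0 := by
      intro j hj
      rw [e]
      by_cases hjL : j ∈ L
      · rw [aeval_prod_eq_zero (Finset.mem_erase.2 ⟨hj, hjL⟩) (hQ j)]; rfl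
      · rw [htail j hjL, map_zero]
    have hwk : w k = 0 := by
      refine hobs k _ (toL2_eq_zero hT₀ (f := obsFun P (M k) (w k)) ?_)
      have h1 := hasSum_obs h₀ w
      rw [obs_eq_zero_of_mem_unobserved hw] at h1
      have h2 := hasSum_single (f := fun j => obsBlock P (M j) T₀ (w j)) k
        fun j hj => by rw [hwj j hj, map_zero]
      exact h2.unique h1
    refine injective_aeval_prod (s := L.erase k) (Q := Q) (N := M k)
      (fun j hj => hQ' j k (Finset.ne_of_mem_erase hj)) ?_
    rw [← e, hwk]
    simp
  · exact htail k hk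

open Polynomial in
/-- Observability of the whole group from observability of the high blocks. -/
theorem exists_observability (hM : FlowBounded M) (h₀ : Bessel P M T₀) (hT₀ : 0 < T₀)
    (L : Finset ι) {c : ℝ}
    (htail : ∀ z : lp (fun _ : ι => E) 2, (∀ k ∈ L, z k = 0) → ‖z‖ ≤ c * ‖obs h₀ z‖)
    (Q : ι → ℝ[X]) (hQ : ∀ k, aeval (M k) (Q k) = 0)
    (hQ' : ∀ j k, j ≠ k → Function.Injective (aeval (M k) (Q j)))
    (hobs : ∀ k z, (∀ t ∈ Set.Icc 0 T₀, P (flow (M k) t z) = 0) → z = 0) :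
    ∃ n : ℕ, ∀ (T : ℝ) (h : Bessel P M T), T₀ + n ≤ T →
      ∃ c, 0 < c ∧ ∀ z, ‖z‖ ≤ c * ‖obs h z‖ := by
  obtain ⟨C, hC⟩ := norm_le_obs_add_lowBlocks h₀ L htail
  obtain ⟨n, hn⟩ := exists_unobserved_eq_bot (hM := hM) hT₀ L hC Q hQ hQ' hobs
  refine ⟨n, fun T h hT => ?_⟩
  refine exists_bound_of_injective (obs h) (lowBlocks L) (C := |C|) (fun z => ?_) fun z hz => ?_
  · have h1 := norm_obs_blockGroup_le hM h₀ h le_rfl (by linarith [n.cast_nonneg (α := ℝ)]) z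
    rw [(isStronglyContinuousGroup_blockGroup hM).map_zero, ContinuousLinearMap.id_apply] at h1
    refine (hC z).trans ?_
    gcongr
    exact le_abs_self C
  -- A zero observation over `[0, T]` is zero over every window `[τ, τ + T₀]` with `τ ≤ n`.
  · refine hn z fun τ hτ => ?_
    have h1 := norm_obs_blockGroup_le hM h₀ h hτ.1 (by linarith [hτ.2]) z
    rw [hz, norm_zero] at h1
    exact norm_le_zero_iff.1 h1

end Uniqueness

/-! ### Orthogonality of the trigonometric system -/

theorem integral_cos_int_mul (m : ℕ) {j : ℤ} (hj : j ≠ 0) :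
    ∫ t in (0 : ℝ)..2 * Real.pi * m, Real.cos (j * t) = 0 := by
  have hj' : (j : ℝ) ≠ 0 := by exact_mod_cast hj
  rw [intervalIntegral.integral_comp_mul_left _ hj', integral_cos]
  have h1 : (j : ℝ) * (2 * Real.pi * m) = ((2 * j * m : ℤ) : ℝ) * Real.pi := by push_cast; ring
  rw [h1, Real.sin_int_mul_pi]
  simp

theorem integral_sin_int_mul (m : ℕ) (j : ℤ) :
    ∫ t in (0 : ℝ)..2 * Real.pi * m, Real.sin (j * t) = 0 := by
  by_cases hj : j = 0
  · simp [hj]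
  have hj' : (j : ℝ) ≠ 0 := by exact_mod_cast hj
  rw [intervalIntegral.integral_comp_mul_left _ hj', integral_sin]
  have h1 : (j : ℝ) * (2 * Real.pi * m) = ((j * m : ℤ) : ℝ) * (2 * Real.pi) := by push_cast; ring
  rw [h1, Real.cos_int_mul_two_pi]
  simp

/-- Product-to-sum formulas over `m` full periods; `0 < p` keeps the frequency `p + q` nonzero. -/
theorem integral_trig_mul_trig (m p q : ℕ) (hp : 0 < p) (a b a' b' : ℝ) :
    ∫ t in (0 : ℝ)..2 * Real.pi * m, (a * Real.cos (p * t) + b * Real.sin (p * t)) *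
      (a' * Real.cos (q * t) + b' * Real.sin (q * t)) =
      if p = q then Real.pi * m * (a * a' + b * b') else 0 := by
  have h1 : ∀ t : ℝ, (a * Real.cos (p * t) + b * Real.sin (p * t)) *
      (a' * Real.cos (q * t) + b' * Real.sin (q * t)) =
      (a * a' + b * b') / 2 * Real.cos (((p - q : ℤ) : ℝ) * t) +
      (a * a' - b * b') / 2 * Real.cos (((p + q : ℤ) : ℝ) * t) +
      (a * b' + b * a') / 2 * Real.sin (((p + q : ℤ) : ℝ) * t) +
      (b * a' - a * b') / 2 * Real.sin (((p - q : ℤ) : ℝ) * t) := by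
    intro t
    push_cast
    rw [sub_mul, add_mul (p : ℝ) q t, Real.cos_sub, Real.cos_add, Real.sin_add, Real.sin_sub]
    ring
  simp_rw [h1]
  rw [intervalIntegral.integral_add, intervalIntegral.integral_add, intervalIntegral.integral_add,
    intervalIntegral.integral_const_mul, intervalIntegral.integral_const_mul,
    intervalIntegral.integral_const_mul, intervalIntegral.integral_const_mul,
    integral_cos_int_mul m (j := (p + q : ℤ)) (by omega), integral_sin_int_mul,
    integral_sin_int_mul]
  · split_ifs with hpq
    · subst hpq
      simp
      ring
    · rw [integral_cos_int_mul m (j := (p - q : ℤ)) (by omega)]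
      simp
  all_goals exact Continuous.intervalIntegrable (by fun_prop) _ _

theorem integral_trig_sum_sq {ι : Type*} (m : ℕ) (s : Finset ι) (n : ι → ℕ)
    (hn : Function.Injective n) (hpos : ∀ k, 0 < n k) (a b : ι → ℝ) :
    ∫ t in Set.Icc 0 (2 * Real.pi * m),
      (∑ k ∈ s, (a k * Real.cos (n k * t) + b k * Real.sin (n k * t))) ^ 2 =
      Real.pi * m * ∑ k ∈ s, (a k ^ 2 + b k ^ 2) := by
  classical
  have hT : (0 : ℝ) ≤ 2 * Real.pi * m := by positivity
  rw [integral_Icc_eq_integral_Ioc, ← intervalIntegral.integral_of_le hT]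
  simp_rw [sq, Finset.sum_mul_sum]
  rw [intervalIntegral.integral_finsetSum
    fun k _ => Continuous.intervalIntegrable (by fun_prop) _ _]
  rw [Finset.mul_sum]
  refine Finset.sum_congr rfl fun k hk => ?_
  rw [intervalIntegral.integral_finsetSum
    fun k _ => Continuous.intervalIntegrable (by fun_prop) _ _]
  simp_rw [integral_trig_mul_trig m _ _ (hpos k)]
  rw [Finset.sum_eq_single k]
  · simp
  · intro j _ hj
    rw [if_neg fun h => hj (hn h).symm]
  · exact fun h => absurd hk h

/-! ### Normal modes of the high blocks -/

/-- Rotating `(α t, β t)` back by the angle `ω t` gives a vector with zero derivative. -/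
theorem rotation_eq {α β : ℝ → ℝ} {ω : ℝ} (hα : ∀ t, HasDerivAt α (ω * β t) t)
    (hβ : ∀ t, HasDerivAt β (-(ω * α t)) t) (t : ℝ) :
    α t = α 0 * Real.cos (ω * t) + β 0 * Real.sin (ω * t) ∧
    β t = β 0 * Real.cos (ω * t) - α 0 * Real.sin (ω * t) := by
  have hc : ∀ t, HasDerivAt (fun t => Real.cos (ω * t)) (-Real.sin (ω * t) * ω) t := fun t => by
    simpa using ((hasDerivAt_id t).const_mul ω).cos
  have hs : ∀ t, HasDerivAt (fun t => Real.sin (ω * t)) (Real.cos (ω * t) * ω) t := fun t => by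
    simpa using ((hasDerivAt_id t).const_mul ω).sin
  have h1 : ∀ t, HasDerivAt (fun t => α t * Real.cos (ω * t) - β t * Real.sin (ω * t)) 0 t :=
    fun t => (((hα t).mul (hc t)).sub ((hβ t).mul (hs t))).congr_deriv (by ring)
  have h2 : ∀ t, HasDerivAt (fun t => α t * Real.sin (ω * t) + β t * Real.cos (ω * t)) 0 t :=
    fun t => (((hα t).mul (hs t)).add ((hβ t).mul (hc t))).congr_deriv (by ring)
  have e1 : α t * Real.cos (ω * t) - β t * Real.sin (ω * t) = _ :=
    is_const_of_deriv_eq_zero (fun t => (h1 t).differentiableAt) (fun t => (h1 t).deriv) t 0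
  have e2 : α t * Real.sin (ω * t) + β t * Real.cos (ω * t) = _ :=
    is_const_of_deriv_eq_zero (fun t => (h2 t).differentiableAt) (fun t => (h2 t).deriv) t 0
  simp only [mul_zero, Real.cos_zero, Real.sin_zero, mul_one, sub_zero, zero_add] at e1 e2
  have e3 := Real.sin_sq_add_cos_sq (ω * t)
  constructor
  · linear_combination (-α t) * e3 + Real.cos (ω * t) * e1 + Real.sin (ω * t) * e2
  · linear_combination (-β t) * e3 - Real.sin (ω * t) * e1 + Real.cos (ω * t) * e2

/-- Of the two roots of `θ² + dθ = p` this is the larger; when `d` is large it is the small one in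
modulus, and it keeps `θ + d` of the size of `d`. -/
theorem exists_mul_add_self_eq {d p : ℝ} (hp : 0 ≤ d ^ 2 + 4 * p) :
    ∃ θ, θ * (θ + d) = p ∧ d / 2 ≤ θ + d := by
  refine ⟨(√(d ^ 2 + 4 * p) - d) / 2, ?_, ?_⟩
  · have := Real.sq_sqrt hp
    nlinarith
  · have := Real.sqrt_nonneg (d ^ 2 + 4 * p)
    linarith

/-- The last bound is `|√l - μ| (√l + μ) = |l - μ²|`, with `√l + μ` at least `μ`. -/
theorem sqrt_near {μ l m : ℝ} (hμ : 0 < μ) (hl : |l - μ ^ 2| ≤ m)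
    (h : 2 * m ≤ μ ^ 2) :
    ∃ ω, ω ^ 2 = l ∧ μ / 2 ≤ ω ∧ ω ≤ 2 * μ ∧ |ω - μ| ≤ m / μ := by
  obtain ⟨h1, h2⟩ := abs_le.1 hl
  have hl0 : 0 ≤ l := by nlinarith
  have hω := Real.sq_sqrt hl0
  have hω0 := Real.sqrt_nonneg l
  refine ⟨√l, hω, ?_, ?_, ?_⟩
  · refine Real.le_sqrt_of_sq_le ?_
    nlinarith
  · refine Real.sqrt_le_iff.2 ⟨by positivity, ?_⟩
    nlinarith
  · rw [le_div_iff₀ hμ]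
    calc |√l - μ| * μ ≤ |√l - μ| * (√l + μ) := by gcongr; linarith
      _ = |√l - μ| * |√l + μ| := by rw [abs_of_nonneg (add_nonneg hω0 hμ.le)]
      _ = |l - μ ^ 2| := by rw [← abs_mul]; congr 1; linear_combination hω
      _ ≤ m := hl

/-- Coupling coefficients and frequencies of the normal modes of the block with parameter `k` and
couplings `g`, `h`. -/
theorem exists_modes (A D p : ℝ) {c : ℝ} (hc : 0 ≤ c) : ∃ m K₀ : ℝ, 0 ≤ m ∧ 1 ≤ K₀ ∧
    ∀ k : ℝ, K₀ ≤ k → ∀ g h : ℝ, g * h = p → |g| ≤ c * k ^ 3 → |h| ≤ c * k ^ 3 →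
    ∃ δ ε ω₁ ω₂ : ℝ,
      (|δ| ≤ 4 * c / k ∧ |ε| ≤ 4 * c / k ∧ |δ| ≤ 1 / 2 ∧ |ε| ≤ 1 / 2) ∧
      (k / 2 ≤ ω₁ ∧ ω₁ ≤ 2 * k ∧ |ω₁ - k| ≤ m / k) ∧
      (k ^ 2 / 2 ≤ ω₂ ∧ ω₂ ≤ 2 * k ^ 2 ∧ |ω₂ - k ^ 2| ≤ m / k) ∧
      (k ^ 2 + A - δ * h = ω₁ ^ 2 ∧ δ * (k ^ 4 + D) - g = ω₁ ^ 2 * δ) ∧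
      (k ^ 4 + D - ε * g = ω₂ ^ 2 ∧ ε * (k ^ 2 + A) - h = ω₂ ^ 2 * ε) := by
  set m := |A| + |D| + |p| + 1 with hm
  have hm1 : 1 ≤ m := by rw [hm]; linarith [abs_nonneg A, abs_nonneg D, abs_nonneg p]
  -- The part `4 m` of the threshold ensures the spectral gap and `8 c` makes the mixing
  -- coefficients at most `1/2`.
  refine ⟨m, 4 * m + 8 * c, by linarith, by linarith, fun k hk g h hgh hg hh => ?_⟩
  have hA := abs_le.1 (show |A| ≤ m - 1 by linarith [abs_nonneg D, abs_nonneg p])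
  have hD := abs_le.1 (show |D| ≤ m - 1 by linarith [abs_nonneg A, abs_nonneg p])
  have hAD : |A| + |D| ≤ m := by linarith [abs_nonneg p]
  have hp := show |p| ≤ m by linarith [abs_nonneg A, abs_nonneg D]
  have hk4 : 4 * m ≤ k := by linarith
  have hk8 : 8 * c ≤ k := by linarith
  have hk1 : 4 ≤ k := by linarith
  have hk0 : 0 < k := by linarith
  have hk2 : 4 * k ≤ k ^ 2 := by nlinarith
  have hk4' : 16 * k ^ 2 ≤ k ^ 4 := by nlinarith
  set d := k ^ 4 + D - k ^ 2 - A with hd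
  have hdk : k ^ 4 / 2 ≤ d := by linarith [hA.1, hA.2, hD.1, hD.2]
  have hd64 : 8 * m ≤ d := by linarith
  have hd0 : 0 < d := by linarith
  -- The stiffness matrix with rows `(k² + A, g)` and `(h, k⁴ + D)` has eigenvalues `k² + A - θ` and
  -- `k⁴ + D + θ` exactly when `θ (θ + d) = g h = p`. Hence large couplings with bounded product
  -- barely move them.
  obtain ⟨θ, hθ, hθd⟩ := exists_mul_add_self_eq (p := p) (d := d) (by nlinarith [(abs_le.1 hp).1])
  have hs0 : 0 < θ + d := by linarith
  have hθ1 : |θ| ≤ 1 := by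
    have h1 : |θ| * (θ + d) ≤ m := by
      rw [← abs_of_pos hs0, ← abs_mul, hθ]; exact hp
    nlinarith [abs_nonneg θ]
  have hbd : ∀ x, |x| ≤ c * k ^ 3 → |x / (θ + d)| ≤ 4 * c / k := by
    intro x hx
    rw [abs_div, abs_of_pos hs0, div_le_div_iff₀ hs0 hk0]
    have h1 : k ^ 4 / 4 ≤ θ + d := by linarith
    calc |x| * k ≤ c * k ^ 3 * k := by gcongr
      _ = 4 * c * (k ^ 4 / 4) := by ring
      _ ≤ 4 * c * (θ + d) := by gcongr
  have hhalf : 4 * c / k ≤ 1 / 2 := by rw [div_le_div_iff₀ hk0 two_pos]; linarith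
  have hδ := hbd g hg
  have hε := hbd h hh
  have hθb := abs_le.1 hθ1
  obtain ⟨ω₁, e₁, l₁, u₁, n₁⟩ := sqrt_near (μ := k) (l := k ^ 2 + A - θ) (m := m) hk0
    (by rw [abs_le]; constructor <;> linarith [hA.1, hA.2]) (by linarith)
  obtain ⟨ω₂, e₂, l₂, u₂, n₂⟩ := sqrt_near (μ := k ^ 2) (l := k ^ 4 + D + θ) (m := m)
    (by positivity)
    (by rw [abs_le]; constructor <;> ring_nf <;> linarith [hD.1, hD.2])
    (by rw [← pow_mul]; norm_num; linarith)
  have hg' : g / (θ + d) * (θ + d) = g := div_mul_cancel₀ _ hs0.ne'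
  have hh' : h / (θ + d) * (θ + d) = h := div_mul_cancel₀ _ hs0.ne'
  have hgθ : g / (θ + d) * h = θ := by
    rw [div_mul_eq_mul_div, hgh, ← hθ, mul_div_cancel_right₀ _ hs0.ne']
  have hhθ : h / (θ + d) * g = θ := by
    rw [div_mul_eq_mul_div, mul_comm h, hgh, ← hθ, mul_div_cancel_right₀ _ hs0.ne']
  -- With these values `(1, -δ)` and `(-ε, 1)` are left eigenvectors of the stiffness matrix, for
  -- `ω₁²` and `ω₂²`.
  refine ⟨g / (θ + d), -(h / (θ + d)), ω₁, ω₂, ⟨hδ, by rwa [abs_neg], hδ.trans hhalf,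
    by rw [abs_neg]; exact hε.trans hhalf⟩, ⟨l₁, u₁, n₁⟩, ⟨l₂, u₂, n₂.trans ?_⟩, ⟨?_, ?_⟩, ⟨?_, ?_⟩⟩
  · gcongr
    nlinarith
  · rw [hgθ, e₁]
  · rw [e₁]
    linear_combination hg' + g / (θ + d) * hd
  · rw [e₂]
    linear_combination hhθ
  · rw [e₂]
    linear_combination hh' + h / (θ + d) * hd

theorem abs_cos_sub_cos_le (x y : ℝ) : |Real.cos x - Real.cos y| ≤ |x - y| := by
  rw [Real.cos_sub_cos]
  have h1 := Real.abs_sin_le_one ((x + y) / 2)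
  have h2 : |Real.sin ((x - y) / 2)| ≤ |(x - y) / 2| := Real.abs_sin_le_abs
  rw [abs_div, abs_two] at h2
  rw [abs_mul, abs_mul, abs_neg, abs_two]
  nlinarith [abs_nonneg (Real.sin ((x + y) / 2)), abs_nonneg (Real.sin ((x - y) / 2))]

theorem abs_sin_sub_sin_le (x y : ℝ) : |Real.sin x - Real.sin y| ≤ |x - y| := by
  simpa [Real.cos_sub_pi_div_two] using
    abs_cos_sub_cos_le (x - Real.pi / 2) (y - Real.pi / 2)

/-- A rotation of frequency `ω` is close to the rotation with the same initial data and
frequency `μ`. -/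
theorem abs_rotation_sub_le {ω μ ρ N a b t : ℝ} (hω : |ω - μ| ≤ ρ) (ha : |a| ≤ N) (hb : |b| ≤ N) :
    |(a * Real.cos (ω * t) + b * Real.sin (ω * t)) -
      (a * Real.cos (μ * t) + b * Real.sin (μ * t))| ≤ 2 * (ρ * |t|) * N := by
  have h0 : |ω * t - μ * t| ≤ ρ * |t| := by
    rw [← sub_mul, abs_mul]; gcongr
  have h1 := (abs_cos_sub_cos_le (ω * t) (μ * t)).trans h0
  have h2 := (abs_sin_sub_sin_le (ω * t) (μ * t)).trans h0
  have hN : 0 ≤ N := (abs_nonneg a).trans ha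
  calc _ = |a * (Real.cos (ω * t) - Real.cos (μ * t)) + b * (Real.sin (ω * t) - Real.sin (μ * t))| := by
        congr 1; ring
    _ ≤ |a| * |Real.cos (ω * t) - Real.cos (μ * t)| + |b| * |Real.sin (ω * t) - Real.sin (μ * t)| := by
        rw [← abs_mul, ← abs_mul]; exact abs_add_le _ _
    _ ≤ N * (ρ * |t|) + N * (ρ * |t|) := by gcongr
    _ = _ := by ring

theorem abs_rotation_le {a b N θ : ℝ} (hN : 0 ≤ N) (h : a ^ 2 + b ^ 2 ≤ N ^ 2) :
    |a * Real.cos θ + b * Real.sin θ| ≤ N ∧ |b * Real.cos θ - a * Real.sin θ| ≤ N := by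
  have h1 := Real.sin_sq_add_cos_sq θ
  have h2 : (a * Real.cos θ + b * Real.sin θ) ^ 2 + (b * Real.cos θ - a * Real.sin θ) ^ 2
      = a ^ 2 + b ^ 2 := by linear_combination (a ^ 2 + b ^ 2) * h1
  constructor
  · exact abs_le_of_sq_le_sq (by nlinarith [sq_nonneg (b * Real.cos θ - a * Real.sin θ)]) hN
  · exact abs_le_of_sq_le_sq (by nlinarith [sq_nonneg (a * Real.cos θ + b * Real.sin θ)]) hN

theorem sum_four_sq_le {a b c d C Z : ℝ} (ha : |a| ≤ C * Z) (hb : |b| ≤ C * Z) (hc : |c| ≤ C * Z)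
    (hd : |d| ≤ C * Z) : a ^ 2 + b ^ 2 + c ^ 2 + d ^ 2 ≤ (2 * C) ^ 2 * Z ^ 2 := by
  have h : ∀ x, |x| ≤ C * Z → x ^ 2 ≤ (C * Z) ^ 2 := fun x hx => sq_le_sq' (abs_le.1 hx).1 (abs_le.1 hx).2
  linarith [h a ha, h b hb, h c hc, h d hd]

/-- The equations of motion of one rescaled block. -/
structure IsBlockSolution (A D k g h : ℝ) (x₁ x₂ y₁ y₂ : ℝ → ℝ) : Prop where
  deriv_x₁ : ∀ t, HasDerivAt x₁ (k * y₁ t) t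
  deriv_x₂ : ∀ t, HasDerivAt x₂ (k ^ 2 * y₂ t) t
  deriv_y₁ : ∀ t, HasDerivAt y₁ (-((k ^ 2 + A) * x₁ t + g * x₂ t) / k) t
  deriv_y₂ : ∀ t, HasDerivAt y₂ (-((k ^ 4 + D) * x₂ t + h * x₁ t) / k ^ 2) t

/-- A linear combination of two numbers with coefficient bounds. -/
theorem abs_add_mul_le {x y u v Z p q : ℝ} (hx : |x| ≤ Z) (hy : |y| ≤ Z) (hu : |u| ≤ p)
    (hv : |v| ≤ q) : |u * x + v * y| ≤ (p + q) * Z := by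
  have hp : 0 ≤ p := (abs_nonneg u).trans hu
  have hq : 0 ≤ q := (abs_nonneg v).trans hv
  calc _ ≤ |u| * |x| + |v| * |y| := by rw [← abs_mul, ← abs_mul]; exact abs_add_le _ _
    _ ≤ p * Z + q * Z := by gcongr
    _ = _ := by ring

set_option maxHeartbeats 1000000 in
/-- For large `k`, the solutions of the block equations are, up to `O(1/k)`, pairs of rotations of
frequencies `k` and `k²`, with coefficients comparable to the state. -/
theorem exists_rotations (A D p : ℝ) {c : ℝ} (hc : 0 ≤ c) : ∃ C K₀ : ℝ, 0 ≤ C ∧ 1 ≤ K₀ ∧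
    ∀ k : ℝ, K₀ ≤ k → ∀ g h : ℝ, g * h = p → |g| ≤ c * k ^ 3 → |h| ≤ c * k ^ 3 →
    ∀ x₁ x₂ y₁ y₂ : ℝ → ℝ, IsBlockSolution A D k g h x₁ x₂ y₁ y₂ → ∃ a b a' b' : ℝ,
      a ^ 2 + b ^ 2 + a' ^ 2 + b' ^ 2 ≤ C ^ 2 * (x₁ 0 ^ 2 + x₂ 0 ^ 2 + y₁ 0 ^ 2 + y₂ 0 ^ 2) ∧
      ∀ t, x₁ t ^ 2 + x₂ t ^ 2 + y₁ t ^ 2 + y₂ t ^ 2 ≤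
          C ^ 2 * (a ^ 2 + b ^ 2 + a' ^ 2 + b' ^ 2) ∧
        |x₁ t - (a * Real.cos (k * t) + b * Real.sin (k * t))| ≤
          C * (1 + |t|) / k * √(a ^ 2 + b ^ 2 + a' ^ 2 + b' ^ 2) ∧
        |x₂ t - (a' * Real.cos (k ^ 2 * t) + b' * Real.sin (k ^ 2 * t))| ≤
          C * (1 + |t|) / k * √(a ^ 2 + b ^ 2 + a' ^ 2 + b' ^ 2) := by
  obtain ⟨m, K₀, hm, hK₀, H⟩ := exists_modes A D p hc
  -- `4 + 16 c` bounds each normal coordinate by the state and conversely; the factor 2 comes from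
  -- adding four squares, and `2 m` from the frequency shift.
  refine ⟨2 * (4 + 16 * c) + 2 * m, K₀, by positivity, hK₀,
    fun k hk g h hgh hg hh x₁ x₂ y₁ y₂ hsol => ?_⟩
  obtain ⟨δ, ε, ω₁, ω₂, ⟨hδ, hε, hδ', hε'⟩, ⟨lω₁, uω₁, nω₁⟩, ⟨lω₂, uω₂, nω₂⟩, ⟨e₁, e₁'⟩, ⟨e₂, e₂'⟩⟩ :=
    H k hk g h hgh hg hh
  have hk1 : 1 ≤ k := hK₀.trans hk
  have hk0 : 0 < k := by linarith
  have hω₁ : 0 < ω₁ := by linarith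
  have hω₂ : 0 < ω₂ := lt_of_lt_of_le (by positivity) lω₂
  have hεδ : |ε * δ| ≤ 1 / 2 := by
    rw [abs_mul]
    linarith [mul_le_mul hε' hδ' (abs_nonneg δ) (by norm_num)]
  obtain ⟨J, hJ⟩ : ∃ J, J = 1 - ε * δ := ⟨_, rfl⟩
  have hJ2 : 1 / 2 ≤ J := by linarith [(abs_le.1 hεδ).2]
  have hJ0 : 0 < J := by linarith
  -- Normal coordinates: `α_i` pairs the positions with a left eigenvector and `β_i` is `α_i'`
  -- divided by `ω_i`. `J` is the determinant of the change of coordinates and stays away from 0.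
  set α₁ : ℝ → ℝ := fun t => (x₁ t - δ * x₂ t) / J with hα₁
  set α₂ : ℝ → ℝ := fun t => (x₂ t - ε * x₁ t) / J with hα₂
  set β₁ : ℝ → ℝ := fun t => (k * y₁ t - δ * (k ^ 2 * y₂ t)) / (J * ω₁) with hβ₁
  set β₂ : ℝ → ℝ := fun t => (k ^ 2 * y₂ t - ε * (k * y₁ t)) / (J * ω₂) with hβ₂
  have dα₁ : ∀ t, HasDerivAt α₁ (ω₁ * β₁ t) t := fun t =>
    (((hsol.deriv_x₁ t).sub ((hsol.deriv_x₂ t).const_mul δ)).div_const _).congr_deriv (by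
      simp only [hβ₁]; field_simp)
  have dα₂ : ∀ t, HasDerivAt α₂ (ω₂ * β₂ t) t := fun t =>
    (((hsol.deriv_x₂ t).sub ((hsol.deriv_x₁ t).const_mul ε)).div_const _).congr_deriv (by
      simp only [hβ₂]; field_simp)
  have dβ₁ : ∀ t, HasDerivAt β₁ (-(ω₁ * α₁ t)) t := fun t =>
    ((((hsol.deriv_y₁ t).const_mul k).sub (((hsol.deriv_y₂ t).const_mul (k ^ 2)).const_mul δ)).div_const
      _).congr_deriv (by
        simp only [hα₁]
        field_simp
        linear_combination (x₁ t) * (-e₁) + (x₂ t) * e₁')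
  have dβ₂ : ∀ t, HasDerivAt β₂ (-(ω₂ * α₂ t)) t := fun t =>
    ((((hsol.deriv_y₂ t).const_mul (k ^ 2)).sub (((hsol.deriv_y₁ t).const_mul k).const_mul ε)).div_const
      _).congr_deriv (by
        simp only [hα₂]
        field_simp
        linear_combination (x₂ t) * (-e₂) + (x₁ t) * e₂')
  have hx₁ : ∀ t, x₁ t = 1 * α₁ t + δ * α₂ t := fun t => by
    simp only [hα₁, hα₂]; field_simp; linear_combination (x₁ t) * hJ
  have hx₂ : ∀ t, x₂ t = ε * α₁ t + 1 * α₂ t := fun t => by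
    simp only [hα₁, hα₂]; field_simp; linear_combination (x₂ t) * hJ
  have hq₁ : |ω₁ / k| ≤ 2 := by
    rw [abs_of_pos (by positivity), div_le_iff₀ hk0]; exact uω₁
  have hq₂ : |ω₂ / k ^ 2| ≤ 2 := by
    rw [abs_of_pos (by positivity), div_le_iff₀ (by positivity)]; exact uω₂
  have hr₁ : |k / (J * ω₁)| ≤ 4 := by
    rw [abs_of_pos (by positivity), div_le_iff₀ (by positivity)]
    linarith [mul_le_mul hJ2 lω₁ (by positivity) hJ0.le]
  have hr₂ : |k ^ 2 / (J * ω₂)| ≤ 4 := by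
    rw [abs_of_pos (by positivity), div_le_iff₀ (by positivity)]
    linarith [mul_le_mul hJ2 lω₂ (by positivity) hJ0.le]
  have hy₁ : ∀ t, y₁ t = (ω₁ / k) * β₁ t + (δ * k * (ω₂ / k ^ 2)) * β₂ t := fun t => by
    simp only [hβ₁, hβ₂]; field_simp; linear_combination (y₁ t) * hJ
  have hy₂ : ∀ t, y₂ t = (ε / k * (ω₁ / k)) * β₁ t + (ω₂ / k ^ 2) * β₂ t := fun t => by
    simp only [hβ₁, hβ₂]; field_simp; linear_combination (y₂ t) * k * hJ
  -- In `y₁` the mode of frequency `ω₂` enters with the factor `δ k`, which is bounded but not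
  -- small. The velocities are therefore only comparable to the modes; the `O(1/k)` closeness
  -- concerns the positions.
  have hδk : |δ * k| ≤ 4 * c := by
    rw [abs_mul, abs_of_pos hk0]; rwa [le_div_iff₀ hk0] at hδ
  have hεk : |ε / k| ≤ 4 * c := by
    rw [abs_div, abs_of_pos hk0]
    refine (div_le_self (abs_nonneg _) hk1).trans (hε.trans (div_le_self (by positivity) hk1))
  have hmul : ∀ {x y p q : ℝ}, |x| ≤ p → |y| ≤ q → |x * y| ≤ p * q := fun hx hy => by
    rw [abs_mul]; exact mul_le_mul hx hy (abs_nonneg _) ((abs_nonneg _).trans hx)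
  set N := √(α₁ 0 ^ 2 + β₁ 0 ^ 2 + α₂ 0 ^ 2 + β₂ 0 ^ 2) with hN
  have hN0 : 0 ≤ N := Real.sqrt_nonneg _
  have hN2 : N ^ 2 = α₁ 0 ^ 2 + β₁ 0 ^ 2 + α₂ 0 ^ 2 + β₂ 0 ^ 2 := Real.sq_sqrt (by positivity)
  refine ⟨α₁ 0, β₁ 0, α₂ 0, β₂ 0, ?_, fun t => ?_⟩
  · set Z := √(x₁ 0 ^ 2 + x₂ 0 ^ 2 + y₁ 0 ^ 2 + y₂ 0 ^ 2) with hZ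
    have hZ0 : 0 ≤ Z := Real.sqrt_nonneg _
    have hZ2 : Z ^ 2 = x₁ 0 ^ 2 + x₂ 0 ^ 2 + y₁ 0 ^ 2 + y₂ 0 ^ 2 := Real.sq_sqrt (by positivity)
    have s₁ := sq_nonneg (x₁ 0)
    have s₂ := sq_nonneg (x₂ 0)
    have s₃ := sq_nonneg (y₁ 0)
    have s₄ := sq_nonneg (y₂ 0)
    have zx₁ : |x₁ 0| ≤ Z :=
      abs_le_of_sq_le_sq (by linarith only [hZ2, s₁, s₂, s₃, s₄]) hZ0
    have zx₂ : |x₂ 0| ≤ Z :=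
      abs_le_of_sq_le_sq (by linarith only [hZ2, s₁, s₂, s₃, s₄]) hZ0
    have zy₁ : |y₁ 0| ≤ Z :=
      abs_le_of_sq_le_sq (by linarith only [hZ2, s₁, s₂, s₃, s₄]) hZ0
    have zy₂ : |y₂ 0| ≤ Z :=
      abs_le_of_sq_le_sq (by linarith only [hZ2, s₁, s₂, s₃, s₄]) hZ0
    have hJi : |1 / J| ≤ 2 := by
      rw [abs_of_pos (by positivity), div_le_iff₀ hJ0]; linarith
    have weak : ∀ {x C' : ℝ}, |x| ≤ C' * Z → C' ≤ 4 + 16 * c → |x| ≤ (4 + 16 * c) * Z :=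
      fun hx hC' => hx.trans (by gcongr)
    have b₁ : |α₁ 0| ≤ (4 + 16 * c) * Z := by
      have e : α₁ 0 = (1 / J) * x₁ 0 + (1 / J * -δ) * x₂ 0 := by simp only [hα₁]; ring
      rw [e]
      exact weak (abs_add_mul_le zx₁ zx₂ hJi (hmul hJi ((abs_neg δ).trans_le hδ')))
        (by linarith)
    have b₂ : |α₂ 0| ≤ (4 + 16 * c) * Z := by
      have e : α₂ 0 = (1 / J * -ε) * x₁ 0 + (1 / J) * x₂ 0 := by simp only [hα₂]; ring
      rw [e]
      exact weak (abs_add_mul_le zx₁ zx₂ (hmul hJi ((abs_neg ε).trans_le hε')) hJi)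
        (by linarith)
    have b₃ : |β₁ 0| ≤ (4 + 16 * c) * Z := by
      have e : β₁ 0 = (k / (J * ω₁)) * y₁ 0 + (k / (J * ω₁) * -(δ * k)) * y₂ 0 := by
        simp only [hβ₁]; ring
      rw [e]
      exact weak (abs_add_mul_le zy₁ zy₂ hr₁ (hmul hr₁ ((abs_neg (δ * k)).trans_le hδk)))
        (by linarith)
    have b₄ : |β₂ 0| ≤ (4 + 16 * c) * Z := by
      have e : β₂ 0 = (k ^ 2 / (J * ω₂) * -(ε / k)) * y₁ 0 + (k ^ 2 / (J * ω₂)) * y₂ 0 := by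
        simp only [hβ₂]; field_simp; ring
      rw [e]
      exact weak (abs_add_mul_le zy₁ zy₂ (hmul hr₂ ((abs_neg (ε / k)).trans_le hεk)) hr₂)
        (by linarith)
    rw [← hZ2]
    refine (sum_four_sq_le b₁ b₃ b₂ b₄).trans ?_
    gcongr
    linarith
  · have n₁ : α₁ 0 ^ 2 + β₁ 0 ^ 2 ≤ N ^ 2 := by
      rw [hN2]; linarith only [sq_nonneg (α₂ 0), sq_nonneg (β₂ 0)]
    have n₂ : α₂ 0 ^ 2 + β₂ 0 ^ 2 ≤ N ^ 2 := by
      rw [hN2]; linarith only [sq_nonneg (α₁ 0), sq_nonneg (β₁ 0)]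
    obtain ⟨r₁, r₁'⟩ := rotation_eq dα₁ dβ₁ t
    obtain ⟨r₂, r₂'⟩ := rotation_eq dα₂ dβ₂ t
    have bα₁ : |α₁ t| ≤ N := by rw [r₁]; exact (abs_rotation_le hN0 n₁).1
    have bβ₁ : |β₁ t| ≤ N := by rw [r₁']; exact (abs_rotation_le hN0 n₁).2
    have bα₂ : |α₂ t| ≤ N := by rw [r₂]; exact (abs_rotation_le hN0 n₂).1
    have bβ₂ : |β₂ t| ≤ N := by rw [r₂']; exact (abs_rotation_le hN0 n₂).2
    have sq0 : ∀ {x y : ℝ}, x ^ 2 + y ^ 2 ≤ N ^ 2 → |x| ≤ N ∧ |y| ≤ N := fun {x y} h =>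
      ⟨abs_le_of_sq_le_sq (by linarith only [h, sq_nonneg y]) hN0,
        abs_le_of_sq_le_sq (by linarith only [h, sq_nonneg x]) hN0⟩
    have weak : ∀ {x C' : ℝ}, |x| ≤ C' * N → C' ≤ 4 + 16 * c → |x| ≤ (4 + 16 * c) * N :=
      fun hx hC' => hx.trans (by gcongr)
    have one : |(1 : ℝ)| ≤ 1 := by simp
    -- The error has two sources: the frequency shift, growing with `|t|`, and the admixture of the
    -- other mode, of size `4 c / k`.
    have near : ∀ {u v x : ℝ}, |u| ≤ 2 * (m / k * |t|) * N → |v| ≤ 4 * c / k → |x| ≤ N →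
        |u + v * x| ≤ (2 * (4 + 16 * c) + 2 * m) * (1 + |t|) / k * N := by
      intro u v x hu hv hx
      calc |u + v * x| ≤ |u| + |v * x| := abs_add_le _ _
        _ ≤ 2 * (m / k * |t|) * N + 4 * c / k * N := add_le_add hu (hmul hv hx)
        _ = (2 * m * |t| + 4 * c) / k * N := by ring
        _ ≤ _ := by
          gcongr
          nlinarith only [hc, hm, abs_nonneg t, mul_nonneg hc (abs_nonneg t)]
    refine ⟨?_, ?_, ?_⟩
    · rw [← hN2]
      refine (sum_four_sq_le (C := 4 + 16 * c) (Z := N) ?_ ?_ ?_ ?_).trans (by gcongr; linarith)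
      · rw [hx₁]; exact weak (abs_add_mul_le bα₁ bα₂ one hδ') (by linarith)
      · rw [hx₂]; exact weak (abs_add_mul_le bα₁ bα₂ hε' one) (by linarith)
      · rw [hy₁]; exact weak (abs_add_mul_le bβ₁ bβ₂ hq₁ (hmul hδk hq₂)) (by linarith)
      · rw [hy₂]; exact weak (abs_add_mul_le bβ₁ bβ₂ (hmul hεk hq₁) hq₂) (by linarith)
    · have e : x₁ t - (α₁ 0 * Real.cos (k * t) + β₁ 0 * Real.sin (k * t)) =
          (α₁ t - (α₁ 0 * Real.cos (k * t) + β₁ 0 * Real.sin (k * t))) + δ * α₂ t := by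
        rw [hx₁]; ring
      rw [e]
      refine near ?_ hδ bα₂
      rw [r₁]
      exact abs_rotation_sub_le nω₁ (sq0 n₁).1 (sq0 n₁).2
    · have e : x₂ t - (α₂ 0 * Real.cos (k ^ 2 * t) + β₂ 0 * Real.sin (k ^ 2 * t)) =
          (α₂ t - (α₂ 0 * Real.cos (k ^ 2 * t) + β₂ 0 * Real.sin (k ^ 2 * t))) + ε * α₁ t := by
        rw [hx₂]; ring
      rw [e]
      refine near ?_ hε bα₁
      rw [r₂]
      exact abs_rotation_sub_le nω₂ (sq0 n₂).1 (sq0 n₂).2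

/-! ### The rescaled blocks of the string-beam system -/

/-- The generator of the rescaled block with parameter `k` and couplings `g`, `h`. -/
def blockGen (A D k g h : ℝ) : EuclideanSpace ℝ (Fin 4) →L[ℝ] EuclideanSpace ℝ (Fin 4) :=
  LinearMap.toContinuousLinearMap
    { toFun := fun z => !₂[k * z 2, k ^ 2 * z 3, -((k ^ 2 + A) * z 0 + g * z 1) / k,
        -((k ^ 4 + D) * z 1 + h * z 0) / k ^ 2]
      map_add' := fun x y => by ext i; fin_cases i <;> simp <;> ring
      map_smul' := fun c x => by ext i; fin_cases i <;> simp <;> ring }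

theorem blockGen_apply (A D k g h : ℝ) (z : EuclideanSpace ℝ (Fin 4)) :
    blockGen A D k g h z = !₂[k * z 2, k ^ 2 * z 3, -((k ^ 2 + A) * z 0 + g * z 1) / k,
        -((k ^ 4 + D) * z 1 + h * z 0) / k ^ 2] := rfl

/-- The projection onto the first two coordinates. -/
def posProj : EuclideanSpace ℝ (Fin 4) →L[ℝ] EuclideanSpace ℝ (Fin 2) :=
  LinearMap.toContinuousLinearMap
    { toFun := fun z => !₂[z 0, z 1]
      map_add' := fun x y => by ext i; fin_cases i <;> simp
      map_smul' := fun c x => by ext i; fin_cases i <;> simp }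

theorem posProj_apply (z : EuclideanSpace ℝ (Fin 4)) : posProj z = !₂[z 0, z 1] := rfl

theorem norm_sq_fin_four (z : EuclideanSpace ℝ (Fin 4)) :
    ‖z‖ ^ 2 = z 0 ^ 2 + z 1 ^ 2 + z 2 ^ 2 + z 3 ^ 2 := by
  rw [EuclideanSpace.norm_sq_eq, Fin.sum_univ_four]
  simp only [Real.norm_eq_abs, sq_abs]

theorem norm_sq_fin_two (z : EuclideanSpace ℝ (Fin 2)) : ‖z‖ ^ 2 = z 0 ^ 2 + z 1 ^ 2 := by
  rw [EuclideanSpace.norm_sq_eq, Fin.sum_univ_two]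
  simp only [Real.norm_eq_abs, sq_abs]

theorem isBlockSolution_of_hasDerivAt {A D k g h : ℝ} {z : ℝ → EuclideanSpace ℝ (Fin 4)}
    (hz : ∀ t, HasDerivAt z (blockGen A D k g h (z t)) t) :
    IsBlockSolution A D k g h (fun t => z t 0) (fun t => z t 1) (fun t => z t 2)
      (fun t => z t 3) := by
  have key : ∀ i t, HasDerivAt (fun t => z t i) (blockGen A D k g h (z t) i) t := fun i t =>
    (EuclideanSpace.proj (𝕜 := ℝ) i).hasFDerivAt.comp_hasDerivAt t (hz t)
  exact ⟨key 0, key 1, key 2, key 3⟩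

/-- If both positions vanish on an interval, so do their one-sided derivatives `k y₁` and `k² y₂` at
0. No condition on the couplings is needed. -/
theorem eq_zero_of_posProj_flow {A D k g h T : ℝ} (hk : k ≠ 0) (hT : 0 < T)
    (z : EuclideanSpace ℝ (Fin 4))
    (hz : ∀ t ∈ Set.Icc 0 T, posProj (flow (blockGen A D k g h) t z) = 0) : z = 0 := by
  have hsol := isBlockSolution_of_hasDerivAt (hasDerivAt_flow_apply (blockGen A D k g h) z)
  have h0 : ∀ t ∈ Set.Icc 0 T, flow (blockGen A D k g h) t z 0 = 0 := fun t ht => by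
    have := congrArg (fun x : EuclideanSpace ℝ (Fin 2) => x 0) (hz t ht)
    simpa [posProj_apply] using this
  have h1 : ∀ t ∈ Set.Icc 0 T, flow (blockGen A D k g h) t z 1 = 0 := fun t ht => by
    have := congrArg (fun x : EuclideanSpace ℝ (Fin 2) => x 1) (hz t ht)
    simpa [posProj_apply] using this
  have key : ∀ {x : ℝ → ℝ} {x' : ℝ}, HasDerivAt x x' 0 → (∀ t ∈ Set.Icc 0 T, x t = 0) →
      x' = 0 := by
    intro x x' hx hx0
    have hu : UniqueDiffWithinAt ℝ (Set.Icc 0 T) 0 :=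
      uniqueDiffOn_Icc hT 0 ⟨le_rfl, hT.le⟩
    exact hu.eq_deriv _ hx.hasDerivWithinAt
      ((hasDerivWithinAt_const 0 _ (0 : ℝ)).congr hx0 (hx0 0 ⟨le_rfl, hT.le⟩))
  have e0 := h0 0 ⟨le_rfl, hT.le⟩
  have e1 := h1 0 ⟨le_rfl, hT.le⟩
  have e2 := key (hsol.deriv_x₁ 0) h0
  have e3 := key (hsol.deriv_x₂ 0) h1
  simp only [flow_zero, ContinuousLinearMap.id_apply, mul_eq_zero, hk, pow_eq_zero_iff, ne_eq,
    OfNat.ofNat_ne_zero, not_false_eq_true, false_or] at e0 e1 e2 e3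
  ext i
  fin_cases i
  exacts [e0, e1, e2, e3]

theorem norm_posProj_sub_le {z : EuclideanSpace ℝ (Fin 4)} {p q r : ℝ} (h₁ : |z 0 - p| ≤ r)
    (h₂ : |z 1 - q| ≤ r) : ‖posProj z - !₂[p, q]‖ ≤ 2 * r := by
  have hr : 0 ≤ r := (abs_nonneg _).trans h₁
  refine le_of_sq_le_sq ?_ (by positivity)
  rw [norm_sq_fin_two]
  have e₁ := sq_le_sq' (abs_le.1 h₁).1 (abs_le.1 h₁).2
  have e₂ := sq_le_sq' (abs_le.1 h₂).1 (abs_le.1 h₂).2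
  simp only [posProj_apply, PiLp.sub_apply, Matrix.cons_val_zero, Matrix.cons_val_one]
  nlinarith

/-! ### Comparison of the high blocks with rotations -/

section Model

variable {A D p c : ℝ} {g h : ℕ+ → ℝ}

/-- The couplings of the blocks have constant product and grow at most like `k³`. -/
structure IsCoupling (p c : ℝ) (g h : ℕ+ → ℝ) : Prop where
  nonneg : 0 ≤ c
  mul_eq : ∀ k, g k * h k = p
  le_left : ∀ k : ℕ+, |g k| ≤ c * (k : ℝ) ^ 3
  le_right : ∀ k : ℕ+, |h k| ≤ c * (k : ℝ) ^ 3

theorem finite_pnat_lt (K : ℝ) : {k : ℕ+ | (k : ℝ) < K}.Finite := by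
  refine Set.Finite.subset (Set.finite_Iic (⌈K⌉₊.succPNat)) fun k hk => ?_
  have h1 : ((k : ℕ) : ℝ) < K := hk
  have h2 : ((k : ℕ) : ℝ) < (⌈K⌉₊ : ℝ) := h1.trans_le (Nat.le_ceil K)
  have h3 : (k : ℕ) < ⌈K⌉₊ := by exact_mod_cast h2
  rw [Set.mem_Iic, ← PNat.coe_le_coe, Nat.succPNat_coe]
  omega

/-- The pair of rotations with frequencies `k` and `k²`. -/
def rotFun (k : ℕ+) (a b a' b' : ℝ) : C(ℝ, EuclideanSpace ℝ (Fin 2)) where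
  toFun t := !₂[a * Real.cos (((k : ℕ) : ℝ) * t) + b * Real.sin (((k : ℕ) : ℝ) * t),
    a' * Real.cos ((((k : ℕ) ^ 2 : ℕ) : ℝ) * t) + b' * Real.sin ((((k : ℕ) ^ 2 : ℕ) : ℝ) * t)]
  continuous_toFun := by
    refine (PiLp.continuous_toLp 2 _).comp (continuous_pi fun i => ?_)
    fin_cases i
    · simp; fun_prop
    · simp; fun_prop

/-- The string and beam components are orthogonal in `ℝ²`, so only the frequencies `k` among
themselves and `k²` among themselves must be distinct; equalities `j = k²` do no harm. -/
theorem norm_toL2_sum_rotFun_sq (m : ℕ) (s : Finset ℕ+) (a b a' b' : ℕ+ → ℝ) :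
    ‖toL2 (2 * Real.pi * m) (∑ k ∈ s, rotFun k (a k) (b k) (a' k) (b' k))‖ ^ 2 =
      Real.pi * m * ∑ k ∈ s, (a k ^ 2 + b k ^ 2 + a' k ^ 2 + b' k ^ 2) := by
  rw [norm_toL2_sq]
  have h1 := integral_trig_sum_sq m s (fun k : ℕ+ => (k : ℕ)) PNat.coe_injective
    (fun k => k.pos) a b
  have h2 := integral_trig_sum_sq m s (fun k : ℕ+ => (k : ℕ) ^ 2)
    (fun i j hij => PNat.coe_injective (Nat.pow_left_injective two_ne_zero hij))
    (fun k => pow_pos k.pos 2) a' b'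
  have h3 : ∀ t : ℝ, ‖(∑ k ∈ s, rotFun k (a k) (b k) (a' k) (b' k)) t‖ ^ 2 =
      (∑ k ∈ s, (a k * Real.cos (((k : ℕ) : ℝ) * t) + b k * Real.sin (((k : ℕ) : ℝ) * t))) ^ 2 +
      (∑ k ∈ s, (a' k * Real.cos ((((k : ℕ) ^ 2 : ℕ) : ℝ) * t) +
        b' k * Real.sin ((((k : ℕ) ^ 2 : ℕ) : ℝ) * t))) ^ 2 := by
    intro t
    rw [norm_sq_fin_two]
    simp [rotFun]
  simp_rw [h3]
  rw [integral_add, h1, h2, ← mul_add, ← Finset.sum_add_distrib]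
  · congr 1
    exact Finset.sum_congr rfl fun k _ => by ring
  · exact (by fun_prop : Continuous _).continuousOn.integrableOn_Icc
  · exact (by fun_prop : Continuous _).continuousOn.integrableOn_Icc

/-- The high blocks are close to pairs of rotations. -/
theorem exists_block_rotations (A D : ℝ) (hgh : IsCoupling p c g h) :
    ∃ (L : Finset ℕ+) (C : ℝ), 0 ≤ C ∧ ∀ k ∉ L, ∀ z : EuclideanSpace ℝ (Fin 4),
      ∃ a b a' b' N : ℝ, 0 ≤ N ∧ N ^ 2 = a ^ 2 + b ^ 2 + a' ^ 2 + b' ^ 2 ∧ N ≤ C * ‖z‖ ∧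
        (∀ t, ‖flow (blockGen A D k (g k) (h k)) t z‖ ≤ C * N) ∧
        ∀ t, ‖obsFun posProj (blockGen A D k (g k) (h k)) z t - rotFun k a b a' b' t‖ ≤
          C * (1 + |t|) * (1 / (k : ℝ)) * N := by
  obtain ⟨C, K₀, hC, hK₀, H⟩ := exists_rotations A D p hgh.nonneg
  refine ⟨(finite_pnat_lt K₀).toFinset, 2 * C, by positivity, fun k hk z => ?_⟩
  have hk' : K₀ ≤ (k : ℝ) := by simpa using hk
  obtain ⟨a, b, a', b', h1, h2⟩ := H k hk' (g k) (h k) (hgh.mul_eq k) (hgh.le_left k)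
    (hgh.le_right k) _ _ _ _
    (isBlockSolution_of_hasDerivAt (hasDerivAt_flow_apply (blockGen A D k (g k) (h k)) z))
  set N := √(a ^ 2 + b ^ 2 + a' ^ 2 + b' ^ 2) with hN
  have hN0 : 0 ≤ N := Real.sqrt_nonneg _
  have hN2 : N ^ 2 = a ^ 2 + b ^ 2 + a' ^ 2 + b' ^ 2 := Real.sq_sqrt (by positivity)
  refine ⟨a, b, a', b', N, hN0, hN2, ?_, fun t => ?_, fun t => ?_⟩
  · simp only [flow_zero, ContinuousLinearMap.id_apply] at h1
    rw [← hN2, ← norm_sq_fin_four, ← mul_pow] at h1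
    have := le_of_sq_le_sq h1 (by positivity)
    nlinarith [mul_nonneg hC (norm_nonneg z)]
  · have h3 := (h2 t).1
    rw [← hN2, ← norm_sq_fin_four, ← mul_pow] at h3
    have := le_of_sq_le_sq h3 (by positivity)
    nlinarith [mul_nonneg hC hN0]
  · have h3 := norm_posProj_sub_le (h2 t).2.1 (h2 t).2.2
    have e : rotFun k a b a' b' t = !₂[a * Real.cos ((k : ℝ) * t) + b * Real.sin ((k : ℝ) * t),
        a' * Real.cos ((k : ℝ) ^ 2 * t) + b' * Real.sin ((k : ℝ) ^ 2 * t)] := by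
      simp [rotFun]
    rw [obsFun_apply, e]
    refine h3.trans (le_of_eq ?_)
    ring

/-- The bound on the high blocks is uniform in time; the finitely many others are bounded on `[-T,
T]` by continuity. -/
theorem flowBounded_of_compl {ι E : Type*} [NormedAddCommGroup E] [NormedSpace ℝ E]
    [CompleteSpace E] {M : ι → E →L[ℝ] E} (L : Finset ι) {C : ℝ} (hC0 : 0 ≤ C)
    (hC : ∀ k ∉ L, ∀ t, ‖flow (M k) t‖ ≤ C) : FlowBounded M := by
  intro T
  choose B hB using fun k => exists_norm_flow_le (M k) T
  refine ⟨C + ∑ k ∈ L, |B k|, fun k t ht => ?_⟩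
  by_cases hk : k ∈ L
  · have h1 : |B k| ≤ ∑ k ∈ L, |B k| :=
      Finset.single_le_sum (f := fun k => |B k|) (fun _ _ => abs_nonneg _) hk
    linarith [hB k t ht, le_abs_self (B k)]
  · have h1 : 0 ≤ ∑ k ∈ L, |B k| := Finset.sum_nonneg fun _ _ => abs_nonneg _
    linarith [hC k hk t]

theorem flowBounded_blockGen (A D : ℝ) (hgh : IsCoupling p c g h) :
    FlowBounded fun k : ℕ+ => blockGen A D k (g k) (h k) := by
  obtain ⟨L, C, hC, H⟩ := exists_block_rotations A D hgh
  refine flowBounded_of_compl L (mul_nonneg hC hC) fun k hk t => ?_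
  refine ContinuousLinearMap.opNorm_le_bound _ (by positivity) fun z => ?_
  obtain ⟨a, b, a', b', N, hN0, -, h1, h2, -⟩ := H k hk z
  calc _ ≤ C * N := h2 t
    _ ≤ C * (C * ‖z‖) := by gcongr
    _ = _ := by ring

/-- The observation of finitely many high blocks is close to that of the rotations. -/
theorem exists_high_blocks_estimate (A D : ℝ) (hgh : IsCoupling p c g h) :
    ∃ (L : Finset ℕ+) (C : ℝ), 0 ≤ C ∧ ∀ s : Finset ℕ+, Disjoint s L →
      ∀ z : ℕ+ → EuclideanSpace ℝ (Fin 4), ∃ N : ℝ, 0 ≤ N ∧ N ≤ C * √(∑ k ∈ s, ‖z k‖ ^ 2) ∧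
        √(∑ k ∈ s, ‖z k‖ ^ 2) ≤ C * N ∧ ∀ m : ℕ,
        |‖∑ k ∈ s, obsBlock posProj (blockGen A D k (g k) (h k)) (2 * Real.pi * m) (z k)‖ -
          √(Real.pi * m) * N| ≤ √(2 * Real.pi * m) * (C * (1 + 2 * Real.pi * m) *
            √(∑ k ∈ s, (1 / (k : ℝ)) ^ 2) * N) := by
  obtain ⟨L, C, hC, H⟩ := exists_block_rotations A D hgh
  refine ⟨L, C, hC, fun s hs z => ?_⟩
  have H' : ∀ k, ∃ a b a' b' N : ℝ, 0 ≤ N ∧ N ^ 2 = a ^ 2 + b ^ 2 + a' ^ 2 + b' ^ 2 ∧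
      (k ∈ s → N ≤ C * ‖z k‖ ∧ ‖z k‖ ≤ C * N ∧
        ∀ t, ‖obsFun posProj (blockGen A D k (g k) (h k)) (z k) t - rotFun k a b a' b' t‖ ≤
          C * (1 + |t|) * (1 / (k : ℝ)) * N) := by
    intro k
    by_cases hk : k ∈ s
    · obtain ⟨a, b, a', b', N, h0, h1, h2, h3, h4⟩ := H k (Finset.disjoint_left.1 hs hk) (z k)
      refine ⟨a, b, a', b', N, h0, h1, fun _ => ⟨h2, ?_, h4⟩⟩
      simpa [flow_zero] using h3 0
    -- Zero rotations outside `s` serve only to make the choice total.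
    · exact ⟨0, 0, 0, 0, 0, le_rfl, by norm_num, fun h => absurd h hk⟩
  choose a b a' b' N hN0 hN2 hN using H'
  have sqle : ∀ {x y : ℝ}, 0 ≤ x → x ≤ C * y → x ^ 2 ≤ C ^ 2 * y ^ 2 := fun hx hxy => by
    rw [← mul_pow]; exact pow_le_pow_left₀ hx hxy 2
  refine ⟨√(∑ k ∈ s, N k ^ 2), Real.sqrt_nonneg _, ?_, ?_, fun m => ?_⟩
  · rw [← Real.sqrt_sq hC, ← Real.sqrt_mul (sq_nonneg C), Finset.mul_sum]
    exact Real.sqrt_le_sqrt (Finset.sum_le_sum fun k hk => sqle (hN0 k) (hN k hk).1)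
  · rw [← Real.sqrt_sq hC, ← Real.sqrt_mul (sq_nonneg C), Finset.mul_sum]
    exact Real.sqrt_le_sqrt (Finset.sum_le_sum fun k hk => sqle (norm_nonneg _) (hN k hk).2.1)
  · have hT : 0 ≤ 2 * Real.pi * m := by positivity
    set F := ∑ k ∈ s, obsFun posProj (blockGen A D k (g k) (h k)) (z k) with hF
    set R := ∑ k ∈ s, rotFun k (a k) (b k) (a' k) (b' k) with hR
    have e1 : ∑ k ∈ s, obsBlock posProj (blockGen A D k (g k) (h k)) (2 * Real.pi * m) (z k) =
        toL2 (2 * Real.pi * m) F := by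
      rw [hF, map_sum]; rfl
    -- The main term is exact, by orthogonality over `m` periods.
    have e2 : ‖toL2 (2 * Real.pi * m) R‖ = √(Real.pi * m) * √(∑ k ∈ s, N k ^ 2) := by
      rw [← Real.sqrt_sq (norm_nonneg (toL2 (2 * Real.pi * m) R)), norm_toL2_sum_rotFun_sq,
        Real.sqrt_mul (by positivity)]
      simp_rw [hN2]
    rw [e1, ← e2]
    refine (abs_norm_sub_norm_le _ _).trans ?_
    rw [← map_sub]
    refine norm_toL2_le_of_forall hT (by positivity) fun t ht => ?_
    have e3 : (F - R) t = ∑ k ∈ s, (obsFun posProj (blockGen A D k (g k) (h k)) (z k) t -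
        rotFun k (a k) (b k) (a' k) (b' k) t) := by
      simp [hF, hR, Finset.sum_sub_distrib]
    rw [e3]
    have ht' : |t| ≤ 2 * Real.pi * m := by rw [abs_of_nonneg ht.1]; exact ht.2
    -- The errors `N k / k` are added pointwise in time, without orthogonality; Cauchy–Schwarz with
    -- the weights `1 / k` suffices.
    calc _ ≤ ∑ k ∈ s, C * (1 + 2 * Real.pi * m) * ((1 / (k : ℝ)) * N k) := by
          refine norm_sum_le_of_le s fun k hk => ((hN k hk).2.2 t).trans ?_
          rw [mul_assoc]
          have := hN0 k
          gcongr
      _ = C * (1 + 2 * Real.pi * m) * ∑ k ∈ s, (1 / (k : ℝ)) * N k := by rw [Finset.mul_sum]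
      _ ≤ C * (1 + 2 * Real.pi * m) * (√(∑ k ∈ s, (1 / (k : ℝ)) ^ 2) * √(∑ k ∈ s, N k ^ 2)) := by
          gcongr
          exact Real.sum_mul_le_sqrt_mul_sqrt s _ _
      _ = _ := by ring

end Model

/-! ### Bessel inequality and observability of the high blocks -/

section Model

variable {A D p c : ℝ} {g h : ℕ+ → ℝ}

theorem summable_one_div_pnat_sq : Summable fun k : ℕ+ => (1 / (k : ℝ)) ^ 2 := by
  have h1 : Summable fun k : ℕ+ => ((k : ℝ) ^ 2)⁻¹ :=
    (Real.summable_nat_pow_inv.2 (by norm_num : 1 < 2)).comp_injective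
      (i := fun k : ℕ+ => (k : ℕ)) PNat.coe_injective
  exact h1.congr fun k => by rw [one_div, inv_pow]

/-- Splitting off the blocks in `L` adds finitely many bounded operators, whose norms are added to
the constant. -/
theorem bessel_of_compl {ι E G : Type*} [NormedAddCommGroup E] [NormedSpace ℝ E]
    [CompleteSpace E] [FiniteDimensional ℝ E] [NormedAddCommGroup G] [NormedSpace ℝ G]
    {P : E →L[ℝ] G} {M : ι → E →L[ℝ] E} {T : ℝ} (L : Finset ι) {C : ℝ} (hC0 : 0 ≤ C)
    (hC : ∀ s : Finset ι, Disjoint s L → ∀ z : ι → E,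
      ‖∑ k ∈ s, obsBlock P (M k) T (z k)‖ ≤ C * √(∑ k ∈ s, ‖z k‖ ^ 2)) : Bessel P M T := by
  classical
  refine ⟨C + ∑ k ∈ L, ‖obsBlock P (M k) T‖, add_nonneg hC0 (Finset.sum_nonneg fun _ _ =>
    norm_nonneg _), fun s z => ?_⟩
  rw [← Finset.sum_inter_add_sum_sdiff s L, add_comm C, add_mul]
  have hmono : ∀ t ⊆ s, √(∑ k ∈ t, ‖z k‖ ^ 2) ≤ √(∑ k ∈ s, ‖z k‖ ^ 2) := fun t ht =>
    Real.sqrt_le_sqrt (Finset.sum_le_sum_of_subset_of_nonneg ht fun _ _ _ => by positivity)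
  refine (norm_add_le _ _).trans (add_le_add ?_ ?_)
  · calc _ ≤ ∑ k ∈ s ∩ L, ‖obsBlock P (M k) T‖ * √(∑ k ∈ s, ‖z k‖ ^ 2) := by
          refine norm_sum_le_of_le _ fun k hk => ((obsBlock P (M k) T).le_opNorm _).trans ?_
          gcongr
          refine Real.le_sqrt_of_sq_le ?_
          exact Finset.single_le_sum (f := fun k => ‖z k‖ ^ 2) (fun _ _ => by positivity)
            (Finset.mem_of_mem_inter_left hk)
      _ ≤ ∑ k ∈ L, ‖obsBlock P (M k) T‖ * √(∑ k ∈ s, ‖z k‖ ^ 2) :=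
          Finset.sum_le_sum_of_subset_of_nonneg Finset.inter_subset_right fun _ _ _ => by positivity
      _ = _ := by rw [Finset.sum_mul]
  · refine (hC _ Finset.sdiff_disjoint z).trans ?_
    gcongr
    exact Finset.sdiff_subset

theorem bessel_blockGen (A D : ℝ) (hgh : IsCoupling p c g h) (m : ℕ) :
    Bessel posProj (fun k : ℕ+ => blockGen A D k (g k) (h k)) (2 * Real.pi * m) := by
  obtain ⟨L, C, hC, H⟩ := exists_high_blocks_estimate A D hgh
  set S := √(∑' k : ℕ+, (1 / (k : ℝ)) ^ 2) with hS
  refine bessel_of_compl L (C := (√(Real.pi * m) + √(2 * Real.pi * m) *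
    (C * (1 + 2 * Real.pi * m) * S)) * C) (by positivity) fun s hs z => ?_
  obtain ⟨N, hN0, hN1, -, hN⟩ := H s hs z
  have h1 := (abs_le.1 (hN m)).2
  have h2 : √(∑ k ∈ s, (1 / (k : ℝ)) ^ 2) ≤ S :=
    Real.sqrt_le_sqrt (summable_one_div_pnat_sq.sum_le_tsum s fun _ _ => by positivity)
  have h3 : √(2 * Real.pi * m) * (C * (1 + 2 * Real.pi * m) * √(∑ k ∈ s, (1 / (k : ℝ)) ^ 2) * N) ≤
      √(2 * Real.pi * m) * (C * (1 + 2 * Real.pi * m) * S * N) := by gcongr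
  calc _ ≤ (√(Real.pi * m) + √(2 * Real.pi * m) * (C * (1 + 2 * Real.pi * m) * S)) * N := by
        linarith
    _ ≤ (√(Real.pi * m) + √(2 * Real.pi * m) * (C * (1 + 2 * Real.pi * m) * S)) *
        (C * √(∑ k ∈ s, ‖z k‖ ^ 2)) := by gcongr
    _ = _ := by ring

/-- Observability of the high blocks. -/
theorem exists_high_blocks_observable (A D : ℝ) (hgh : IsCoupling p c g h) {m : ℕ} (hm : 0 < m) :
    ∃ (L : Finset ℕ+) (C : ℝ), ∀ z : lp (fun _ : ℕ+ => EuclideanSpace ℝ (Fin 4)) 2,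
      (∀ k ∈ L, z k = 0) → ‖z‖ ≤ C * ‖obs (bessel_blockGen A D hgh m) z‖ := by
  classical
  obtain ⟨L, C, hC, H⟩ := exists_high_blocks_estimate A D hgh
  set κ := √(2 * Real.pi * m) * (C * (1 + 2 * Real.pi * m)) with hκ
  have hκ0 : 0 ≤ κ := by positivity
  have hq : 0 < √(Real.pi * m) := Real.sqrt_pos.2 (by positivity)
  -- Chosen so that `(κ + 1) η` is half of `√(π m)`: outside `L'` the error is at most half the main
  -- term. The `+ 1` covers `κ = 0`.
  set η := √(Real.pi * m) / (2 * (κ + 1)) with hη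
  have hη0 : 0 < η := by positivity
  obtain ⟨L', hL'⟩ := summable_iff_vanishing_norm.1 summable_one_div_pnat_sq (η ^ 2) (by positivity)
  refine ⟨L ∪ L', 2 * C / √(Real.pi * m), fun z hz => ?_⟩
  have key : ∀ s : Finset ℕ+, √(∑ k ∈ s, ‖z k‖ ^ 2) ≤ 2 * C / √(Real.pi * m) *
      ‖∑ k ∈ s, obsBlock posProj (blockGen A D k (g k) (h k)) (2 * Real.pi * m) (z k)‖ := by
    intro s
    have hz' : ∀ k ∈ s, k ∉ s \ (L ∪ L') → z k = 0 := fun k hk hk' => by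
      refine hz k ?_
      by_contra hcon
      exact hk' (Finset.mem_sdiff.2 ⟨hk, hcon⟩)
    rw [← Finset.sum_subset (Finset.sdiff_subset (s := s) (t := L ∪ L')) (f := fun k => ‖z k‖ ^ 2)
        (fun k hk hk' => by simp [hz' k hk hk']),
      ← Finset.sum_subset (Finset.sdiff_subset (s := s) (t := L ∪ L')) (fun k hk hk' => by
        rw [hz' k hk hk', map_zero])]
    set s' := s \ (L ∪ L')
    have hd : Disjoint s' (L ∪ L') := Finset.sdiff_disjoint
    rw [Finset.disjoint_union_right] at hd
    obtain ⟨N, hN0, -, hN1, hN⟩ := H s' hd.1 fun k => z k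
    have h1 := (abs_le.1 (hN m)).1
    have h2 : √(∑ k ∈ s', (1 / (k : ℝ)) ^ 2) ≤ η := by
      have h3 := hL' s' hd.2
      rw [Real.norm_eq_abs, abs_of_nonneg (by positivity)] at h3
      exact Real.sqrt_le_iff.2 ⟨hη0.le, h3.le⟩
    have h3 : √(2 * Real.pi * m) * (C * (1 + 2 * Real.pi * m) * √(∑ k ∈ s', (1 / (k : ℝ)) ^ 2) * N)
        ≤ √(Real.pi * m) / 2 * N := by
      calc _ = κ * √(∑ k ∈ s', (1 / (k : ℝ)) ^ 2) * N := by rw [hκ]; ring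
        _ ≤ (κ + 1) * η * N := by gcongr; linarith
        _ = _ := by rw [hη]; field_simp
    have h4 : √(Real.pi * m) / 2 * N ≤ ‖∑ k ∈ s', obsBlock posProj (blockGen A D k (g k) (h k))
        (2 * Real.pi * m) (z k)‖ := by linarith
    refine hN1.trans ?_
    calc C * N = 2 * C / √(Real.pi * m) * (√(Real.pi * m) / 2 * N) := by field_simp
      _ ≤ _ := by gcongr
  have hlim1 : Tendsto (fun s : Finset ℕ+ => √(∑ k ∈ s, ‖z k‖ ^ 2)) atTop (𝓝 ‖z‖) := by
    have h1 := (ell2_summable z).hasSum.sqrt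
    rw [← ell2_norm_sq, Real.sqrt_sq (norm_nonneg z)] at h1
    exact h1
  exact le_of_tendsto_of_tendsto hlim1 ((hasSum_obs (bessel_blockGen A D hgh m) z).norm.const_mul _)
    (Eventually.of_forall key)

/-- The parameters for which the blocks are invertible and have disjoint spectra. -/
def Generic (A D p : ℝ) : Prop :=
  (∀ k : ℕ+, ((k : ℝ) ^ 2 + A) * ((k : ℝ) ^ 4 + D) ≠ p) ∧
  ∀ j k : ℕ+, j ≠ k → ∀ a b a' b' : ℝ, a = (k : ℝ) ^ 2 + A → b = (k : ℝ) ^ 4 + D →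
    a' = (j : ℝ) ^ 2 + A → b' = (j : ℝ) ^ 4 + D →
    (a' * b' - a * b + (a + b - a' - b') * a) * (a' * b' - a * b + (a + b - a' - b') * b) ≠
      (a + b - a' - b') ^ 2 * p

/-! ### Characteristic polynomials of the blocks -/

theorem eq_zero_of_det_ne_zero {α β γ δ x y : ℝ} (h₁ : α * x + β * y = 0) (h₂ : γ * x + δ * y = 0)
    (hdet : α * δ - β * γ ≠ 0) : x = 0 ∧ y = 0 := by
  constructor
  · refine (mul_eq_zero.1 (?_ : (α * δ - β * γ) * x = 0)).resolve_left hdet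
    linear_combination δ * h₁ - β * h₂
  · refine (mul_eq_zero.1 (?_ : (α * δ - β * γ) * y = 0)).resolve_left hdet
    linear_combination α * h₂ - γ * h₁

/-- The square of a block decouples positions from velocities, acting on each pair as minus a
stiffness matrix; even polynomials thus reduce to 2×2 matrices. -/
theorem blockGen_blockGen {k g h : ℝ} (hk : k ≠ 0) (z : EuclideanSpace ℝ (Fin 4)) :
    blockGen A D k g h (blockGen A D k g h z) =
      !₂[-((k ^ 2 + A) * z 0 + g * z 1), -((k ^ 4 + D) * z 1 + h * z 0),
        -((k ^ 2 + A) * z 2 + g * k * z 3), -((k ^ 4 + D) * z 3 + h / k * z 2)] := by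
  ext i
  fin_cases i <;> simp [blockGen_apply] <;> field_simp

open Polynomial

/-- The characteristic polynomial of the block with parameter `k`. -/
def blockPoly (A D p k : ℝ) : ℝ[X] :=
  X ^ 4 + C (k ^ 2 + A + (k ^ 4 + D)) * X ^ 2 + C ((k ^ 2 + A) * (k ^ 4 + D) - p)

/-- Let `K` be the stiffness matrix of block `k`. By Cayley–Hamilton, the polynomial of block `j`
acts on the positions as `c K + e`, where `c` is the difference of the traces (`k` minus `j`) and
`e` that of the determinants (`j` minus `k`). On the velocities the couplings become `g k` and `h /
k`. -/
theorem aeval_blockPoly_apply (j k g h : ℝ) (hk : k ≠ 0) (hgh : g * h = p)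
    (z : EuclideanSpace ℝ (Fin 4)) (c e : ℝ)
    (hc : c = (k ^ 2 + A + (k ^ 4 + D)) - (j ^ 2 + A + (j ^ 4 + D)))
    (he : e = (j ^ 2 + A) * (j ^ 4 + D) - (k ^ 2 + A) * (k ^ 4 + D)) :
    aeval (blockGen A D k g h) (blockPoly A D p j) z =
      !₂[(e + c * (k ^ 2 + A)) * z 0 + c * g * z 1, c * h * z 0 + (e + c * (k ^ 4 + D)) * z 1,
        (e + c * (k ^ 2 + A)) * z 2 + c * (g * k) * z 3,
        c * (h / k) * z 2 + (e + c * (k ^ 4 + D)) * z 3] := by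
  have h1 : aeval (blockGen A D k g h) (blockPoly A D p j) z =
      blockGen A D k g h (blockGen A D k g h (blockGen A D k g h (blockGen A D k g h z))) +
      (j ^ 2 + A + (j ^ 4 + D)) • blockGen A D k g h (blockGen A D k g h z) +
      ((j ^ 2 + A) * (j ^ 4 + D) - p) • z := by
    simp only [blockPoly, map_add, map_mul, map_pow, aeval_X, aeval_C, Algebra.algebraMap_eq_smul_one]
    simp [pow_succ]
    module
  rw [h1, blockGen_blockGen hk z, blockGen_blockGen hk, hc, he, ← hgh]
  ext i
  fin_cases i
  · simp; ring
  · simp; ring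
  · simp; field_simp; ring
  · simp; field_simp; ring

theorem aeval_blockPoly_self (k g h : ℝ) (hk : k ≠ 0) (hgh : g * h = p) :
    aeval (blockGen A D k g h) (blockPoly A D p k) = 0 := by
  ext z i
  rw [aeval_blockPoly_apply k k g h hk hgh z 0 0 (by ring) (by ring)]
  fin_cases i <;> simp

/-- On positions and velocities alike the 2×2 determinant is `(e + c a)(e + c b) - c² g h`, where `a
= k² + A` and `b = k⁴ + D`; its nonvanishing is the second clause of `Generic`. -/
theorem injective_aeval_blockPoly (hgen : Generic A D p) (hgh : IsCoupling p c g h) {j k : ℕ+}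
    (hjk : j ≠ k) :
    Function.Injective (aeval (blockGen A D k (g k) (h k)) (blockPoly A D p j)) := by
  have hk : (k : ℝ) ≠ 0 := by exact_mod_cast k.pos.ne'
  refine (injective_iff_map_eq_zero _).2 fun z hz => ?_
  rw [aeval_blockPoly_apply j k (g k) (h k) hk (hgh.mul_eq k) z _ _ rfl rfl] at hz
  have h0 := congrArg (fun x : EuclideanSpace ℝ (Fin 4) => x 0) hz
  have h1 := congrArg (fun x : EuclideanSpace ℝ (Fin 4) => x 1) hz
  have h2 := congrArg (fun x : EuclideanSpace ℝ (Fin 4) => x 2) hz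
  have h3 := congrArg (fun x : EuclideanSpace ℝ (Fin 4) => x 3) hz
  simp at h0 h1 h2 h3
  have hne := hgen.2 j k hjk _ _ _ _ rfl rfl rfl rfl
  have hm := hgh.mul_eq k
  obtain ⟨e0, e1⟩ := eq_zero_of_det_ne_zero h0 h1 (by
    intro hcon
    apply hne
    linear_combination hcon + (((k : ℝ) ^ 2 + A + ((k : ℝ) ^ 4 + D)) -
      ((j : ℝ) ^ 2 + A + ((j : ℝ) ^ 4 + D))) ^ 2 * hm)
  obtain ⟨e2, e3⟩ := eq_zero_of_det_ne_zero h2 h3 (by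
    intro hcon
    apply hne
    have hkk : (h k / (k : ℝ)) * k = h k := div_mul_cancel₀ _ hk
    linear_combination hcon + (((k : ℝ) ^ 2 + A + ((k : ℝ) ^ 4 + D)) -
      ((j : ℝ) ^ 2 + A + ((j : ℝ) ^ 4 + D))) ^ 2 * (hm + g k * hkk))
  ext i
  fin_cases i
  exacts [e0, e1, e2, e3]

/-- Observability of the rescaled system for generic parameters. -/
theorem exists_observability_blockGen (hgen : Generic A D p) (hgh : IsCoupling p c g h) :
    ∃ m : ℕ, 0 < m ∧ ∃ C, 0 < C ∧ ∀ z, ‖z‖ ≤ C * ‖obs (bessel_blockGen A D hgh m) z‖ := by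
  obtain ⟨L, C, hL⟩ := exists_high_blocks_observable A D hgh one_pos
  have hpos : 0 < 2 * Real.pi * ((1 : ℕ) : ℝ) := by positivity
  have hk0 : ∀ k : ℕ+, (k : ℝ) ≠ 0 := fun k => by exact_mod_cast k.pos.ne'
  obtain ⟨n, hn⟩ := exists_observability (flowBounded_blockGen A D hgh)
    (bessel_blockGen A D hgh 1) hpos L hL (fun k : ℕ+ => blockPoly A D p k)
    (fun k => aeval_blockPoly_self _ _ _ (hk0 k) (hgh.mul_eq k))
    (fun j k hjk => injective_aeval_blockPoly hgen hgh hjk)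
    (fun k z hz => eq_zero_of_posProj_flow (hk0 k) hpos z hz)
  -- `n + 1` periods cover one period plus `n` units of time, since `2π > 1`.
  refine ⟨n + 1, n.succ_pos, hn _ _ ?_⟩
  push_cast
  nlinarith [Real.pi_gt_three, n.cast_nonneg (α := ℝ)]

end Model

/-! ### Rescaling the state space -/

theorem weight_zero (β : IrrPoint) (k : ℕ+) : weight 0 β k = Real.sin (k * β.val) ^ 2 := by
  simp [weight]

theorem weight_one (β : IrrPoint) (k : ℕ+) :
    weight 1 β k = (k : ℝ) ^ 2 * Real.sin (k * β.val) ^ 2 := by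
  simp [weight]

theorem weight_two (β : IrrPoint) (k : ℕ+) :
    weight 2 β k = (k : ℝ) ^ 4 * Real.sin (k * β.val) ^ 2 := by
  have : (2 * 2 : ℝ) = ((4 : ℕ) : ℝ) := by norm_num
  rw [weight, this, Real.rpow_natCast]

theorem weight_neg_one (β : IrrPoint) (k : ℕ+) :
    weight (-1) β k = (Real.sin (k * β.val) / k) ^ 2 := by
  have : (2 * (-1) : ℝ) = -((2 : ℕ) : ℝ) := by norm_num
  rw [weight, this, Real.rpow_neg (by positivity), Real.rpow_natCast, div_pow]
  ring

theorem weight_neg_two (β : IrrPoint) (k : ℕ+) :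
    weight (-2) β k = (Real.sin (k * β.val) / (k : ℝ) ^ 2) ^ 2 := by
  have : (2 * (-2) : ℝ) = -((4 : ℕ) : ℝ) := by norm_num
  rw [weight, this, Real.rpow_neg (by positivity), Real.rpow_natCast, div_pow, ← pow_mul]
  ring

theorem pnat_ne_zero (k : ℕ+) : (k : ℝ) ≠ 0 := by exact_mod_cast k.pos.ne'

theorem pnat_pos (k : ℕ+) : 0 < (k : ℝ) := by exact_mod_cast k.pos

theorem one_le_pnat (k : ℕ+) : 1 ≤ (k : ℝ) := by exact_mod_cast k.pos

/-- Membership in `D^α_β` by comparison. -/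
theorem mem_coeffs_of_le {α : ℝ} {β : IrrPoint} {a b : ℕ+ → ℝ} (hb : Summable b)
    (h : ∀ k, weight α β k * |a k| ^ 2 ≤ b k) : a ∈ coeffs α β :=
  Summable.of_nonneg_of_le
    (fun k => mul_nonneg (weight_pos α β k).le (by positivity)) h hb

theorem sq_coord_le (z : EuclideanSpace ℝ (Fin 4)) (i : Fin 4) : z i ^ 2 ≤ ‖z‖ ^ 2 := by
  rw [EuclideanSpace.norm_sq_eq]
  have h := Finset.single_le_sum (f := fun i => ‖z i‖ ^ 2) (fun _ _ => by positivity)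
    (Finset.mem_univ i)
  simpa using h

section Rescale

variable {ξ η : IrrPoint}

/-- The rescaled coordinates of the `k`-th mode. -/
def rescaleFun (U : StateSpace ξ η) (k : ℕ+) : EuclideanSpace ℝ (Fin 4) :=
  !₂[Real.sin (k * ξ.val) * u₁ U k, Real.sin (k * η.val) * u₂ U k,
    Real.sin (k * ξ.val) / k * v₁ U k, Real.sin (k * η.val) / (k : ℝ) ^ 2 * v₂ U k]

theorem norm_rescaleFun_sq (U : StateSpace ξ η) (k : ℕ+) : ‖rescaleFun U k‖ ^ 2 =
    (weight 0 ξ k * |u₁ U k| ^ 2 + weight 0 η k * |u₂ U k| ^ 2) +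
    (weight (-1) ξ k * |v₁ U k| ^ 2 + weight (-2) η k * |v₂ U k| ^ 2) := by
  rw [norm_sq_fin_four, weight_zero, weight_zero, weight_neg_one, weight_neg_two]
  simp only [rescaleFun, sq_abs]
  simp
  ring

theorem summable_components (U : StateSpace ξ η) :
    (Summable fun k => weight 0 ξ k * |u₁ U k| ^ 2) ∧
    (Summable fun k => weight 0 η k * |u₂ U k| ^ 2) ∧
    (Summable fun k => weight (-1) ξ k * |v₁ U k| ^ 2) ∧
    (Summable fun k => weight (-2) η k * |v₂ U k| ^ 2) :=
  ⟨U.fst.fst.coeff_mem, U.fst.snd.coeff_mem, U.snd.fst.coeff_mem, U.snd.snd.coeff_mem⟩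

theorem state_norm_sq (U : StateSpace ξ η) : ‖U‖ ^ 2 = ∑' k, ‖rescaleFun U k‖ ^ 2 := by
  obtain ⟨h1, h2, h3, h4⟩ := summable_components U
  simp_rw [norm_rescaleFun_sq]
  rw [(h1.add h2).tsum_add (h3.add h4), h1.tsum_add h2, h3.tsum_add h4,
    WithLp.prod_norm_sq_eq_of_L2, WithLp.prod_norm_sq_eq_of_L2, WithLp.prod_norm_sq_eq_of_L2,
    DSpace.norm_sq_eq, DSpace.norm_sq_eq, DSpace.norm_sq_eq, DSpace.norm_sq_eq]
  rfl

theorem memℓp_rescaleFun (U : StateSpace ξ η) : Memℓp (rescaleFun U) 2 := by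
  obtain ⟨h1, h2, h3, h4⟩ := summable_components U
  refine memℓp_two_of_summable (((h1.add h2).add (h3.add h4)).congr fun k => ?_)
  rw [norm_rescaleFun_sq]

/-- The state with given rescaled coordinates. -/
def unscale (z : lp (fun _ : ℕ+ => EuclideanSpace ℝ (Fin 4)) 2) : StateSpace ξ η :=
  mkState (fun k => z k 0 / Real.sin (k * ξ.val)) (fun k => z k 1 / Real.sin (k * η.val))
    (fun k => z k 2 * k / Real.sin (k * ξ.val)) (fun k => z k 3 * (k : ℝ) ^ 2 / Real.sin (k * η.val))
    (mem_coeffs_of_le (ell2_summable z) fun k => by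
      have h1 := sin_ne_zero ξ k
      rw [weight_zero, sq_abs, ← mul_pow, mul_div_cancel₀ _ h1]
      exact sq_coord_le _ _)
    (mem_coeffs_of_le (ell2_summable z) fun k => by
      have h1 := sin_ne_zero η k
      rw [weight_zero, sq_abs, ← mul_pow, mul_div_cancel₀ _ h1]
      exact sq_coord_le _ _)
    (mem_coeffs_of_le (ell2_summable z) fun k => by
      have h1 := sin_ne_zero ξ k
      have h2 := pnat_ne_zero k
      have e : Real.sin (k * ξ.val) / k * (z k 2 * k / Real.sin (k * ξ.val)) = z k 2 := by
        field_simp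
      rw [weight_neg_one, sq_abs, ← mul_pow, e]
      exact sq_coord_le _ _)
    (mem_coeffs_of_le (ell2_summable z) fun k => by
      have h1 := sin_ne_zero η k
      have h2 := pnat_ne_zero k
      have e : Real.sin (k * η.val) / (k : ℝ) ^ 2 * (z k 3 * (k : ℝ) ^ 2 / Real.sin (k * η.val))
          = z k 3 := by field_simp
      rw [weight_neg_two, sq_abs, ← mul_pow, e]
      exact sq_coord_le _ _)

/-- The rescaling isometry of the state space onto `ℓ²`. -/
def rescale (ξ η : IrrPoint) :
    StateSpace ξ η ≃ₗᵢ[ℝ] lp (fun _ : ℕ+ => EuclideanSpace ℝ (Fin 4)) 2 where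
  toFun U := ⟨rescaleFun U, memℓp_rescaleFun U⟩
  invFun z := unscale z
  map_add' U V := by
    ext k i
    change rescaleFun (U + V) k i = rescaleFun U k i + rescaleFun V k i
    fin_cases i <;> simp [rescaleFun] <;> ring
  map_smul' c U := by
    ext k i
    change rescaleFun (c • U) k i = c * rescaleFun U k i
    fin_cases i <;> simp [rescaleFun] <;> ring
  left_inv U := by
    have h1 := sin_ne_zero ξ
    have h2 := sin_ne_zero η
    have h3 := pnat_ne_zero
    apply state_ext
    · ext k; have := h1 k; simp [unscale, rescaleFun]; field_simp
    · ext k; have := h2 k; simp [unscale, rescaleFun]; field_simp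
    · ext k; have := h1 k; have := h3 k; simp [unscale, rescaleFun]; field_simp
    · ext k; have := h2 k; have := h3 k; simp [unscale, rescaleFun]; field_simp
  right_inv z := by
    ext k i
    have h1 := sin_ne_zero ξ k
    have h2 := sin_ne_zero η k
    have h3 := pnat_ne_zero k
    change rescaleFun (unscale z) k i = z k i
    fin_cases i <;> simp [unscale, rescaleFun] <;> field_simp
  norm_map' U := by
    rw [← sq_eq_sq₀ (norm_nonneg _) (norm_nonneg _), state_norm_sq]
    exact ell2_norm_sq _

theorem rescale_apply (U : StateSpace ξ η) (k : ℕ+) : rescale ξ η U k = rescaleFun U k := rfl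

end Rescale

/-! ### The couplings -/

/-- If every sequence that is square summable with the weights `w` is so with the weights `w'`,
then `w'` is bounded by a multiple of `w`. -/
theorem exists_weight_le {ι : Type*} {w w' : ι → ℝ} (hw : ∀ k, 0 < w k) (hw' : ∀ k, 0 ≤ w' k)
    (h : ∀ a : ι → ℝ, Summable (fun k => w k * |a k| ^ 2) → Summable fun k => w' k * |a k| ^ 2) :
    ∃ c, 0 ≤ c ∧ ∀ k, w' k ≤ c * w k := by
  classical
  by_contra! hcon
  -- Gliding hump: masses `2⁻ⁿ` at `κ n` have finite total, yet the `w'`-weight magnifies them to at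
  -- least `2ⁿ`. The masses are summed in `b`, so `κ` need not be injective.
  choose κ hκ using fun n : ℕ => hcon (4 ^ n) (by positivity)
  set f : ℕ → ι → ℝ := fun n k => if k = κ n then (1 / 2) ^ n else 0 with hf
  have hf0 : ∀ n k, 0 ≤ f n k := fun n k => by simp only [hf]; split_ifs <;> positivity
  have hfle : ∀ n k, f n k ≤ (1 / 2) ^ n := fun n k => by
    simp only [hf]; split_ifs
    · exact le_rfl
    · positivity
  have hfs : ∀ k, Summable fun n => f n k := fun k =>
    Summable.of_nonneg_of_le (fun n => hf0 n k) (fun n => hfle n k) summable_geometric_two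
  set b : ι → ℝ := fun k => ∑' n, f n k with hb
  have hb0 : ∀ k, 0 ≤ b k := fun k => tsum_nonneg fun n => hf0 n k
  have hbs : Summable b := by
    refine summable_of_sum_le hb0 (c := 2) fun u => ?_
    rw [← Summable.tsum_finsetSum fun k _ => hfs k, ← tsum_geometric_two]
    refine (summable_sum fun k _ => hfs k).tsum_le_tsum (fun n => ?_) summable_geometric_two
    simp only [hf, Finset.sum_ite_eq']
    split_ifs
    · exact le_rfl
    · positivity
  have ha : ∀ k, |√(b k / w k)| ^ 2 = b k / w k := fun k => by
    rw [sq_abs, Real.sq_sqrt (div_nonneg (hb0 k) (hw k).le)]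
  have hsum := h (fun k => √(b k / w k)) (hbs.congr fun k => by
    rw [ha, mul_div_cancel₀ _ (hw k).ne'])
  obtain ⟨n, hn⟩ := pow_unbounded_of_one_lt (∑' k, w' k * |√(b k / w k)| ^ 2) one_lt_two
  have h1 : w' (κ n) * |√(b (κ n) / w (κ n))| ^ 2 ≤ ∑' k, w' k * |√(b k / w k)| ^ 2 :=
    hsum.le_tsum _ fun j _ => mul_nonneg (hw' j) (by positivity)
  have h2 : (1 / 2 : ℝ) ^ n ≤ b (κ n) := by
    have h3 : f n (κ n) ≤ b (κ n) := (hfs (κ n)).le_tsum n fun j _ => hf0 j (κ n)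
    rwa [show f n (κ n) = (1 / 2) ^ n from if_pos rfl] at h3
  rw [ha] at h1
  have h4 : (2 : ℝ) ^ n ≤ w' (κ n) * (b (κ n) / w (κ n)) := by
    have hwp := hw (κ n)
    rw [mul_div_assoc', le_div_iff₀ hwp]
    calc (2 : ℝ) ^ n * w (κ n) = (4 ^ n * w (κ n)) * (1 / 2) ^ n := by
          rw [mul_right_comm, ← mul_pow]; norm_num
      _ ≤ w' (κ n) * b (κ n) :=
        mul_le_mul (hκ n).le h2 (by positivity) (hw' _)
  linarith

section Coupling

variable {A B C D : ℝ} {ξ η : IrrPoint}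

/-- The rescaled couplings: `C sin (k ξ) / sin (k η)` of the string to the beam, and with `B` and
exchanged points of the beam to the string. -/
def coupling (C : ℝ) (ξ η : IrrPoint) (k : ℕ+) : ℝ :=
  C * Real.sin (k * ξ.val) / Real.sin (k * η.val)

theorem zero_mem_coeffs (α : ℝ) (β : IrrPoint) : (0 : ℕ+ → ℝ) ∈ coeffs α β := Submodule.zero_mem _

theorem coupling_bound {c r s t : ℝ} {k : ℝ} (hk : 0 < k) (hs : s ≠ 0) (hr : 0 ≤ r)
    (h : c ^ 2 * t ^ 2 ≤ r * (k ^ 6 * s ^ 2)) : |c * t / s| ≤ √r * k ^ 3 := by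
  refine abs_le_of_sq_le_sq ?_ (by positivity)
  have hs2 : 0 < s ^ 2 := by positivity
  rw [div_pow, mul_pow, mul_pow, Real.sq_sqrt hr, div_le_iff₀ hs2, ← pow_mul,
    mul_assoc]
  exact h

/-- The domain hypothesis is tested on states with one nonzero position component, and
`exists_weight_le` turns the resulting inclusions of weighted spaces into bounds on the weights. In
the product of the couplings the sines cancel. -/
theorem exists_isCoupling (hdom : MapsDomIntoState A B C D ξ η) :
    ∃ c, IsCoupling (B * C) c (coupling C ξ η) (coupling B η ξ) := by
  -- Keeping `C²` inside the weight covers `C = 0` without a separate case.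
  obtain ⟨r₁, hr₁, h₁⟩ := exists_weight_le (w := weight 2 η)
    (w' := fun k => C ^ 2 * weight (-1) ξ k) (weight_pos 2 η)
    (fun k => mul_nonneg (sq_nonneg _) (weight_pos _ _ k).le) (fun a ha => by
      have ha' : a ∈ coeffs 2 η := ha
      have h1 := (hdom (mkState 0 a 0 0 (zero_mem_coeffs _ _)
        (coeffs_anti (by norm_num) η ha') (zero_mem_coeffs _ _) (zero_mem_coeffs _ _))
        ⟨⟨⟨zero_mem_coeffs _ _, ha'⟩, zero_mem_coeffs _ _⟩, zero_mem_coeffs _ _⟩).1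
      rw [mem_coeffs] at h1
      refine h1.congr fun k => ?_
      simp [stringForce, mul_pow]
      ring)
  obtain ⟨r₂, hr₂, h₂⟩ := exists_weight_le (w := weight 1 ξ)
    (w' := fun k => B ^ 2 * weight (-2) η k) (weight_pos 1 ξ)
    (fun k => mul_nonneg (sq_nonneg _) (weight_pos _ _ k).le) (fun a ha => by
      have ha' : a ∈ coeffs 1 ξ := ha
      have h1 := (hdom (mkState a 0 0 0 (coeffs_anti (by norm_num) ξ ha')
        (zero_mem_coeffs _ _) (zero_mem_coeffs _ _) (zero_mem_coeffs _ _))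
        ⟨⟨⟨ha', zero_mem_coeffs _ _⟩, zero_mem_coeffs _ _⟩, zero_mem_coeffs _ _⟩).2
      rw [mem_coeffs] at h1
      refine h1.congr fun k => ?_
      simp [beamForce, mul_pow]
      ring)
  refine ⟨√r₁ + √r₂, by positivity, fun k => ?_, fun k => ?_, fun k => ?_⟩
  · have h1 := sin_ne_zero ξ k
    have h2 := sin_ne_zero η k
    unfold coupling
    field_simp
  · have hk := pnat_pos k
    have h1 := h₁ k
    simp only [weight_two, weight_neg_one, div_pow] at h1
    rw [mul_div_assoc', div_le_iff₀ (by positivity)] at h1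
    refine (coupling_bound hk (sin_ne_zero η k) hr₁ (by linarith)).trans ?_
    gcongr
    linarith [Real.sqrt_nonneg r₂]
  · have hk := pnat_pos k
    have h1 := h₂ k
    simp only [weight_one, weight_neg_two, div_pow] at h1
    rw [mul_div_assoc', div_le_iff₀ (by positivity)] at h1
    refine (coupling_bound hk (sin_ne_zero ξ k) hr₂ (by ring_nf at h1 ⊢; linarith)).trans ?_
    gcongr
    linarith [Real.sqrt_nonneg r₁]

end Coupling

/-! ### The generator -/

/-! ### Bounds for the positions in terms of the generator -/

section Estimate

variable {A D p c : ℝ} {g h : ℕ+ → ℝ}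

/-- Solving the block equation `M z = w` for the positions, by Cramer's rule. -/
theorem cramer_blockGen {k g h : ℝ} (hk : k ≠ 0) (hgh : g * h = p)
    {z w : EuclideanSpace ℝ (Fin 4)} (hzw : blockGen A D k g h z = w) :
    ((k ^ 2 + A) * (k ^ 4 + D) - p) * z 0 = -(k ^ 4 + D) * k * w 2 + g * k ^ 2 * w 3 ∧
    ((k ^ 2 + A) * (k ^ 4 + D) - p) * z 1 = h * k * w 2 + -(k ^ 2 + A) * k ^ 2 * w 3 := by
  have h2 : w 2 = -((k ^ 2 + A) * z 0 + g * z 1) / k := by rw [← hzw]; simp [blockGen_apply]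
  have h3 : w 3 = -((k ^ 4 + D) * z 1 + h * z 0) / k ^ 2 := by rw [← hzw]; simp [blockGen_apply]
  rw [h2, h3, ← hgh]
  constructor
  · field_simp; ring
  · field_simp; ring

theorem abs_coord_le (z : EuclideanSpace ℝ (Fin 4)) (i : Fin 4) : |z i| ≤ ‖z‖ :=
  PiLp.norm_apply_le z i

/-- The positions are controlled by the generator in each block that is invertible. -/
theorem exists_block_estimate {k g h : ℝ} (hk : k ≠ 0) (hgh : g * h = p)
    (hdet : (k ^ 2 + A) * (k ^ 4 + D) ≠ p) : ∃ R, ∀ z w, blockGen A D k g h z = w →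
      k * |z 0| ≤ R * ‖w‖ ∧ k ^ 2 * |z 1| ≤ R * ‖w‖ := by
  set Δ := (k ^ 2 + A) * (k ^ 4 + D) - p with hΔ
  have hΔ0 : 0 < |Δ| := abs_pos.2 (sub_ne_zero.2 hdet)
  refine ⟨|k| / |Δ| * (|-(k ^ 4 + D) * k| + |g * k ^ 2|) +
    k ^ 2 / |Δ| * (|h * k| + |-(k ^ 2 + A) * k ^ 2|), fun z w hzw => ?_⟩
  obtain ⟨e0, e1⟩ := cramer_blockGen hk hgh hzw
  have b0 := abs_add_mul_le (abs_coord_le w 2) (abs_coord_le w 3) le_rfl le_rfl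
    (u := -(k ^ 4 + D) * k) (v := g * k ^ 2)
  have b1 := abs_add_mul_le (abs_coord_le w 2) (abs_coord_le w 3) le_rfl le_rfl
    (u := h * k) (v := -(k ^ 2 + A) * k ^ 2)
  rw [← e0, abs_mul] at b0
  rw [← e1, abs_mul] at b1
  have b0' : |z 0| ≤ (|-(k ^ 4 + D) * k| + |g * k ^ 2|) * ‖w‖ / |Δ| := by
    rw [le_div_iff₀ hΔ0]; linarith
  have b1' : |z 1| ≤ (|h * k| + |-(k ^ 2 + A) * k ^ 2|) * ‖w‖ / |Δ| := by
    rw [le_div_iff₀ hΔ0]; linarith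
  have n0 : 0 ≤ k ^ 2 / |Δ| * (|h * k| + |-(k ^ 2 + A) * k ^ 2|) * ‖w‖ := by positivity
  have n1 : 0 ≤ |k| / |Δ| * (|-(k ^ 4 + D) * k| + |g * k ^ 2|) * ‖w‖ := by positivity
  rw [add_mul]
  constructor
  · calc k * |z 0| ≤ |k| * ((|-(k ^ 4 + D) * k| + |g * k ^ 2|) * ‖w‖ / |Δ|) := by
          gcongr
          exact le_abs_self k
      _ = |k| / |Δ| * (|-(k ^ 4 + D) * k| + |g * k ^ 2|) * ‖w‖ := by ring
      _ ≤ _ := by linarith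
  · calc k ^ 2 * |z 1| ≤ k ^ 2 * ((|h * k| + |-(k ^ 2 + A) * k ^ 2|) * ‖w‖ / |Δ|) := by gcongr
      _ = k ^ 2 / |Δ| * (|h * k| + |-(k ^ 2 + A) * k ^ 2|) * ‖w‖ := by ring
      _ ≤ _ := by linarith

/-- The positions in the high blocks are uniformly controlled by the generator. -/
theorem exists_high_block_estimate (A D : ℝ) (hgh : IsCoupling p c g h) :
    ∃ (L : Finset ℕ+) (R : ℝ), 0 ≤ R ∧ ∀ k ∉ L, ∀ z w, blockGen A D k (g k) (h k) z = w →
      (k : ℝ) * |z 0| ≤ R * ‖w‖ ∧ (k : ℝ) ^ 2 * |z 1| ≤ R * ‖w‖ := by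
  have hc := hgh.nonneg
  set m := |A| + |D| + |p| + 1 with hm
  have hm1 : 1 ≤ m := by rw [hm]; linarith [abs_nonneg A, abs_nonneg D, abs_nonneg p]
  -- The constant is the ratio of the numerators in Cramer's rule, at most `(2 + c) k⁵` and `(2 + c)
  -- k⁴`, to the determinant, at least `k⁶ / 4`.
  refine ⟨(finite_pnat_lt (4 * m)).toFinset, 4 * (2 + c), by positivity, fun k hk z w hzw => ?_⟩
  have hk' : 4 * m ≤ (k : ℝ) := by simpa using hk
  have hkne := pnat_ne_zero k
  obtain ⟨e0, e1⟩ := cramer_blockGen hkne (hgh.mul_eq k) hzw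
  have hg := hgh.le_left k
  have hh := hgh.le_right k
  generalize (k : ℝ) = k at hk' hkne e0 e1 hg hh ⊢
  have hA := abs_le.1 (show |A| ≤ m by linarith [abs_nonneg D, abs_nonneg p])
  have hD := abs_le.1 (show |D| ≤ m by linarith [abs_nonneg A, abs_nonneg p])
  have hp := abs_le.1 (show |p| ≤ m by linarith [abs_nonneg A, abs_nonneg D])
  have hk4 : 4 ≤ k := by linarith
  have hk0 : 0 < k := by linarith
  have hk2 : k ≤ k ^ 2 := by nlinarith
  have hk24 : k ^ 2 ≤ k ^ 4 := pow_le_pow_right₀ (by linarith) (by norm_num)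
  have hk26 : k ^ 2 ≤ k ^ 6 := pow_le_pow_right₀ (by linarith) (by norm_num)
  have a1 : 3 / 4 * k ^ 2 ≤ k ^ 2 + A := by linarith [hA.1]
  have a2 : k ^ 2 + A ≤ 2 * k ^ 2 := by linarith [hA.2]
  have d1 : 3 / 4 * k ^ 4 ≤ k ^ 4 + D := by linarith [hD.1]
  have d2 : k ^ 4 + D ≤ 2 * k ^ 4 := by linarith [hD.2]
  have hdet : k ^ 6 / 4 ≤ (k ^ 2 + A) * (k ^ 4 + D) - p := by
    have h1 : (3 / 4 * k ^ 2) * (3 / 4 * k ^ 4) ≤ (k ^ 2 + A) * (k ^ 4 + D) :=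
      mul_le_mul a1 d1 (by positivity) (le_trans (by positivity) a1)
    have h2 : (3 / 4 * k ^ 2) * (3 / 4 * k ^ 4) = 9 / 16 * k ^ 6 := by ring
    linarith [hp.2]
  have hw0 := norm_nonneg w
  have b0 := abs_add_mul_le (abs_coord_le w 2) (abs_coord_le w 3)
    (u := -(k ^ 4 + D) * k) (v := g _ * k ^ 2) (p := 2 * k ^ 5) (q := c * k ^ 5)
    (by
      rw [abs_mul, abs_neg, abs_of_nonneg (le_trans (by positivity) d1), abs_of_pos hk0]
      calc _ ≤ 2 * k ^ 4 * k := by gcongr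
        _ = _ := by ring)
    (by
      rw [abs_mul, abs_of_pos (pow_pos hk0 2)]
      calc _ ≤ c * k ^ 3 * k ^ 2 := by gcongr
        _ = _ := by ring)
  have b1 := abs_add_mul_le (abs_coord_le w 2) (abs_coord_le w 3)
    (u := h _ * k) (v := -(k ^ 2 + A) * k ^ 2) (p := c * k ^ 4) (q := 2 * k ^ 4)
    (by
      rw [abs_mul, abs_of_pos hk0]
      calc _ ≤ c * k ^ 3 * k := by gcongr
        _ = _ := by ring)
    (by
      rw [abs_mul, abs_neg, abs_of_nonneg (le_trans (by positivity) a1),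
        abs_of_pos (pow_pos hk0 2)]
      calc _ ≤ 2 * k ^ 2 * k ^ 2 := by gcongr
        _ = _ := by ring)
  rw [← e0, abs_mul, abs_of_pos (lt_of_lt_of_le (by positivity) hdet)] at b0
  rw [← e1, abs_mul, abs_of_pos (lt_of_lt_of_le (by positivity) hdet)] at b1
  have c0 : k ^ 6 / 4 * |z 0| ≤ (2 * k ^ 5 + c * k ^ 5) * ‖w‖ :=
    (mul_le_mul_of_nonneg_right hdet (abs_nonneg _)).trans b0
  have c1 : k ^ 6 / 4 * |z 1| ≤ (c * k ^ 4 + 2 * k ^ 4) * ‖w‖ :=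
    (mul_le_mul_of_nonneg_right hdet (abs_nonneg _)).trans b1
  constructor
  · refine le_of_mul_le_mul_left ?_ (by positivity : 0 < k ^ 5 / 4)
    calc _ = k ^ 6 / 4 * |z 0| := by ring
      _ ≤ _ := c0
      _ = _ := by ring
  · refine le_of_mul_le_mul_left ?_ (by positivity : 0 < k ^ 4 / 4)
    calc _ = k ^ 6 / 4 * |z 1| := by ring
      _ ≤ _ := c1
      _ = _ := by ring

/-- The high blocks satisfy a uniform bound; each of the finitely many others is invertible by the
first clause of `Generic`. -/
theorem exists_generator_estimate (hgen : Generic A D p) (hgh : IsCoupling p c g h) :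
    ∃ R : ℝ, 0 ≤ R ∧ ∀ (k : ℕ+) z w, blockGen A D k (g k) (h k) z = w →
      (k : ℝ) * |z 0| ≤ R * ‖w‖ ∧ (k : ℝ) ^ 2 * |z 1| ≤ R * ‖w‖ := by
  obtain ⟨L, R, hR, H⟩ := exists_high_block_estimate A D hgh
  choose B hB using fun k : ℕ+ =>
    exists_block_estimate (A := A) (D := D) (pnat_ne_zero k) (hgh.mul_eq k) (hgen.1 k)
  have hS : 0 ≤ ∑ k ∈ L, |B k| := Finset.sum_nonneg fun _ _ => abs_nonneg _
  refine ⟨R + ∑ k ∈ L, |B k|, by positivity, fun k z w hzw => ?_⟩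
  by_cases hk : k ∈ L
  · have h1 : |B k| ≤ ∑ k ∈ L, |B k| :=
      Finset.single_le_sum (f := fun k => |B k|) (fun _ _ => abs_nonneg _) hk
    have h2 : B k * ‖w‖ ≤ (R + ∑ k ∈ L, |B k|) * ‖w‖ := by
      gcongr
      linarith [le_abs_self (B k)]
    exact ⟨(hB k z w hzw).1.trans h2, (hB k z w hzw).2.trans h2⟩
  · have h2 : R * ‖w‖ ≤ (R + ∑ k ∈ L, |B k|) * ‖w‖ := by
      gcongr
      linarith
    exact ⟨(H k hk z w hzw).1.trans h2, (H k hk z w hzw).2.trans h2⟩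

/-- Without genericity, the positions are controlled by the graph norm. -/
theorem exists_graph_estimate (A D : ℝ) (hgh : IsCoupling p c g h) :
    ∃ R : ℝ, 0 ≤ R ∧ ∀ (k : ℕ+) z w, blockGen A D k (g k) (h k) z = w →
      (k : ℝ) * |z 0| ≤ R * (‖w‖ + ‖z‖) ∧ (k : ℝ) ^ 2 * |z 1| ≤ R * (‖w‖ + ‖z‖) := by
  obtain ⟨L, R, hR, H⟩ := exists_high_block_estimate A D hgh
  have hS : 0 ≤ ∑ k ∈ L, (k : ℝ) ^ 2 := Finset.sum_nonneg fun _ _ => by positivity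
  refine ⟨R + ∑ k ∈ L, (k : ℝ) ^ 2, by positivity, fun k z w hzw => ?_⟩
  by_cases hk : k ∈ L
  · have h1 : (k : ℝ) ^ 2 ≤ ∑ k ∈ L, (k : ℝ) ^ 2 :=
      Finset.single_le_sum (f := fun k : ℕ+ => (k : ℝ) ^ 2) (fun _ _ => by positivity) hk
    have h2 : (k : ℝ) ≤ (k : ℝ) ^ 2 := le_self_pow₀ (one_le_pnat k) two_ne_zero
    have key : ∀ {q x : ℝ}, q ≤ (k : ℝ) ^ 2 → |x| ≤ ‖z‖ →
        q * |x| ≤ (R + ∑ k ∈ L, (k : ℝ) ^ 2) * (‖w‖ + ‖z‖) := fun hq hx => by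
      refine mul_le_mul (by linarith) (by linarith [norm_nonneg w]) (abs_nonneg _) (by positivity)
    exact ⟨key h2 (abs_coord_le z 0), key le_rfl (abs_coord_le z 1)⟩
  · have h2 : R * ‖w‖ ≤ (R + ∑ k ∈ L, (k : ℝ) ^ 2) * (‖w‖ + ‖z‖) :=
      mul_le_mul (by linarith) (by linarith [norm_nonneg z]) (norm_nonneg w) (by positivity)
    exact ⟨(H k hk z w hzw).1.trans h2, (H k hk z w hzw).2.trans h2⟩

end Estimate

/-! ### The operator `𝒜*` in rescaled coordinates -/

section Generator

variable {A B C D : ℝ} {ξ η : IrrPoint}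

theorem opA_apply (hdom : MapsDomIntoState A B C D ξ η) (U : (opA hdom).domain)
    (hU : U.1 ∈ dom ξ η) : opA hdom U = mkState (v₁ U.1) (v₂ U.1) (stringForce A C (u₁ U.1) (u₂ U.1))
      (beamForce B D (u₁ U.1) (u₂ U.1)) hU.1.2 hU.2 (hdom U.1 hU).1 (hdom U.1 hU).2 := rfl

theorem rescale_opA (hdom : MapsDomIntoState A B C D ξ η) (U : (opA hdom).domain) (k : ℕ+) :
    rescale ξ η (opA hdom U) k =
      blockGen A D k (coupling C ξ η k) (coupling B η ξ k) (rescale ξ η U.1 k) := by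
  have h1 := sin_ne_zero ξ k
  have h2 := sin_ne_zero η k
  have h3 := pnat_ne_zero k
  rw [opA_apply hdom U U.2, rescale_apply, rescale_apply, rescaleFun, rescaleFun, blockGen_apply,
    u₁_mkState, u₂_mkState, v₁_mkState, v₂_mkState]
  generalize u₁ U.1 = a₁
  generalize u₂ U.1 = a₂
  generalize v₁ U.1 k = b₁
  generalize v₂ U.1 k = b₂
  have e3 : stringForce A C a₁ a₂ k = -(k : ℝ) ^ 2 * a₁ k - A * a₁ k - C * a₂ k := rfl
  have e4 : beamForce B D a₁ a₂ k =
      -(-(k : ℝ) ^ 2 * (-(k : ℝ) ^ 2 * a₂ k)) - B * a₁ k - D * a₂ k := rfl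
  rw [e3, e4, coupling, coupling]
  generalize Real.sin (k * ξ.val) = s at *
  generalize Real.sin (k * η.val) = t at *
  generalize (k : ℝ) = κ at *
  ext i
  fin_cases i
  · simp; field_simp
  · simp; field_simp
  · simp; field_simp; ring
  · simp; field_simp; ring

/-- `D(𝒜*)` is the maximal domain of the block operator. The regularity of the positions comes from
the graph estimate, that of the velocities from the first two equations, `k z₂` and `k² z₃` being
coordinates of an `ℓ²` element. -/
theorem mem_dom_of_rescale (hdom : MapsDomIntoState A B C D ξ η) {U V : StateSpace ξ η}
    (hUV : ∀ k : ℕ+, blockGen A D k (coupling C ξ η k) (coupling B η ξ k) (rescale ξ η U k) =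
      rescale ξ η V k) : U ∈ dom ξ η := by
  obtain ⟨c, hgh⟩ := exists_isCoupling hdom
  obtain ⟨R, hR, H⟩ := exists_graph_estimate A D hgh
  have hs : Summable fun k : ℕ+ =>
      2 * R ^ 2 * (‖rescale ξ η V k‖ ^ 2 + ‖rescale ξ η U k‖ ^ 2) :=
    ((ell2_summable _).add (ell2_summable _)).mul_left _
  have hsq : ∀ {x v u : ℝ}, 0 ≤ x → x ≤ R * (v + u) → x ^ 2 ≤ 2 * R ^ 2 * (v ^ 2 + u ^ 2) := by
    intro x v u hx h
    have h1 := pow_le_pow_left₀ hx h 2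
    nlinarith [mul_nonneg (sq_nonneg R) (sq_nonneg (v - u))]
  have hz0 : ∀ k, rescale ξ η U k 0 = Real.sin (k * ξ.val) * u₁ U k := fun k => rfl
  have hz1 : ∀ k, rescale ξ η U k 1 = Real.sin (k * η.val) * u₂ U k := fun k => rfl
  have hz2 : ∀ k, rescale ξ η U k 2 = Real.sin (k * ξ.val) / k * v₁ U k := fun k => rfl
  have hz3 : ∀ k, rescale ξ η U k 3 = Real.sin (k * η.val) / (k : ℝ) ^ 2 * v₂ U k := fun k => rfl
  refine mem_dom.2 ⟨⟨⟨?_, ?_⟩, ?_⟩, ?_⟩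
  · refine mem_coeffs_of_le hs fun k => ?_
    have h1 := hsq (mul_nonneg (pnat_pos k).le (abs_nonneg _)) (H k _ _ (hUV k)).1
    rw [hz0] at h1
    refine le_trans (le_of_eq ?_) h1
    rw [weight_one, mul_pow, sq_abs, sq_abs]
    ring
  · refine mem_coeffs_of_le hs fun k => ?_
    have h1 := hsq (mul_nonneg (by positivity) (abs_nonneg _)) (H k _ _ (hUV k)).2
    rw [hz1] at h1
    refine le_trans (le_of_eq ?_) h1
    rw [weight_two, mul_pow, sq_abs, sq_abs]
    ring
  · refine mem_coeffs_of_le (ell2_summable (rescale ξ η V)) fun k => ?_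
    have h1 := sq_coord_le (rescale ξ η V k) 0
    have h2 : rescale ξ η V k 0 = k * rescale ξ η U k 2 := by rw [← hUV k]; simp [blockGen_apply]
    rw [h2, hz2] at h1
    refine le_trans (le_of_eq ?_) h1
    have := pnat_ne_zero k
    rw [weight_zero, sq_abs]
    field_simp
  · refine mem_coeffs_of_le (ell2_summable (rescale ξ η V)) fun k => ?_
    have h1 := sq_coord_le (rescale ξ η V k) 1
    have h2 : rescale ξ η V k 1 = (k : ℝ) ^ 2 * rescale ξ η U k 3 := by
      rw [← hUV k]; simp [blockGen_apply]
    rw [h2, hz3] at h1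
    refine le_trans (le_of_eq ?_) h1
    have := pnat_ne_zero k
    rw [weight_zero, sq_abs]
    field_simp

theorem mem_graph_opA_iff (hdom : MapsDomIntoState A B C D ξ η) (U V : StateSpace ξ η) :
    (U, V) ∈ (opA hdom).graph ↔
      ∀ k : ℕ+, blockGen A D k (coupling C ξ η k) (coupling B η ξ k) (rescale ξ η U k) =
        rescale ξ η V k := by
  rw [LinearPMap.mem_graph_iff]
  constructor
  · rintro ⟨U', rfl, rfl⟩ k
    exact (rescale_opA hdom U' k).symm
  · intro h
    refine ⟨⟨U, mem_dom_of_rescale hdom h⟩, rfl, ?_⟩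
    apply (rescale ξ η).injective
    ext k : 2
    rw [rescale_opA hdom, ← h k]

/-- Both membership in the graph and convergence of the difference quotients amount to the same
blockwise identity; the group is transported by the isometry. -/
theorem hypH1_opA (hdom : MapsDomIntoState A B C D ξ η) : HypH1 (opA hdom) := by
  obtain ⟨c, hgh⟩ := exists_isCoupling hdom
  have hM := flowBounded_blockGen A D hgh
  have hG := isStronglyContinuousGroup_blockGroup hM
  set Θ := (rescale ξ η).toContinuousLinearEquiv with hΘ
  refine ⟨fun t => (Θ.symm : _ →L[ℝ] StateSpace ξ η).comp
    ((blockGroup hM t).comp (Θ : StateSpace ξ η →L[ℝ] _)), ⟨?_, fun s t => ?_, fun x => ?_⟩,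
    fun x y => ?_⟩
  · ext x
    simp [hG.map_zero]
  · ext x
    simp [hG.map_add]
  · exact Θ.symm.continuous.comp (hG.continuous (Θ x))
  · rw [mem_graph_opA_iff, ← tendsto_blockGroup_iff hM (rescale ξ η x) (rescale ξ η y),
      Θ.toHomeomorph.isInducing.tendsto_nhds_iff]
    refine tendsto_congr fun t => ?_
    simp [hΘ, map_smul, map_sub]

end Generator

/-! ### The observation -/

section Observe

variable {A B C D : ℝ} {ξ η : IrrPoint}

theorem hasSum_euclidean_two {ι : Type*} {f : ι → EuclideanSpace ℝ (Fin 2)} {a b : ℝ}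
    (h₀ : HasSum (fun k => f k 0) a) (h₁ : HasSum (fun k => f k 1) b) : HasSum f !₂[a, b] := by
  have h : HasSum (fun k => WithLp.ofLp (f k)) (![a, b] : Fin 2 → ℝ) := by
    rw [Pi.hasSum]
    intro i
    fin_cases i
    exacts [h₀, h₁]
  exact h.mapL ((PiLp.continuousLinearEquiv 2 ℝ fun _ : Fin 2 => ℝ).symm :
    (Fin 2 → ℝ) →L[ℝ] EuclideanSpace ℝ (Fin 2))

/-- The values `w_k(ξ)` and `w_k(η)` carry exactly the sines used in the rescaling, so no small
divisor remains in the observation. -/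
theorem hasSum_opB (U : (opB ξ η).domain) :
    HasSum (fun k => √(2 / Real.pi) • posProj (rescale ξ η U.1 k)) (opB ξ η U) := by
  have hU : U.1 ∈ dom ξ η := U.2
  have e : opB ξ η U = !₂[valueAt ξ.val (u₁ U.1), valueAt η.val (u₂ U.1)] := rfl
  rw [e]
  refine hasSum_euclidean_two ?_ ?_
  · have h1 := (summable_valueAt hU.1.1.1).hasSum
    have h2 : (fun k : ℕ+ => (√(2 / Real.pi) • posProj (rescale ξ η U.1 k)) 0) =
        fun k => u₁ U.1 k * w k ξ.val := funext fun k => by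
      simp [posProj_apply, rescale_apply, rescaleFun, w]; ring
    rw [h2]
    exact h1
  · have h1 := (summable_valueAt (coeffs_anti one_le_two η hU.1.1.2)).hasSum
    have h2 : (fun k : ℕ+ => (√(2 / Real.pi) • posProj (rescale ξ η U.1 k)) 1) =
        fun k => u₂ U.1 k * w k η.val := funext fun k => by
      simp [posProj_apply, rescale_apply, rescaleFun, w]; ring
    rw [h2]
    exact h1

/-- Evaluation at a block is continuous, so each block of a solution solves a linear differential
equation with constant coefficients. -/
theorem rescale_solution (hdom : MapsDomIntoState A B C D ξ η) {U₀ : StateSpace ξ η}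
    {U : ℝ → StateSpace ξ η} (hU : IsSolution (opA hdom) U₀ U) (t : ℝ) (k : ℕ+) :
    rescale ξ η (U t) k =
      flow (blockGen A D k (coupling C ξ η k) (coupling B η ξ k)) t (rescale ξ η U₀ k) := by
  have h1 : ∀ t, HasDerivAt (fun t => rescale ξ η (U t) k)
      (blockGen A D k (coupling C ξ η k) (coupling B η ξ k) (rescale ξ η (U t) k)) t := by
    intro t
    rw [← rescale_opA hdom ⟨U t, hU.mem t⟩ k]
    exact (((lp.evalCLM ℝ (fun _ : ℕ+ => EuclideanSpace ℝ (Fin 4)) 2 k).comp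
      ((rescale ξ η).toContinuousLinearEquiv :
        StateSpace ξ η →L[ℝ] _)).hasFDerivAt.comp_hasDerivAt t (hU.hasDerivAt t))
  rw [eq_flow_of_hasDerivAt h1 t, hU.init]

theorem memLp_and_L2norm_eq {G : Type*} [NormedAddCommGroup G] [NormedSpace ℝ G] {T κ : ℝ}
    (F : Lp G 2 (volume.restrict (Set.Icc 0 T))) {f : ℝ → G}
    (hf : (fun t => κ • F t) =ᵐ[volume.restrict (Set.Icc 0 T)] f) :
    MemLp f 2 (volume.restrict (Set.Icc 0 T)) ∧ L2norm 0 T f = |κ| * ‖F‖ := by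
  have hF := Lp.memLp F
  refine ⟨(hF.const_smul κ).ae_eq hf, ?_⟩
  have h1 : ‖F‖ ^ 2 = ∫ t in Set.Icc 0 T, ‖F t‖ ^ 2 := by
    rw [Lp.norm_def, hF.eLpNorm_eq_integral_rpow_norm (by norm_num) (by norm_num)]
    have h0 : 0 ≤ ∫ t in Set.Icc 0 T, ‖F t‖ ^ 2 := by positivity
    simp only [ENNReal.toReal_ofNat, Real.rpow_ofNat]
    rw [ENNReal.toReal_ofReal (by positivity), ← Real.rpow_natCast, ← Real.rpow_mul h0]
    norm_num
  have h2 : ∫ t in Set.Icc 0 T, ‖f t‖ ^ 2 = (|κ| * ‖F‖) ^ 2 := by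
    rw [mul_pow, h1, ← integral_const_mul]
    refine integral_congr_ae (hf.mono fun t ht => ?_)
    simp only [← ht, norm_smul, mul_pow, Real.norm_eq_abs]
  rw [L2norm, h2, Real.sqrt_sq (by positivity)]

theorem dom_opA_le_opB (hdom : MapsDomIntoState A B C D ξ η) :
    (opA hdom).domain ≤ (opB ξ η).domain := le_rfl

/-- The observation of a solution is the observation of the rescaled system. -/
theorem opB_solution (hdom : MapsDomIntoState A B C D ξ η) {c : ℝ}
    (hgh : IsCoupling (B * C) c (coupling C ξ η) (coupling B η ξ)) (m : ℕ) {U₀ : StateSpace ξ η}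
    {U : ℝ → StateSpace ξ η} (hU : IsSolution (opA hdom) U₀ U) :
    MemLp (fun t => opB ξ η ⟨U t, dom_opA_le_opB hdom (hU.mem t)⟩) 2
      (volume.restrict (Set.Icc 0 (2 * Real.pi * m))) ∧
    L2norm 0 (2 * Real.pi * m) (fun t => opB ξ η ⟨U t, dom_opA_le_opB hdom (hU.mem t)⟩) =
      √(2 / Real.pi) * ‖obs (bessel_blockGen A D hgh m) (rescale ξ η U₀)‖ := by
  have hκ : √(2 / Real.pi) ≠ 0 := (Real.sqrt_pos.2 (by positivity)).ne'
  -- A solution stays in the domain, so the series for the point values converges at every time and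
  -- its sum can be identified with the `L²` limit.
  have h1 := obs_ae_eq (bessel_blockGen A D hgh m) (rescale ξ η U₀)
    (f := fun t => (√(2 / Real.pi))⁻¹ • opB ξ η ⟨U t, dom_opA_le_opB hdom (hU.mem t)⟩) (fun t => by
      have h2 := (hasSum_opB ⟨U t, dom_opA_le_opB hdom (hU.mem t)⟩).const_smul (√(2 / Real.pi))⁻¹
      simp only [inv_smul_smul₀ hκ, rescale_solution hdom hU] at h2
      exact h2)
  have h3 := memLp_and_L2norm_eq (κ := √(2 / Real.pi))
    (f := fun t => opB ξ η ⟨U t, dom_opA_le_opB hdom (hU.mem t)⟩)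
    (obs (bessel_blockGen A D hgh m) (rescale ξ η U₀)) (h1.mono fun t ht => by
      simp only [ht, smul_inv_smul₀ hκ])
  rwa [abs_of_nonneg (Real.sqrt_nonneg _)] at h3

theorem hypH3_opA (hdom : MapsDomIntoState A B C D ξ η) : HypH3 (opA hdom) (opB ξ η) := by
  obtain ⟨c, hgh⟩ := exists_isCoupling hdom
  refine ⟨dom_opA_le_opB hdom, 0, 2 * Real.pi * (1 : ℕ),
    √(2 / Real.pi) * ‖obs (bessel_blockGen A D hgh 1)‖, by positivity, fun U₀ _ U hU => ?_⟩
  obtain ⟨h1, h2⟩ := opB_solution hdom hgh 1 hU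
  refine ⟨h1, ?_⟩
  have h3 := (obs (bessel_blockGen A D hgh 1)).le_opNorm (rescale ξ η U₀)
  rw [(rescale ξ η).norm_map] at h3
  exact (h2.trans_le (mul_le_mul_of_nonneg_left h3 (Real.sqrt_nonneg _))).trans_eq
    (mul_assoc _ _ _).symm

theorem hypH4_opA (hdom : MapsDomIntoState A B C D ξ η) (hgen : Generic A D (B * C)) :
    HypH4 (opA hdom) (opB ξ η) := by
  obtain ⟨c, hgh⟩ := exists_isCoupling hdom
  obtain ⟨m, hm, R, hR, H⟩ := exists_observability_blockGen hgen hgh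
  have hκ : 0 < √(2 / Real.pi) := Real.sqrt_pos.2 (by positivity)
  refine ⟨dom_opA_le_opB hdom, 0, 2 * Real.pi * m, R / √(2 / Real.pi), by positivity, by positivity,
    fun U₀ _ U hU => ?_⟩
  obtain ⟨h1, h2⟩ := opB_solution hdom hgh m hU
  refine ⟨h1, ?_⟩
  rw [h2, ← (rescale ξ η).norm_map U₀]
  refine (H (rescale ξ η U₀)).trans_eq ?_
  field_simp

theorem norm_hasSum_le {G : Type*} [NormedAddCommGroup G] {f : ℕ+ → G} {x : G} {R : ℝ} (hR : 0 ≤ R)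
    (hf : HasSum f x) (v : lp (fun _ : ℕ+ => EuclideanSpace ℝ (Fin 4)) 2)
    (h : ∀ k, ‖f k‖ ≤ R * ((1 / (k : ℝ)) * ‖v k‖)) :
    ‖x‖ ≤ R * √(∑' k : ℕ+, (1 / (k : ℝ)) ^ 2) * ‖v‖ := by
  refine le_of_tendsto hf.norm (Eventually.of_forall fun s => ?_)
  calc ‖∑ k ∈ s, f k‖ ≤ ∑ k ∈ s, R * ((1 / (k : ℝ)) * ‖v k‖) := norm_sum_le_of_le s fun k _ => h k
    _ = R * ∑ k ∈ s, (1 / (k : ℝ)) * ‖v k‖ := by rw [Finset.mul_sum]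
    _ ≤ R * (√(∑ k ∈ s, (1 / (k : ℝ)) ^ 2) * √(∑ k ∈ s, ‖v k‖ ^ 2)) := by
        gcongr
        exact Real.sum_mul_le_sqrt_mul_sqrt s _ _
    _ ≤ R * (√(∑' k : ℕ+, (1 / (k : ℝ)) ^ 2) * ‖v‖) := by
        gcongr
        · exact summable_one_div_pnat_sq.sum_le_tsum s fun _ _ => by positivity
        · refine Real.sqrt_le_iff.2 ⟨norm_nonneg _, ?_⟩
          rw [ell2_norm_sq]
          exact (ell2_summable v).sum_le_tsum s fun _ _ => by positivity
    _ = _ := by ring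

/-- Each position is at most `1 / k` times the block of `𝒜* U`, up to a constant, and Cauchy–Schwarz
sums the point values. -/
theorem hypH2_opA (hdom : MapsDomIntoState A B C D ξ η) (hgen : Generic A D (B * C)) :
    HypH2 (opA hdom) (opB ξ η) := by
  obtain ⟨c, hgh⟩ := exists_isCoupling hdom
  obtain ⟨R, hR, H⟩ := exists_generator_estimate hgen hgh
  refine ⟨dom_opA_le_opB hdom, √(2 / Real.pi) * (2 * R) * √(∑' k : ℕ+, (1 / (k : ℝ)) ^ 2),
    fun U => ?_⟩
  rw [← (rescale ξ η).norm_map (opA hdom U)]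
  refine norm_hasSum_le (by positivity) (hasSum_opB ⟨U.1, dom_opA_le_opB hdom U.2⟩) _ fun k => ?_
  obtain ⟨h1, h2⟩ := H k _ _ (rescale_opA hdom U k).symm
  have hk := pnat_pos k
  have h3 : |rescale ξ η U.1 k 0 - 0| ≤ 1 / (k : ℝ) * (R * ‖rescale ξ η (opA hdom U) k‖) := by
    rw [sub_zero, one_div, ← div_eq_inv_mul, le_div_iff₀ hk]
    linarith
  have h4 : |rescale ξ η U.1 k 1 - 0| ≤ 1 / (k : ℝ) * (R * ‖rescale ξ η (opA hdom U) k‖) := by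
    rw [sub_zero, one_div, ← div_eq_inv_mul, le_div_iff₀ hk]
    have h5 : (k : ℝ) * |rescale ξ η U.1 k 1| ≤ (k : ℝ) ^ 2 * |rescale ξ η U.1 k 1| := by
      gcongr
      exact le_self_pow₀ (one_le_pnat k) two_ne_zero
    linarith
  have h5 := norm_posProj_sub_le h3 h4
  have h6 : (!₂[(0 : ℝ), 0] : EuclideanSpace ℝ (Fin 2)) = 0 := by ext i; fin_cases i <;> rfl
  rw [h6, sub_zero] at h5
  rw [norm_smul, Real.norm_eq_abs, abs_of_nonneg (Real.sqrt_nonneg _), mul_assoc (√(2 / Real.pi))]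
  gcongr
  exact h5.trans_eq (by ring)

end Observe

/-! ### Genericity -/

/-- For fixed `A`, `D` and `B ≠ 0` exactly one value of `C` is excluded; Fubini does the rest. -/
theorem ae_mul_ne {φ : ℝ × ℝ → ℝ} (hφ : Measurable φ) {q : ℝ} (hq : q ≠ 0) :
    ∀ᵐ x : ℝ × ℝ × ℝ × ℝ, φ (x.1, x.2.2.2) ≠ q * (x.2.1 * x.2.2.1) := by
  have hne : ∀ x₀ : ℝ, ∀ᵐ x : ℝ, x ≠ x₀ := fun x₀ => by simp [ae_iff, measure_singleton]
  have hm : MeasurableSet {x : ℝ × ℝ × ℝ × ℝ | φ (x.1, x.2.2.2) ≠ q * (x.2.1 * x.2.2.1)} :=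
    (measurableSet_eq_fun (by fun_prop) (by fun_prop)).compl
  rw [Measure.volume_eq_prod, Measure.ae_prod_iff_ae_ae hm]
  refine Eventually.of_forall fun a => ?_
  have hm2 : MeasurableSet {x : ℝ × ℝ × ℝ | φ (a, x.2.2) ≠ q * (x.1 * x.2.1)} :=
    (measurableSet_eq_fun (by fun_prop) (by fun_prop)).compl
  rw [Measure.volume_eq_prod, Measure.ae_prod_iff_ae_ae hm2]
  filter_upwards [hne 0] with b hb
  have hm3 : MeasurableSet {x : ℝ × ℝ | φ (a, x.1) ≠ q * (b * x.2)} :=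
    (measurableSet_eq_fun (by fun_prop) (by fun_prop)).compl
  have h1 : ∀ᵐ x : ℝ × ℝ, φ (a, x.1) ≠ q * (b * x.2) := by
    rw [Measure.volume_eq_prod, Measure.ae_prod_iff_ae_ae hm3]
    refine Eventually.of_forall fun d => ?_
    filter_upwards [hne (φ (a, d) / (q * b))] with e he hcon
    apply he
    rw [hcon]
    field_simp
  -- The inner variables were taken in the order `(D, C)`, to integrate over `C` first; the swap
  -- restores `(C, D)`.
  rw [Measure.volume_eq_prod] at h1 ⊢
  exact Measure.measurePreserving_swap.quasiMeasurePreserving.ae h1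

/-- Both clauses are countable families of the form `φ(A, D) ≠ q BC`. For the second, `q` is the
square of a difference of traces, in which `A` and `D` cancel, and `k² + k⁴` is injective on
positive integers. The exceptional null set depends on neither `ξ` nor `η`. -/
theorem ae_generic : ∀ᵐ x : ℝ × ℝ × ℝ × ℝ, Generic x.1 x.2.2.2 (x.2.1 * x.2.2.1) := by
  have h1 : ∀ᵐ x : ℝ × ℝ × ℝ × ℝ, ∀ k : ℕ+,
      ((k : ℝ) ^ 2 + x.1) * ((k : ℝ) ^ 4 + x.2.2.2) ≠ x.2.1 * x.2.2.1 := by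
    rw [ae_all_iff]
    intro k
    have h := ae_mul_ne (φ := fun y => ((k : ℝ) ^ 2 + y.1) * ((k : ℝ) ^ 4 + y.2)) (by fun_prop)
      one_ne_zero
    simpa using h
  have h2 : ∀ᵐ x : ℝ × ℝ × ℝ × ℝ, ∀ j k : ℕ+, j ≠ k → ∀ a b a' b' : ℝ, a = (k : ℝ) ^ 2 + x.1 →
      b = (k : ℝ) ^ 4 + x.2.2.2 → a' = (j : ℝ) ^ 2 + x.1 → b' = (j : ℝ) ^ 4 + x.2.2.2 →
      (a' * b' - a * b + (a + b - a' - b') * a) * (a' * b' - a * b + (a + b - a' - b') * b) ≠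
        (a + b - a' - b') ^ 2 * (x.2.1 * x.2.2.1) := by
    rw [ae_all_iff]
    intro j
    rw [ae_all_iff]
    intro k
    by_cases hjk : j = k
    · exact Eventually.of_forall fun _ h => absurd hjk h
    have hq : ((k : ℝ) ^ 2 + (k : ℝ) ^ 4 - (j : ℝ) ^ 2 - (j : ℝ) ^ 4) ^ 2 ≠ 0 := by
      refine pow_ne_zero 2 fun hcon => hjk ?_
      have hf : ((k : ℝ) - j) * (((k : ℝ) + j) * (1 + (k : ℝ) ^ 2 + (j : ℝ) ^ 2)) = 0 := by
        linear_combination hcon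
      have hpos : 0 < ((k : ℝ) + j) * (1 + (k : ℝ) ^ 2 + (j : ℝ) ^ 2) := by
        have := pnat_pos k
        have := pnat_pos j
        positivity
      have he : (k : ℝ) = j := sub_eq_zero.1 ((mul_eq_zero.1 hf).resolve_right hpos.ne')
      exact PNat.coe_injective (by exact_mod_cast he.symm)
    have h := ae_mul_ne (q := ((k : ℝ) ^ 2 + (k : ℝ) ^ 4 - (j : ℝ) ^ 2 - (j : ℝ) ^ 4) ^ 2)
      (φ := fun y => (((j : ℝ) ^ 2 + y.1) * ((j : ℝ) ^ 4 + y.2) -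
          ((k : ℝ) ^ 2 + y.1) * ((k : ℝ) ^ 4 + y.2) +
        ((k : ℝ) ^ 2 + (k : ℝ) ^ 4 - (j : ℝ) ^ 2 - (j : ℝ) ^ 4) * ((k : ℝ) ^ 2 + y.1)) *
        (((j : ℝ) ^ 2 + y.1) * ((j : ℝ) ^ 4 + y.2) -
          ((k : ℝ) ^ 2 + y.1) * ((k : ℝ) ^ 4 + y.2) +
        ((k : ℝ) ^ 2 + (k : ℝ) ^ 4 - (j : ℝ) ^ 2 - (j : ℝ) ^ 4) * ((k : ℝ) ^ 4 + y.2)))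
      (by fun_prop) hq
    filter_upwards [h] with x hx _ a b a' b' ha hb ha' hb' hcon
    apply hx
    have e : a + b - a' - b' = (k : ℝ) ^ 2 + (k : ℝ) ^ 4 - (j : ℝ) ^ 2 - (j : ℝ) ^ 4 := by
      rw [ha, hb, ha', hb']; ring
    rw [e, ha, hb, ha', hb'] at hcon
    exact hcon
  filter_upwards [h1, h2] with x hx1 hx2
  exact ⟨hx1, hx2⟩

end StringBeam

end

/-! ### The main theorem -/

open StringBeam in
theorem proposition3p1 (ξ η : IrrPoint) :
    (∀ (A B C D : ℝ) (h : MapsDomIntoState A B C D ξ η),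
      HypH1 (opA h) ∧ HypH3 (opA h) (opB ξ η)) ∧
    (∀ᵐ p : ℝ × ℝ × ℝ × ℝ, ∀ A B C D : ℝ, p = (A, B, C, D) →
      ∀ h : MapsDomIntoState A B C D ξ η,
        HypH1 (opA h) ∧ HypH2 (opA h) (opB ξ η) ∧
        HypH3 (opA h) (opB ξ η) ∧ HypH4 (opA h) (opB ξ η)) := by
  refine ⟨fun A B C D h => ⟨hypH1_opA h, hypH3_opA h⟩, ?_⟩
  filter_upwards [ae_generic] with p hp A B C D hpe h
  subst hpe
  exact ⟨hypH1_opA h, hypH2_opA h hp, hypH3_opA h, hypH4_opA h hp⟩
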